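/- **Model.** Let $n=3t+1$ with $t\ge 0$, and let $\mathbb V$ be any set. The $n$ parties communicate over asynchronous, authenticated point-to-point links. The local state of a party consists of its input $v_i\in\mathbb V$ and the sequence of its local events (messages sent and received, decisions, results of coin accesses). An algorithm prescribes the next local step of each party as a function of its local state; a local step sends messages, decides on a value of $\mathbb V$, or accesses a common coin. Cryptography is ideal: messages are built from numbers, values of $\mathbb V$, signatures and threshold signatures (on a message, obtained by combining the signatures of a given number of distinct parties on it), and nobody can produce a signature of an uncorrupted party unless a message containing it is known to him. The algorithm may use a sequence of independent common coins with distributions on $\mathbb N$ of its choice; the value of a coin is sampled at the first access to it, and a coin can be accessed only by someone who holds shares (signatures on the name of the coin) of $t+1$ distinct parties. A strong adaptive adversary chooses every event as a function of the complete history, including all local states: which party takes a local step, which pending message is delivered, which party to corrupt (on the fly, at most $t$ in total), and what corrupted parties send and which coins they access; corrupted parties deviate arbitrarily and pool their knowledge. In every execution each honest (never corrupted) party must take infinitely many local steps and each message sent to an honest party must eventually be delivered. Inputs together with such a strategy determine an *ensemble*: a tree of configurations, branching at coin accesses, with the probability measure on its paths (executions) for which the probability to pass through a node is the product of the edge weights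 leading to it. Let $f$ be the maximal number of parties corrupted in any path of the ensemble, $\mathcal V_{in}$ the multiset of all $n$ inputs, and $\mathrm{max\_mult}(\mathcal V_{in})$ the largest multiplicity of a value in it. The rounds of an execution are defined by cutting it greedily into consecutive segments, each ending as soon as every uncorrupted party has taken a local step in the segment and all messages between uncorrupted parties that were sent before the segment have been delivered. The length of a message in words is the number of numbers (including coin names), values and signatures in it. **Theorem.** There is a constant $C$ such that for every $t\ge 0$ and every $\mathbb V$ there is an algorithm for $n=3t+1$ parties all of whose ensembles, against a strong adaptive adversary, satisfy: * *Agreement:* in every path, all honest parties that decide output the same value. * *Probabilistic Termination:* every honest party decides with probability $1$. * *Qualitative Validity:* if $\mathrm{max\_mult}(\mathcal V_{in})-f\ge 2t+1$, then in every path all honest parties that decide output values in $\mathcal V_{in}$; otherwise the probability that the honest parties decide on a value in $\mathcal V_{in}$ is at least $1-\frac{f}{n-t}$. * *Complexity:* the expected number of rounds until all honest parties have decided is at most $C$; the expected total number of messages sent by honest parties during the whole execution is at most $Cn^2$, and so is the expected total number of words in these messages. -/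

import Mathlib

open MeasureTheory ProbabilityTheory
open scoped ENNReal NNReal

universe u

noncomputable section

namespace AsyncBA

/-! ### Parties, messages, unforgeable signatures -/

/-- The `n = 3t + 1` parties. -/
abbrev Party (t : ℕ) : Type := Fin (3 * t + 1)

/-- Message contents: symbolic terms over numbers, values of the domain `V`, signatures and
threshold signatures. `sig i m` is party `i`'s signature on `m` (sent together with `m`);
`tsig k m` is a threshold signature on `m`, combined from the signatures of `k` parties.
`coin k` names the `k`-th common coin; `sig i (coin k)` is party `i`'s share of that coin. -/
inductive Msg (t : ℕ) (V : Type u) : Type u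
  | nat : ℕ → Msg t V
  | val : V → Msg t V
  | coin : ℕ → Msg t V
  | pair : Msg t V → Msg t V → Msg t V
  | sig : Party t → Msg t V → Msg t V
  | tsig : ℕ → Msg t V → Msg t V

/-- Length of a message in words: the number of numbers, values and signatures in it. -/
def Msg.words {t : ℕ} {V : Type u} : Msg t V → ℕ
  | .nat _ => 1
  | .val _ => 1
  | .coin _ => 1
  | .pair a b => a.words + b.words
  | .sig _ m => m.words + 1
  | .tsig _ m => m.words + 1

/-- `Derivable K S m`: someone who knows the messages in `S` and the signing keys of the parties
in `K` can produce `m`. There is no way to produce a signature of a party outside `K` other than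
to extract it from a known message. -/
inductive Derivable {t : ℕ} {V : Type u} (K : Set (Party t)) (S : Set (Msg t V)) : Msg t V → Prop
  | known {m : Msg t V} : m ∈ S → Derivable K S m
  | nat (k : ℕ) : Derivable K S (.nat k)
  | val (v : V) : Derivable K S (.val v)
  | coin (k : ℕ) : Derivable K S (.coin k)
  | pair {a b : Msg t V} : Derivable K S a → Derivable K S b → Derivable K S (.pair a b)
  | fst {a b : Msg t V} : Derivable K S (.pair a b) → Derivable K S a
  | snd {a b : Msg t V} : Derivable K S (.pair a b) → Derivable K S b
  | sign {i : Party t} {m : Msg t V} : i ∈ K → Derivable K S m → Derivable K S (.sig i m)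
  | openSig {i : Party t} {m : Msg t V} : Derivable K S (.sig i m) → Derivable K S m
  | combine {k : ℕ} {m : Msg t V} (Q : Finset (Party t)) : k ≤ Q.card → Derivable K S m →
      (∀ i ∈ Q, Derivable K S (.sig i m)) → Derivable K S (.tsig k m)
  | openTsig {k : ℕ} {m : Msg t V} : Derivable K S (.tsig k m) → Derivable K S m

/-- The value of the `k`-th common coin is accessible to whoever can combine the shares of
`t + 1` parties. -/
def CanToss {t : ℕ} {V : Type u} (K : Set (Party t)) (S : Set (Msg t V)) (k : ℕ) : Prop :=
  Derivable K S (.tsig (t + 1) (.coin k))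

/-! ### Algorithms -/

/-- What a party does in one local step: send messages to parties (nothing, if the list is empty),
decide on a value, or access a common coin. -/
inductive Action (t : ℕ) (V : Type u) : Type u
  | send : List (Party t × Msg t V) → Action t V
  | decide : V → Action t V
  | toss : ℕ → Action t V

/-- The local events that make up a local state. `tossed k none` is an access to coin `k`
without sufficiently many shares. -/
inductive LocalEvent (t : ℕ) (V : Type u) : Type u
  | sent : List (Party t × Msg t V) → LocalEvent t V
  | decided : V → LocalEvent t V
  | tossed : ℕ → Option ℕ → LocalEvent t V
  | received : Party t → Msg t V → LocalEvent t V

/-- A randomized algorithm: the action of each party as a function of its local state (its input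
and the sequence of its local events, latest first), and the distribution of each common coin. -/
structure Algorithm (t : ℕ) (V : Type u) : Type u where
  act : Party t → V → List (LocalEvent t V) → Action t V
  coinLaw : ℕ → PMF ℕ

/-! ### Configurations and moves of the adversary -/

/-- A message that was sent; `honest` records whether the sender was uncorrupted at that time. -/
structure Packet (t : ℕ) (V : Type u) : Type u where
  src : Party t
  dst : Party t
  msg : Msg t V
  honest : Bool

/-- A configuration: inputs and local events (together the local states), all messages sent so
far, the positions in that list of those delivered (the others are pending), the states of the
common coins, and the set of corrupted parties. -/
structure Config (t : ℕ) (V : Type u) : Type u where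
  input : Party t → V
  events : Party t → List (LocalEvent t V)
  net : List (Packet t V)
  delivered : Finset ℕ
  coins : ℕ → Option ℕ
  corrupted : Finset (Party t)

/-- The choices of the adversary: which party takes a local step, which message is delivered, who
is corrupted, and which messages corrupted parties send and which coins they access. -/
inductive Move (t : ℕ) (V : Type u) : Type u
  | step : Party t → Move t V
  | deliver : ℕ → Move t V
  | corrupt : Party t → Move t V
  | inject : Party t → Party t → Msg t V → Move t V
  | peek : ℕ → Move t V

namespace Config

variable {t : ℕ} {V : Type u}

/-- The initial configuration with the given inputs. -/
def init (input : Party t → V) : Config t V where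
  input := input
  events := fun _ => []
  net := []
  delivered := ∅
  coins := fun _ => none
  corrupted := ∅

/-- Append a local event to the local state of party `i`. -/
def record (c : Config t V) (i : Party t) (e : LocalEvent t V) : Config t V :=
  { c with events := Function.update c.events i (e :: c.events i) }

/-- The messages that party `i` has received. -/
def received (c : Config t V) (i : Party t) : Set (Msg t V) :=
  {m | ∃ j, LocalEvent.received j m ∈ c.events i}

/-- The contents of all messages sent so far; all of this is known to the adversary. -/
def traffic (c : Config t V) : Set (Msg t V) := {m | ∃ p ∈ c.net, p.msg = m}

/-- Access coin `k`: the first access samples its value, later ones return the same value. -/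
def flip (A : Algorithm t V) (c : Config t V) (k : ℕ) : PMF (ℕ × Config t V) :=
  match c.coins k with
  | some r => PMF.pure (r, c)
  | none => (A.coinLaw k).map fun r =>
      (r, { c with coins := Function.update c.coins k (some r) })

open Classical in
/-- A local step of an honest party `i`, as prescribed by the algorithm. Messages that the party
is not able to produce from its own key and what it has received are not sent. -/
def localStep (A : Algorithm t V) (c : Config t V) (i : Party t) : PMF (Config t V) :=
  match A.act i (c.input i) (c.events i) with
  | .send l =>
      let out : List (Packet t V) :=
        (l.filter fun p => decide (Derivable {i} (c.received i) p.2)).map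
          fun p => ⟨i, p.1, p.2, true⟩
      PMF.pure ({ c with net := c.net ++ out }.record i (.sent l))
  | .decide v => PMF.pure (c.record i (.decided v))
  | .toss k =>
      if CanToss {i} (c.received i) k then
        (c.flip A k).map fun x => x.2.record i (.tossed k (some x.1))
      else PMF.pure (c.record i (.tossed k none))

open Classical in
/-- The effect of a move of the adversary. Moves that are not allowed have no effect. At most `t`
parties can be corrupted. Corrupted parties pool their keys and know all messages ever sent. -/
def next (A : Algorithm t V) (c : Config t V) : Move t V → PMF (Config t V)
  | .step i => if i ∈ c.corrupted then PMF.pure c else c.localStep A i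
  | .deliver k =>
      match c.net[k]? with
      | some p =>
          if k ∈ c.delivered then PMF.pure c
          else PMF.pure ({ c with delivered := insert k c.delivered }.record p.dst
            (.received p.src p.msg))
      | none => PMF.pure c
  | .corrupt i =>
      if c.corrupted.card < t then PMF.pure { c with corrupted := insert i c.corrupted }
      else PMF.pure c
  | .inject i j m =>
      if i ∈ c.corrupted ∧ Derivable (c.corrupted : Set (Party t)) c.traffic m then
        PMF.pure { c with net := c.net ++ [⟨i, j, m, false⟩] }
      else PMF.pure c
  | .peek k =>
      if CanToss (c.corrupted : Set (Party t)) c.traffic k then (c.flip A k).map Prod.snd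
      else PMF.pure c

end Config

/-! ### Ensembles -/

/-- A node of the tree of executions: a configuration together with the configurations that lead
to it from the root (latest first). -/
structure Node (t : ℕ) (V : Type u) : Type u where
  cur : Config t V
  past : List (Config t V)

instance {t : ℕ} {V : Type u} : MeasurableSpace (Node t V) := ⊤

/-- A strategy of a strong adaptive adversary: its next move is an arbitrary function of the
complete history, including all local states. -/
abbrev Strategy (t : ℕ) (V : Type u) : Type u := Node t V → Move t V

variable {t : ℕ} {V : Type u}

/-- The children of a node, with the weights of the edges that lead to them. -/
def children (A : Algorithm t V) (σ : Strategy t V) (x : Node t V) : PMF (Node t V) :=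
  (x.cur.next A (σ x)).map fun c => ⟨c, x.cur :: x.past⟩

/-- `ω` is a path of the tree that starts in the initial configuration with the given inputs. -/
def IsTreePath (A : Algorithm t V) (input : Party t → V) (σ : Strategy t V)
    (ω : ℕ → Node t V) : Prop :=
  ω 0 = ⟨Config.init input, []⟩ ∧ ∀ s, ω (s + 1) ∈ (children A σ (ω s)).support

/-- Party `i` is never corrupted in `ω`. -/
def HonestIn (ω : ℕ → Node t V) (i : Party t) : Prop := ∀ s, i ∉ (ω s).cur.corrupted

/-- Fairness: every honest party takes infinitely many local steps and every message sent to an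
honest party is eventually delivered. -/
def IsFair (σ : Strategy t V) (ω : ℕ → Node t V) : Prop :=
  (∀ i, HonestIn ω i → ∀ s, ∃ s', s ≤ s' ∧ σ (ω s') = .step i) ∧
  ∀ s k p, (ω s).cur.net[k]? = some p → HonestIn ω p.dst → ∃ s', k ∈ (ω s').cur.delivered

/-- An ensemble of the algorithm `A`: inputs and an adversary strategy all of whose executions
are legal (fair). -/
structure Ensemble (A : Algorithm t V) : Type u where
  input : Party t → V
  strategy : Strategy t V
  fair : ∀ ω, IsTreePath A input strategy ω → IsFair strategy ω

namespace Ensemble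

variable {A : Algorithm t V} (E : Ensemble A)

/-- The paths (executions) of the ensemble. -/
def IsPath (ω : ℕ → Node t V) : Prop := IsTreePath A E.input E.strategy ω

/-- One step down the tree, as a Markov kernel. -/
def stepKernel : Kernel (Node t V) (Node t V) where
  toFun x := (children A E.strategy x).toMeasure
  measurable' := measurable_from_top

instance : IsMarkovKernel E.stepKernel :=
  ⟨fun x => inferInstanceAs (IsProbabilityMeasure (children A E.strategy x).toMeasure)⟩

/-- The transition from the first `s + 1` nodes of a path to the next node. -/
def transition (s : ℕ) : Kernel (Finset.Iic s → Node t V) (Node t V) :=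
  E.stepKernel.comap (fun h => h ⟨s, Finset.mem_Iic.2 le_rfl⟩) (measurable_pi_apply _)

instance (s : ℕ) : IsMarkovKernel (E.transition s) :=
  inferInstanceAs (IsMarkovKernel (E.stepKernel.comap _ _))

/-- The probability measure of the ensemble: the set of paths through a node has as its
probability the product of the weights along the way from the root to that node. -/
def law : Measure (ℕ → Node t V) :=
  Kernel.traj (X := fun _ => Node t V) E.transition 0 fun _ => ⟨Config.init E.input, []⟩

/-- `f`: the maximal number of parties that are corrupted in any of the paths. -/
def faults : ℕ := sSup {k | ∃ ω, E.IsPath ω ∧ ∃ s, k = (ω s).cur.corrupted.card}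

/-- The multiset of all input values. -/
def inputs : Multiset V := Finset.univ.val.map E.input

end Ensemble

/-! ### Byzantine Agreement -/

/-- Party `i` has decided on `v` within the first `s` events of `ω`. -/
def DecidedBy (ω : ℕ → Node t V) (i : Party t) (v : V) (s : ℕ) : Prop :=
  LocalEvent.decided v ∈ (ω s).cur.events i

/-- Party `i` decides on `v` in `ω`. -/
def Decides (ω : ℕ → Node t V) (i : Party t) (v : V) : Prop := ∃ s, DecidedBy ω i v s

/-- In every path, all honest parties that decide output the same value. -/
def Agreement {A : Algorithm t V} (E : Ensemble A) : Prop :=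
  ∀ ω, E.IsPath ω → ∀ i j v w, HonestIn ω i → HonestIn ω j →
    Decides ω i v → Decides ω j w → v = w

/-- Every honest party decides with probability 1. -/
def ProbabilisticTermination {A : Algorithm t V} (E : Ensemble A) : Prop :=
  ∀ᵐ ω ∂E.law, ∀ i, HonestIn ω i → ∃ v, Decides ω i v

open Classical in
/-- The maximum multiplicity of a value in a multiset. -/
def maxMult (M : Multiset V) : ℕ := M.toFinset.sup fun v => M.count v

/-- If `maxMult - f ≥ 2t + 1`, then honest parties decide on input values only; otherwise they
decide on an input value with probability at least `1 - f / (n - t)`. -/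
def QualitativeValidity {A : Algorithm t V} (E : Ensemble A) : Prop :=
  (2 * t + 1 + E.faults ≤ maxMult E.inputs →
    ∀ ω, E.IsPath ω → ∀ i v, HonestIn ω i → Decides ω i v → v ∈ E.inputs) ∧
  (maxMult E.inputs < 2 * t + 1 + E.faults →
    1 - (E.faults : ℝ) / (((3 * t + 1 : ℕ) : ℝ) - t) ≤
      E.law.real {ω | ∀ i, HonestIn ω i → ∃ v ∈ E.inputs, Decides ω i v})

/-! ### Complexity -/

/-- The events `a, …, b - 1` of `ω` complete an asynchronous round: every honest party has taken a
local step, and all messages among honest parties that were sent before are delivered. -/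
def RoundOver (σ : Strategy t V) (ω : ℕ → Node t V) (a b : ℕ) : Prop :=
  (∀ i ∉ (ω b).cur.corrupted, ∃ s, a ≤ s ∧ s < b ∧ σ (ω s) = .step i) ∧
  ∀ k p, (ω a).cur.net[k]? = some p → p.src ∉ (ω b).cur.corrupted →
    p.dst ∉ (ω b).cur.corrupted → k ∈ (ω b).cur.delivered

open Classical in
/-- The starting point of the current round and the number of completed rounds after `s` events,
where the execution is cut greedily into consecutive rounds. -/
def roundState (σ : Strategy t V) (ω : ℕ → Node t V) : ℕ → ℕ × ℕ
  | 0 => (0, 0)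
  | s + 1 =>
      let x := roundState σ ω s
      if RoundOver σ ω x.1 (s + 1) then (s + 1, x.2 + 1) else x

open Classical in
/-- The number of asynchronous rounds (begun) until all honest parties have decided. -/
def roundsToDecide (σ : Strategy t V) (ω : ℕ → Node t V) : ℝ≥0∞ :=
  ⨆ s, if ∃ i, HonestIn ω i ∧ ¬ ∃ v, DecidedBy ω i v s
    then (((roundState σ ω s).2 + 1 : ℕ) : ℝ≥0∞) else 0

/-- The messages sent by honest parties up to a configuration. -/
def honestMessages (c : Config t V) : List (Msg t V) :=
  (c.net.filter fun p => p.honest).map fun p => p.msg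

/-- The total number of messages that honest parties send in `ω`. -/
def messagesSent (ω : ℕ → Node t V) : ℝ≥0∞ :=
  ⨆ s, ((honestMessages (ω s).cur).length : ℝ≥0∞)

/-- The total number of words in the messages that honest parties send in `ω`. -/
def wordsSent (ω : ℕ → Node t V) : ℝ≥0∞ :=
  ⨆ s, (((honestMessages (ω s).cur).map Msg.words).sum : ℝ≥0∞)

end AsyncBA

end

/-! The algorithm runs in views. Inputs are signed first: `t + 1` signatures on one value certify it
as an input, and `t + 1` reports of having seen no such certificate open view 0 to every value. In a
view each party proposes a value, gathers `2t + 1` acknowledgements into a certificate, and then `2t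
+ 1` confirmations that this certificate is held. Whoever sees `2t + 1` confirmed proposers asks to
end the proposals; on `t + 1` such requests a party abandons them, that is, it stops acknowledging
and confirming. Coin shares are released only after `2t + 1` parties have abandoned. The coin elects
a uniform leader. Parties vote for the leader's certified value, or cast an empty vote backed by a
proof that `2t + 1` parties declared this certificate absent. A quorum of votes for one value
decides it; the absence proof, together with a quorum of empty votes or the leader's certificate,
opens the next view and fixes the values legitimate there.

Safety rests on two facts: a party signs at most one value per slot (`WF.issued_unique`), and any
two quorums share an uncorrupted party (`Inv.issued_both`). A quorum of votes for `v` thus excludes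
a quorum of empty votes and a certificate of the leader for another value, so `v` is the only
legitimate value later (`Inv.valid_after_vote`), which gives agreement.

A quorum of confirmations for the leader excludes an absence proof (`Inv.not_held`), so a new view
is entered only if the previous leader was not confirmed. When a coin becomes accessible, `2t + 1`
of the `3t + 1` parties are already confirmed (`Inv.of_coin`), so a fresh coin misses them with
probability at most `t / (3t + 1)`, whatever the adversary does. The supermartingale `failureBound`
turns this into an expectation of at most 1/2 failed views. A view lasts at most 44 rounds
(`decided_or_inView`) and costs `O(n)` messages per party (`WF.sentCount_le'`), whence termination
and the complexity bounds.

For validity, a party uncorrupted when the coin becomes accessible can only be certified for an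
input value, even if it is corrupted after its election: a quorum has abandoned, so its
acknowledgements are frozen (`Clean`, `Inv.clean_of_coin`). The probability `r` of electing an
unclean leader before a confirmed one thus obeys `r ≤ f / n + (t / n) r`, that is, `r ≤ f / (n -
t)`; `lossBound` is the corresponding supermartingale. If one value is frequent enough, no
uncorrupted party ever reports mixed inputs, and only inputs are legitimate (`Inv.not_sound_echo`).
-/

noncomputable section

/-! ### The protocol as a set of rules on local logs, and the uniqueness of signed statements. -/

namespace AsyncBA

variable {t : ℕ} {V : Type u}

/-! ### Slots and statements

A party speaks at most once in each of its slots. Speaking in a slot means signing a statement that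
consists of the name of the slot and possibly a value. -/

/-- The slots of a party: signing its input, reporting on the inputs, and for every view `j`:
proposing a value, acknowledging the proposal of `p`, distributing the certificate of its own
proposal, confirming to hold the certificate of `p`, distributing the confirmations, asking to end
the proposals, abandoning the proposals, releasing its share of the coin, declaring the certificate
of the leader absent, and voting. -/
inductive Slot (t : ℕ) : Type
  | inp
  | echo
  | prop (j : ℕ)
  | ack (j : ℕ) (p : Party t)
  | cert (j : ℕ)
  | hold (j : ℕ) (p : Party t)
  | done (j : ℕ)
  | skip (j : ℕ)
  | aband (j : ℕ)
  | share (j : ℕ)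
  | absent (j : ℕ)
  | vote (j : ℕ)
  deriving DecidableEq

/-- The slot as three numbers. -/
def Slot.code : Slot t → ℕ × ℕ × ℕ
  | .inp => (0, 0, 0)
  | .echo => (1, 0, 0)
  | .prop j => (2, j, 0)
  | .ack j p => (3, j, p)
  | .cert j => (4, j, 0)
  | .hold j p => (5, j, p)
  | .done j => (6, j, 0)
  | .skip j => (7, j, 0)
  | .aband j => (8, j, 0)
  | .share j => (9, j, 0)
  | .absent j => (10, j, 0)
  | .vote j => (11, j, 0)

lemma Slot.code_injective : Function.Injective (Slot.code (t := t)) := by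
  intro s s' h
  cases s <;> cases s' <;> simp only [Slot.code, Prod.mk.injEq] at h <;>
    first
      | rfl
      | (exfalso; omega)
      | (obtain ⟨-, h, -⟩ := h; rw [h]; done)
      | (obtain ⟨-, h, h'⟩ := h; rw [h, Fin.ext h'])

/-- The statement for slot `s` with the value `o`. -/
def stmt (s : Slot t) (o : Option V) : Msg t V :=
  .pair (.pair (.nat s.code.1) (.pair (.nat s.code.2.1) (.nat s.code.2.2)))
    (o.elim (.nat 0) .val)

/-- Domain separation: a signature given for one slot or value cannot be reused for another. -/
lemma stmt_inj {s s' : Slot t} {o o' : Option V} : stmt s o = stmt s' o' ↔ s = s' ∧ o = o' := by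
  constructor
  · intro h
    simp only [stmt, Msg.pair.injEq, Msg.nat.injEq] at h
    refine ⟨Slot.code_injective (Prod.ext h.1.1 (Prod.ext h.1.2.1 h.1.2.2)), ?_⟩
    cases o <;> cases o' <;> simp_all
  · rintro ⟨rfl, rfl⟩
    rfl

lemma stmt_ne_coin {s : Slot t} {o : Option V} {j : ℕ} : stmt s o ≠ .coin j := by
  simp [stmt]

lemma words_stmt (s : Slot t) (o : Option V) : (stmt s o).words = 4 := by
  cases o <;> simp [stmt, Msg.words]

lemma derivable_stmt (K : Set (Party t)) (S : Set (Msg t V)) (s : Slot t) (o : Option V) :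
    Derivable K S (stmt s o) := by
  refine .pair (.pair (.nat _) (.pair (.nat _) (.nat _))) ?_
  cases o
  · exact .nat 0
  · exact .val _

lemma Derivable.mono {K K' : Set (Party t)} {S S' : Set (Msg t V)} {m : Msg t V}
    (h : Derivable K S m) (hK : K ⊆ K') (hS : S ⊆ S') : Derivable K' S' m := by
  induction h with
  | known h => exact .known (hS h)
  | nat k => exact .nat k
  | val v => exact .val v
  | coin k => exact .coin k
  | pair _ _ iha ihb => exact .pair iha ihb
  | fst _ ih => exact .fst ih
  | snd _ ih => exact .snd ih
  | sign hi _ ih => exact .sign (hK hi) ih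
  | openSig _ ih => exact .openSig ih
  | combine Q hQ _ _ ih ihQ => exact .combine Q hQ ih ihQ
  | openTsig _ ih => exact .openTsig ih

/-! ### Local states -/

/-- The events of a local state. -/
abbrev Log (t : ℕ) (V : Type u) : Type u := List (LocalEvent t V)

/-- The messages received according to a log. -/
def Log.received (ev : Log t V) : Set (Msg t V) := {m | ∃ j, LocalEvent.received j m ∈ ev}

/-- What follows from the received messages alone, without signing anything. -/
def Know (ev : Log t V) (m : Msg t V) : Prop := Derivable ∅ ev.received m

/-- A party with log `ev` has sent the message `m`. -/
def Sent (ev : Log t V) (d : Party t) (m : Msg t V) : Prop :=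
  ∃ l, LocalEvent.sent l ∈ ev ∧ (d, m) ∈ l

/-- Party `i` with log `ev` has issued its signature on `m`. -/
def Issued (ev : Log t V) (i : Party t) (m : Msg t V) : Prop := ∃ d, Sent ev d (.sig i m)

/-- Party `i` has spoken in slot `s`. -/
def Fired (ev : Log t V) (i : Party t) (s : Slot t) : Prop := ∃ o, Issued ev i (stmt s o)

/-- The coin of view `j` was seen to elect `p` as the leader. -/
def Lead (ev : Log t V) (j : ℕ) (p : Party t) : Prop := LocalEvent.tossed j (some p.val) ∈ ev

/-- A certificate signed by a quorum of `2t + 1` parties. -/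
def qcert (s : Slot t) (o : Option V) : Msg t V := .tsig (2 * t + 1) (stmt s o)

/-- A certificate signed by `t + 1` parties. -/
def wcert (s : Slot t) (o : Option V) : Msg t V := .tsig (t + 1) (stmt s o)

/-- The party has entered view `j`. -/
def Entered (ev : Log t V) : ℕ → Prop
  | 0 => (∃ v, Know ev (wcert .inp (some v))) ∨ Know ev (wcert .echo none)
  | j + 1 => Entered ev j ∧ Know ev (qcert (.absent j) none) ∧ ∃ p, Lead ev j p ∧
      (Know ev (qcert (.vote j) none) ∨ ∃ v, Know ev (qcert (.ack j p) (some v)))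

/-- The value `v` is known to be a legitimate proposal in view `j`. -/
def Valid (ev : Log t V) : ℕ → V → Prop
  | 0, v => Know ev (wcert .inp (some v)) ∨ Know ev (wcert .echo none)
  | j + 1, v => (∃ p, Lead ev j p ∧ Know ev (qcert (.ack j p) (some v))) ∨
      (Know ev (qcert (.vote j) none) ∧ Valid ev j v)

/-- The view to which a slot belongs has been entered. -/
def Ready (ev : Log t V) : Slot t → Prop
  | .inp | .echo => True
  | .prop j | .ack j _ | .cert j | .hold j _ | .done j | .skip j | .aband j | .share j | .absent j
  | .vote j => Entered ev j

/-- Party `i` with input `x` may speak in slot `s` with value `o`, sending also the messages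
`es`. -/
def Rule (i : Party t) (x : V) (ev : Log t V) : Slot t → Option V → List (Msg t V) → Prop
  | .inp, o, es => o = some x ∧ es = []
  | .echo, o, es =>
      2 * t + 1 ≤ {p | ∃ w, Know ev (.sig p (stmt .inp (some w)))}.ncard ∧
      ((∃ v, o = some v ∧ Know ev (wcert .inp (some v)) ∧ es = [wcert .inp (some v)]) ∨
        (o = none ∧ es = [] ∧ ∀ v, ¬ Know ev (wcert .inp (some v))))
  | .prop 0, o, es => ∃ v m, o = some v ∧ es = [m] ∧ Know ev m ∧
      (m = wcert .inp (some v) ∨ (v = x ∧ m = wcert .echo none))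
  | .prop (j + 1), o, es => ∃ v m, o = some v ∧ es = [m] ∧ Know ev m ∧
      ((∃ p, Lead ev j p ∧ m = qcert (.ack j p) (some v)) ∨
        (m = qcert (.vote j) none ∧ Issued ev i (stmt (.prop j) (some v))))
  | .ack j p, o, es => ∃ v, o = some v ∧ es = [] ∧ ¬ Fired ev i (.aband j) ∧
      Know ev (.sig p (stmt (.prop j) (some v))) ∧ Valid ev j v
  | .cert j, o, es => ∃ v, o = none ∧ es = [qcert (.ack j i) (some v)] ∧
      Know ev (qcert (.ack j i) (some v))
  | .hold j p, o, es => o = none ∧ es = [] ∧ ¬ Fired ev i (.aband j) ∧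
      ∃ v, Know ev (qcert (.ack j p) (some v))
  | .done j, o, es => o = none ∧ es = [qcert (.hold j i) none] ∧ Know ev (qcert (.hold j i) none)
  | .skip j, o, es => o = none ∧ es = [] ∧
      2 * t + 1 ≤ {p | Know ev (qcert (.hold j p) none)}.ncard
  | .aband j, o, es => o = none ∧ es = [wcert (.skip j) none] ∧ Know ev (wcert (.skip j) none)
  | .share j, o, es => o = none ∧ es = [.sig i (.coin j)] ∧ Know ev (qcert (.aband j) none)
  | .absent j, o, es => o = none ∧ es = [] ∧ Fired ev i (.aband j) ∧
      ∃ p, Lead ev j p ∧ ∀ v, ¬ Know ev (qcert (.ack j p) (some v))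
  | .vote j, o, es => ∃ p, Lead ev j p ∧
      ((∃ v, o = some v ∧ es = [qcert (.ack j p) (some v)] ∧
          Know ev (qcert (.ack j p) (some v))) ∨
        (o = none ∧ es = [qcert (.absent j) none] ∧ Know ev (qcert (.absent j) none)))

/-- The parties to which the messages of a slot are sent. -/
def Slot.dests : Slot t → List (Party t)
  | .ack _ p | .hold _ p => [p]
  | _ => List.finRange _

/-- Slot `s` may be used with value `o` and further messages `es`, and has not been used before. -/
def Enabled (i : Party t) (x : V) (ev : Log t V) (s : Slot t) (o : Option V)
    (es : List (Msg t V)) : Prop :=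
  ¬ Fired ev i s ∧ Ready ev s ∧ Rule i x ev s o es

open Classical in
/-- The messages to be sent for slot `s`. -/
def output (i : Party t) (x : V) (ev : Log t V) (s : Slot t) : List (Party t × Msg t V) :=
  if h : ∃ r : Option V × List (Msg t V), Enabled i x ev s r.1 r.2 then
    s.dests.flatMap fun d => (Msg.sig i (stmt s h.choose.1) :: h.choose.2).map (Prod.mk d)
  else []

/-- The slots of view `j`. -/
def viewSlots (t j : ℕ) : Finset (Slot t) :=
  {.prop j, .cert j, .done j, .skip j, .aband j, .share j, .absent j, .vote j} ∪
    Finset.univ.biUnion fun p => {.ack j p, .hold j p}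

/-- The slots of the views before `m`. -/
def slots (t m : ℕ) : Finset (Slot t) := {.inp, .echo} ∪ (Finset.range m).biUnion (viewSlots t)

/-- All messages that can be sent now. -/
def batch (i : Party t) (x : V) (ev : Log t V) : List (Party t × Msg t V) :=
  (slots t (ev.length + 1)).toList.flatMap (output i x ev)

/-- The number of local steps in a log. -/
def Log.steps (ev : Log t V) : ℕ :=
  ev.countP fun e => match e with
    | .received _ _ => false
    | _ => true

/-- The coin of view `j` can be accessed now, for the first time. -/
def Tossable (ev : Log t V) (j : ℕ) : Prop :=
  Entered ev j ∧ Know ev (.tsig (t + 1) (.coin j)) ∧ ∀ p, ¬ Lead ev j p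

/-- There is a proof that `v` is to be decided. -/
def Decisive (ev : Log t V) (v : V) : Prop := ∃ j, Know ev (qcert (.vote j) (some v))

open Classical in
/-- The next local step: sending, accessing a coin and deciding in turn. -/
def act (i : Party t) (x : V) (ev : Log t V) : Action t V :=
  if ev.steps % 3 = 0 then .send (batch i x ev)
  else if ev.steps % 3 = 1 then
    if h : ∃ j, Tossable ev j then .toss h.choose else .send []
  else if h : ∃ v, Decisive ev v then .decide h.choose else .send []

/-- The agreement algorithm; the coin of each view elects a leader uniformly at random. -/
def protocol (t : ℕ) (V : Type u) : Algorithm t V where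
  act := act
  coinLaw := fun _ => (PMF.uniformOfFintype (Party t)).map Fin.val

/-! ### Monotonicity in the log -/

variable {i p d : Party t} {x v : V} {ev ev' pre : Log t V} {m : Msg t V} {s : Slot t}
  {o : Option V} {j : ℕ}

lemma Log.received_mono (h : ev <:+ ev') : ev.received ⊆ ev'.received :=
  fun _ ⟨k, hk⟩ => ⟨k, h.subset hk⟩

lemma Know.mono (hm : Know ev m) (h : ev <:+ ev') : Know ev' m :=
  Derivable.mono hm subset_rfl (Log.received_mono h)

lemma Sent.mono (hm : Sent ev d m) (h : ev <:+ ev') : Sent ev' d m := by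
  obtain ⟨l, hl, hd⟩ := hm
  exact ⟨l, h.subset hl, hd⟩

lemma Issued.mono (hm : Issued ev i m) (h : ev <:+ ev') : Issued ev' i m :=
  hm.imp fun _ hd => hd.mono h

lemma Fired.mono (hm : Fired ev i s) (h : ev <:+ ev') : Fired ev' i s :=
  hm.imp fun _ hd => hd.mono h

lemma Lead.mono (hm : Lead ev j p) (h : ev <:+ ev') : Lead ev' j p := h.subset hm

lemma Entered.mono (h : ev <:+ ev') : ∀ {j : ℕ}, Entered ev j → Entered ev' j
  | 0, hj => hj.imp (fun ⟨v, hv⟩ => ⟨v, hv.mono h⟩) fun hv => hv.mono h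
  | _ + 1, ⟨hj, hx, p, hp, hc⟩ => ⟨Entered.mono h hj, hx.mono h, p, hp.mono h,
      hc.imp (fun hv => hv.mono h) fun ⟨v, hv⟩ => ⟨v, hv.mono h⟩⟩

lemma Entered.of_le {j j' : ℕ} (h : Entered ev j) (hj : j' ≤ j) : Entered ev j' := by
  induction hj with
  | refl => exact h
  | step _ ih => exact ih h.1

lemma Valid.mono (h : ev <:+ ev') : ∀ {j : ℕ} {v : V}, Valid ev j v → Valid ev' j v
  | 0, _, hj => hj.imp (fun hv => hv.mono h) fun hv => hv.mono h
  | _ + 1, _, hj => hj.imp (fun ⟨p, hp, hc⟩ => ⟨p, hp.mono h, hc.mono h⟩)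
      fun ⟨hc, hv⟩ => ⟨hc.mono h, Valid.mono h hv⟩

/-! ### Logs of the protocol -/

/-- The local steps in the log are those that the protocol prescribes. -/
def WF (i : Party t) (x : V) : Log t V → Prop
  | [] => True
  | .received _ _ :: ev => WF i x ev
  | .sent l :: ev => act i x ev = .send l ∧ WF i x ev
  | .decided v :: ev => act i x ev = .decide v ∧ WF i x ev
  | .tossed k _ :: ev => act i x ev = .toss k ∧ WF i x ev

lemma WF.of_suffix (h : WF i x ev) (hs : pre <:+ ev) : WF i x pre := by
  induction ev with
  | nil => rw [List.suffix_nil.1 hs]; trivial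
  | cons e ev ih =>
    rcases List.suffix_cons_iff.1 hs with rfl | hs
    · exact h
    · refine ih ?_ hs
      cases e <;> first | exact h | exact h.2

lemma exists_suffix_of_mem {e : LocalEvent t V} (h : e ∈ ev) : ∃ pre, e :: pre <:+ ev := by
  obtain ⟨a, b, rfl⟩ := List.append_of_mem h
  exact ⟨b, a, rfl⟩

/-- An extra message of a slot is a known certificate, or a share of the coin. -/
lemma Rule.extra {es : List (Msg t V)} (h : Rule i x ev s o es) (hm : m ∈ es) :
    (Know ev m ∧ m.words ≤ 5 ∧ ∃ k m', m = .tsig k m') ∨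
      ∃ j, s = .share j ∧ m = .sig i (.coin j) := by
  rcases s with _ | _ | (_ | j) | _ | _ | _ | _ | _ | _ | _ | _ | _ <;> simp only [Rule] at h
  · simp_all
  · rcases h with ⟨-, ⟨v, -, hk, rfl⟩ | ⟨-, rfl, -⟩⟩ <;> simp_all [wcert, Msg.words, words_stmt]
  · obtain ⟨v, c, -, rfl, hk, rfl | ⟨-, rfl⟩⟩ := h <;> simp_all [wcert, Msg.words, words_stmt]
  · obtain ⟨v, c, -, rfl, hk, ⟨p, -, rfl⟩ | ⟨rfl, -⟩⟩ := h <;>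
      simp_all [qcert, Msg.words, words_stmt]
  · obtain ⟨v, -, rfl, -⟩ := h; simp_all
  · obtain ⟨v, -, rfl, hk⟩ := h; simp_all [qcert, Msg.words, words_stmt]
  · simp_all
  · obtain ⟨-, rfl, hk⟩ := h; simp_all [qcert, Msg.words, words_stmt]
  · simp_all
  · obtain ⟨-, rfl, hk⟩ := h; simp_all [wcert, Msg.words, words_stmt]
  · obtain ⟨-, rfl, hk⟩ := h; simp_all
  · simp_all
  · obtain ⟨p, -, ⟨v, -, rfl, hk⟩ | ⟨-, rfl, hk⟩⟩ := h <;> simp_all [qcert, Msg.words, words_stmt]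

lemma Rule.length_le {es : List (Msg t V)} (h : Rule i x ev s o es) : es.length ≤ 1 := by
  rcases s with _ | _ | (_ | j) | _ | _ | _ | _ | _ | _ | _ | _ | _ <;> simp only [Rule] at h
  all_goals first
    | (obtain ⟨-, rfl, -⟩ := h; simp)
    | (obtain ⟨-, -, -, rfl, -⟩ := h; simp)
    | (obtain ⟨-, -, rfl, -⟩ := h; simp)
    | (obtain ⟨-, ⟨-, -, -, rfl⟩ | ⟨-, rfl, -⟩⟩ := h <;> simp)
    | (obtain ⟨-, -, ⟨-, -, rfl, -⟩ | ⟨-, rfl, -⟩⟩ := h <;> simp)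

lemma mem_output {y : Party t × Msg t V} (h : y ∈ output i x ev s) :
    ∃ o es, Enabled i x ev s o es ∧ y.1 ∈ s.dests ∧ (y.2 = .sig i (stmt s o) ∨ y.2 ∈ es) := by
  unfold output at h
  split_ifs at h with hr
  · obtain ⟨d, hd, hy⟩ := List.mem_flatMap.1 h
    obtain ⟨m, hm, rfl⟩ := List.mem_map.1 hy
    exact ⟨_, _, hr.choose_spec, hd, by simpa using hm⟩
  · simp at h

lemma output_spec {es : List (Msg t V)} (h : Enabled i x ev s o es) :
    ∃ o es, Enabled i x ev s o es ∧ ∀ d ∈ s.dests, ∀ m ∈ Msg.sig i (stmt s o) :: es,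
      (d, m) ∈ output i x ev s := by
  have hr : ∃ r : Option V × List (Msg t V), Enabled i x ev s r.1 r.2 := ⟨(o, es), h⟩
  refine ⟨hr.choose.1, hr.choose.2, hr.choose_spec, fun d hd m hm => ?_⟩
  rw [output, dif_pos hr]
  exact List.mem_flatMap.2 ⟨d, hd, List.mem_map.2 ⟨m, hm, rfl⟩⟩

lemma act_eq_send {l : List (Party t × Msg t V)} (h : act i x ev = .send l) :
    l = [] ∨ (ev.steps % 3 = 0 ∧ l = batch i x ev) := by
  unfold act at h
  split_ifs at h <;> simp_all

lemma act_eq_toss {k : ℕ} (h : act i x ev = .toss k) : Tossable ev k := by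
  unfold act at h
  split_ifs at h with h1 h2 h3
  cases h
  exact h3.choose_spec

lemma act_eq_decide (h : act i x ev = .decide v) : Decisive ev v := by
  unfold act at h
  split_ifs at h with h1 h2 h3 h4
  cases h
  exact h4.choose_spec

/-- Every message in the log was sent by a rule. -/
lemma WF.sent (h : WF i x ev) (hm : Sent ev d m) :
    ∃ pre s o es, pre <:+ ev ∧ LocalEvent.sent (batch i x pre) :: pre <:+ ev ∧
      Enabled i x pre s o es ∧ (m = .sig i (stmt s o) ∨ m ∈ es) ∧ (d, m) ∈ output i x pre s ∧
      (d, m) ∈ batch i x pre := by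
  obtain ⟨l, hl, hd⟩ := hm
  obtain ⟨pre, hpre⟩ := exists_suffix_of_mem hl
  have hw := h.of_suffix hpre
  rcases act_eq_send hw.1 with rfl | ⟨-, rfl⟩
  · simp at hd
  · obtain ⟨s, -, hs⟩ := List.mem_flatMap.1 hd
    obtain ⟨o, es, he, -, hm⟩ := mem_output hs
    exact ⟨pre, s, o, es, (List.suffix_cons _ _).trans hpre, hpre, he, hm, hs, hd⟩

/-- Every signed statement was signed by a rule. -/
lemma WF.issued (h : WF i x ev) (hm : Issued ev i (stmt s o)) :
    ∃ pre es, LocalEvent.sent (batch i x pre) :: pre <:+ ev ∧ Enabled i x pre s o es ∧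
      (∃ d, (d, Msg.sig i (stmt s o)) ∈ output i x pre s) ∧
      Issued (.sent (batch i x pre) :: pre) i (stmt s o) := by
  obtain ⟨d, hm⟩ := hm
  obtain ⟨pre, s', o', es, hp, hp', he, hm, hd, hb⟩ := h.sent hm
  rcases hm with hm | hm
  · obtain ⟨rfl, rfl⟩ := stmt_inj.1 (Msg.sig.inj hm).2
    exact ⟨pre, es, hp', he, ⟨d, hd⟩, d, _, List.mem_cons_self, hb⟩
  · rcases he.2.2.extra hm with ⟨-, -, k, m', h'⟩ | ⟨j, -, h'⟩
    · cases h'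
    · exact absurd (Msg.sig.inj h').2 stmt_ne_coin

/-- A coin share leaves a party only as the extra message of the slot `share`, whose rule demands
proof that a quorum has abandoned. -/
lemma WF.issued_coin (h : WF i x ev) (hm : Issued ev i (.coin j)) :
    Entered ev j ∧ Know ev (qcert (.aband j) none) := by
  obtain ⟨d, hm⟩ := hm
  obtain ⟨pre, s', o', es, hp, hp', he, hm, -⟩ := h.sent hm
  rcases hm with hm | hm
  · exact absurd (Msg.sig.inj hm).2.symm stmt_ne_coin
  · rcases he.2.2.extra hm with ⟨-, -, k, m', h'⟩ | ⟨j, rfl, h'⟩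
    · cases h'
    · cases h'
      exact ⟨Entered.mono hp he.2.1, he.2.2.2.2.mono hp⟩

lemma suffix_cons_total {a b c : Log t V} {e e' : LocalEvent t V} (ha : e :: a <:+ c)
    (hb : e' :: b <:+ c) : e :: a = e' :: b ∨ e :: a <:+ b ∨ e' :: b <:+ a := by
  rcases List.suffix_or_suffix_of_suffix ha hb with h | h
  · rcases List.suffix_cons_iff.1 h with h | h
    · exact .inl h
    · exact .inr (.inl h)
  · rcases List.suffix_cons_iff.1 h with h | h
    · exact .inl h.symm
    · exact .inr (.inr h)

/-- All messages of a slot within one batch stem from a single choice of value, and no extra message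
is a signed statement. -/
lemma output_unique {o' : Option V} {d' : Party t}
    (h : (d, Msg.sig i (stmt s o)) ∈ output i x ev s)
    (h' : (d', Msg.sig i (stmt s o')) ∈ output i x ev s) : o = o' := by
  unfold output at h h'
  split_ifs at h with hr
  · rw [dif_pos hr] at h'
    have key : ∀ {d o}, (d, Msg.sig i (stmt s o)) ∈ (s.dests.flatMap fun d =>
        (Msg.sig i (stmt s hr.choose.1) :: hr.choose.2).map (Prod.mk d)) → o = hr.choose.1 := by
      intro d o h
      obtain ⟨d', -, hy⟩ := List.mem_flatMap.1 h
      obtain ⟨m, hm, hd⟩ := List.mem_map.1 hy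
      cases hd
      rcases List.mem_cons.1 hm with hm | hm
      · exact (stmt_inj.1 (Msg.sig.inj hm).2).2
      · rcases hr.choose_spec.2.2.extra hm with ⟨-, -, k, m', h'⟩ | ⟨j, -, h'⟩
        · cases h'
        · exact absurd (Msg.sig.inj h').2 stmt_ne_coin
    rw [key h, key h']
  · simp at h

/-- Speaking requires that the slot was not used before, so both signatures come from the same
batch, where the value is unique. This is the non-equivocation behind every quorum argument. -/
lemma WF.issued_unique {o' : Option V} (h : WF i x ev) (hm : Issued ev i (stmt s o))
    (hm' : Issued ev i (stmt s o')) : o = o' := by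
  obtain ⟨a, es, ha, he, ⟨d, hd⟩, hf⟩ := h.issued hm
  obtain ⟨b, es', hb, he', ⟨d', hd'⟩, hf'⟩ := h.issued hm'
  rcases suffix_cons_total ha hb with heq | hs | hs
  · obtain rfl := (List.cons.inj heq).2
    exact output_unique hd hd'
  · exact absurd ⟨o, hf.mono hs⟩ he'.1
  · exact absurd ⟨o', hf'.mono hs⟩ he.1

end AsyncBA

end

/-! ### Transitions of configurations, authenticity of signatures, quorum intersection. -/

noncomputable section

namespace AsyncBA

variable {t : ℕ} {V : Type u}

/-! ### Transitions between configurations -/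

variable {c c' c'' : Config t V} {i p d : Party t} {m : Msg t V} {s : Slot t} {o : Option V} {j : ℕ}
  {v : V}

lemma Know.derivable {ev : Log t V} (h : Know ev m) (K : Set (Party t)) :
    Derivable K ev.received m :=
  Derivable.mono h (Set.empty_subset _) subset_rfl

lemma derivable_of_act {x : V} {ev : Log t V} {l : List (Party t × Msg t V)}
    (h : act i x ev = .send l) : ∀ y ∈ l, Derivable {i} ev.received y.2 := by
  intro y hy
  rcases act_eq_send h with rfl | ⟨-, rfl⟩
  · simp at hy
  · obtain ⟨s, -, hs⟩ := List.mem_flatMap.1 hy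
    obtain ⟨o, es, he, -, hm | hm⟩ := mem_output hs
    · rw [hm]
      exact .sign rfl (derivable_stmt _ _ _ _)
    · rcases he.2.2.extra hm with ⟨hk, -⟩ | ⟨j, -, h'⟩
      · exact hk.derivable _
      · rw [h']
        exact .sign rfl (.coin _)

/-- The packets by which `i` sends the messages `l`. -/
def packets (i : Party t) (l : List (Party t × Msg t V)) : List (Packet t V) :=
  l.map fun y => ⟨i, y.1, y.2, true⟩

/-- The possible transitions between configurations. -/
inductive Trans (c : Config t V) : Config t V → Prop
  | stay : Trans c c
  | send (i : Party t) (l : List (Party t × Msg t V)) : i ∉ c.corrupted →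
      act i (c.input i) (c.events i) = .send l →
      Trans c ({ c with net := c.net ++ packets i l }.record i (.sent l))
  | decide (i : Party t) (v : V) : i ∉ c.corrupted →
      act i (c.input i) (c.events i) = .decide v → Trans c (c.record i (.decided v))
  | toss (i : Party t) (k : ℕ) (r : ℕ) : i ∉ c.corrupted →
      act i (c.input i) (c.events i) = .toss k → (c.coins k = none ∨ c.coins k = some r) →
      r < 3 * t + 1 →
      Trans c ({ c with coins := Function.update c.coins k (some r) }.record i
        (.tossed k (some r)))
  | deliver (k : ℕ) (p : Packet t V) : c.net[k]? = some p → k ∉ c.delivered →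
      Trans c ({ c with delivered := insert k c.delivered }.record p.dst (.received p.src p.msg))
  | corrupt (i : Party t) : c.corrupted.card < t →
      Trans c { c with corrupted := insert i c.corrupted }
  | inject (i d : Party t) (m : Msg t V) : i ∈ c.corrupted →
      Derivable (c.corrupted : Set (Party t)) c.traffic m →
      Trans c { c with net := c.net ++ [⟨i, d, m, false⟩] }
  | peek (k : ℕ) (r : ℕ) : CanToss (c.corrupted : Set (Party t)) c.traffic k →
      c.coins k = none → r < 3 * t + 1 →
      Trans c { c with coins := Function.update c.coins k (some r) }

/-- The coins sampled so far elect leaders. -/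
def CoinsLt (c : Config t V) : Prop := ∀ k r, c.coins k = some r → r < 3 * t + 1

lemma mem_support_coinLaw {k r : ℕ} (h : r ∈ ((protocol t V).coinLaw k).support) :
    r < 3 * t + 1 := by
  simp only [protocol, PMF.mem_support_map_iff] at h
  obtain ⟨a, -, rfl⟩ := h
  exact a.2

open Classical in
/-- The local step of an honest party that sends messages. -/
lemma localStep_send {l : List (Party t × Msg t V)}
    (h : act i (c.input i) (c.events i) = .send l) :
    c.localStep (protocol t V) i = PMF.pure
      ({ c with net := c.net ++ packets i l }.record i (.sent l)) := by
  -- The filter of the model removes nothing: the protocol sends only its own signatures and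
  -- certificates that it can derive.
  have hl : (l.filter fun p => decide (Derivable {i} (c.received i) p.2)) = l := by
    refine List.filter_eq_self.2 fun y hy => ?_
    exact decide_eq_true (derivable_of_act h y hy)
  unfold Config.localStep
  simp only [protocol, h]
  congr 4
  exact congrArg (packets i) hl

lemma localStep_decide (h : act i (c.input i) (c.events i) = .decide v) :
    c.localStep (protocol t V) i = PMF.pure (c.record i (.decided v)) := by
  unfold Config.localStep
  simp only [protocol, h]

lemma localStep_toss {k : ℕ} (h : act i (c.input i) (c.events i) = .toss k) :
    c.localStep (protocol t V) i =
      (c.flip (protocol t V) k).map fun x => x.2.record i (.tossed k (some x.1)) := by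
  have hk : CanToss {i} (c.received i) k := (act_eq_toss h).2.1.derivable _
  have h' : (protocol t V).act i (c.input i) (c.events i) = .toss k := h
  unfold Config.localStep
  rw [h']
  simp [hk]

lemma trans_of_mem_support {mv : Move t V} (hc : CoinsLt c)
    (h : c' ∈ (c.next (protocol t V) mv).support) : Trans c c' := by
  have hstay : ∀ {c'}, c' ∈ (PMF.pure c).support → Trans c c' := by
    intro c' h
    rw [PMF.support_pure, Set.mem_singleton_iff] at h
    exact h ▸ .stay
  cases mv with
  | step i =>
    simp only [Config.next] at h
    split_ifs at h with hi
    · exact hstay h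
    cases ha : act i (c.input i) (c.events i) with
    | send l =>
      rw [localStep_send ha, PMF.support_pure, Set.mem_singleton_iff] at h
      exact h ▸ .send i l hi ha
    | decide v =>
      rw [localStep_decide ha, PMF.support_pure, Set.mem_singleton_iff] at h
      exact h ▸ .decide i v hi ha
    | toss k =>
      rw [localStep_toss ha, PMF.mem_support_map_iff] at h
      obtain ⟨⟨r, c1⟩, h1, rfl⟩ := h
      unfold Config.flip at h1
      split at h1
      · rename_i r' hr'
        rw [PMF.support_pure, Set.mem_singleton_iff] at h1
        cases h1
        -- Overwriting a sampled coin with its own value changes nothing, so `Trans.toss` covers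
        -- repeated accesses too.
        have := Trans.toss i k r hi ha (.inr hr') (hc _ _ hr')
        rw [← hr', Function.update_eq_self] at this
        simpa only [hr'] using this
      · rename_i hr'
        obtain ⟨r', hr, h1⟩ := (PMF.mem_support_map_iff _ _ _).1 h1
        cases h1
        exact .toss i k r hi ha (.inl hr') (mem_support_coinLaw hr)
  | deliver k =>
    simp only [Config.next] at h
    split at h
    · rename_i p hp
      split_ifs at h with hk
      · exact hstay h
      · rw [PMF.support_pure, Set.mem_singleton_iff] at h
        exact h ▸ .deliver k p hp hk
    · exact hstay h
  | corrupt i =>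
    simp only [Config.next] at h
    split_ifs at h with hk
    · rw [PMF.support_pure, Set.mem_singleton_iff] at h
      exact h ▸ .corrupt i hk
    · exact hstay h
  | inject i d m =>
    simp only [Config.next] at h
    split_ifs at h with hk
    · rw [PMF.support_pure, Set.mem_singleton_iff] at h
      exact h ▸ .inject i d m hk.1 hk.2
    · exact hstay h
  | peek k =>
    simp only [Config.next] at h
    split_ifs at h with hk
    · rw [PMF.mem_support_map_iff] at h
      obtain ⟨⟨r, c1⟩, h1, rfl⟩ := h
      unfold Config.flip at h1
      split at h1
      · rw [PMF.support_pure, Set.mem_singleton_iff] at h1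
        cases h1
        exact .stay
      · rename_i hr'
        obtain ⟨r', hr, h1⟩ := (PMF.mem_support_map_iff _ _ _).1 h1
        cases h1
        exact .peek k r hk hr' (mem_support_coinLaw hr)
    · exact hstay h

/-- `c'` may be later than `c` in an execution. -/
structure Ext (c c' : Config t V) : Prop where
  input : c'.input = c.input
  events : ∀ i, c.events i <:+ c'.events i
  net : c.net <+: c'.net
  delivered : c.delivered ⊆ c'.delivered
  coins : ∀ k r, c.coins k = some r → c'.coins k = some r
  corrupted : c.corrupted ⊆ c'.corrupted

lemma Ext.refl (c : Config t V) : Ext c c :=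
  ⟨rfl, fun _ => List.suffix_refl _, List.prefix_refl _, subset_rfl, fun _ _ h => h, subset_rfl⟩

lemma Ext.trans (h : Ext c c') (h' : Ext c' c'') : Ext c c'' :=
  ⟨h'.1.trans h.1, fun i => (h.2 i).trans (h'.2 i), h.3.trans h'.3, h.4.trans h'.4,
    fun k r hk => h'.5 k r (h.5 k r hk), h.6.trans h'.6⟩

lemma record_events_self (c : Config t V) (i : Party t) (e : LocalEvent t V) :
    (c.record i e).events i = e :: c.events i := by
  simp [Config.record]

lemma record_events_of_ne (c : Config t V) {i p : Party t} (e : LocalEvent t V) (h : p ≠ i) :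
    (c.record i e).events p = c.events p := by
  simp [Config.record, h]

lemma suffix_record (c : Config t V) (i p : Party t) (e : LocalEvent t V) :
    c.events p <:+ (c.record i e).events p := by
  rcases eq_or_ne p i with rfl | h
  · rw [record_events_self]
    exact List.suffix_cons _ _
  · rw [record_events_of_ne _ _ h]

lemma Trans.ext (h : Trans c c') : Ext c c' := by
  cases h with
  | stay => exact .refl _
  | send i l hi ha =>
    exact ⟨rfl, fun p => suffix_record _ i p _, List.prefix_append _ _, subset_rfl,
      fun _ _ h => h, subset_rfl⟩
  | decide i v hi ha =>
    exact ⟨rfl, fun p => suffix_record _ i p _, List.prefix_refl _, subset_rfl,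
      fun _ _ h => h, subset_rfl⟩
  | toss i k r hi ha hk hr =>
    refine ⟨rfl, fun p => suffix_record _ i p _, List.prefix_refl _, subset_rfl,
      fun k' r' h => ?_, subset_rfl⟩
    simp only [Config.record, Function.update_apply]
    split_ifs with hkk
    · subst hkk
      rcases hk with hk | hk <;> simp_all
    · exact h
  | deliver k p hp hk =>
    exact ⟨rfl, fun p => suffix_record _ _ p _, List.prefix_refl _, Finset.subset_insert _ _,
      fun _ _ h => h, subset_rfl⟩
  | corrupt i hi =>
    exact ⟨rfl, fun p => List.suffix_refl _, List.prefix_refl _, subset_rfl,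
      fun _ _ h => h, Finset.subset_insert _ _⟩
  | inject i d m hi hd =>
    exact ⟨rfl, fun p => List.suffix_refl _, List.prefix_append _ _, subset_rfl,
      fun _ _ h => h, subset_rfl⟩
  | peek k r hk hk' hr =>
    refine ⟨rfl, fun p => List.suffix_refl _, List.prefix_refl _, subset_rfl,
      fun k' r' h => ?_, subset_rfl⟩
    simp only [Function.update_apply]
    split_ifs with hkk
    · subst hkk
      simp_all
    · exact h

/-! ### Authenticity -/

/-- If a signature of `i` on `m` exists then `i` is corrupted or has issued it. -/
def Auth (c : Config t V) (i : Party t) (m : Msg t V) : Prop :=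
  i ∈ c.corrupted ∨ Issued (c.events i) i m

lemma Auth.mono (hm : Auth c i m) (h : Ext c c') : Auth c' i m :=
  hm.imp (fun hi => h.corrupted hi) fun hi => hi.mono (h.events i)

/-- All signatures in a message are authentic. -/
def Sound (c : Config t V) : Msg t V → Prop
  | .nat _ => True
  | .val _ => True
  | .coin _ => True
  | .pair a b => Sound c a ∧ Sound c b
  | .sig i m => Auth c i m ∧ Sound c m
  | .tsig k m => (∃ Q : Finset (Party t), k ≤ Q.card ∧ ∀ i ∈ Q, Auth c i m) ∧ Sound c m

lemma Sound.mono (h : Ext c c') : ∀ {m : Msg t V}, Sound c m → Sound c' m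
  | .nat _, _ => trivial
  | .val _, _ => trivial
  | .coin _, _ => trivial
  | .pair _ _, ⟨ha, hb⟩ => ⟨ha.mono h, hb.mono h⟩
  | .sig _ _, ⟨ha, hb⟩ => ⟨ha.mono h, hb.mono h⟩
  | .tsig _ _, ⟨⟨Q, hQ, ha⟩, hb⟩ => ⟨⟨Q, hQ, fun i hi => (ha i hi).mono h⟩, hb.mono h⟩

/-- Fresh signatures arise only from keys in `K`, which belong to corrupted parties, and a combined
signature inherits authenticity from its shares. -/
lemma sound_of_derivable {K : Set (Party t)} {S : Set (Msg t V)} (hK : ∀ i ∈ K, i ∈ c.corrupted)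
    (hS : ∀ m ∈ S, Sound c m) (h : Derivable K S m) : Sound c m := by
  induction h with
  | known h => exact hS _ h
  | nat | val | coin => trivial
  | pair _ _ iha ihb => exact ⟨iha, ihb⟩
  | fst _ ih => exact ih.1
  | snd _ ih => exact ih.2
  | sign hi _ ih => exact ⟨.inl (hK _ hi), ih⟩
  | openSig _ ih => exact ih.2
  | combine Q hQ _ _ ih ihQ => exact ⟨⟨Q, hQ, fun i hi => (ihQ i hi).1⟩, ih⟩
  | openTsig _ ih => exact ih.2

lemma sound_stmt (c : Config t V) (s : Slot t) (o : Option V) : Sound c (stmt s o) := by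
  cases o <;> simp [stmt, Sound]

/-- The invariants of configurations that do not depend on the meaning of the messages. -/
structure Inv (c : Config t V) : Prop where
  wf : ∀ i, WF i (c.input i) (c.events i)
  card : c.corrupted.card ≤ t
  sound : ∀ p ∈ c.net, Sound c p.msg
  sent : ∀ p ∈ c.net, p.honest = true → Sent (c.events p.src) p.dst p.msg
  received : ∀ i k m, LocalEvent.received k m ∈ c.events i → ∃ p ∈ c.net, p.msg = m
  net : ∀ i d m, Sent (c.events i) d m → ⟨i, d, m, true⟩ ∈ c.net
  delivered : ∀ k p, c.net[k]? = some p → k ∈ c.delivered →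
    LocalEvent.received p.src p.msg ∈ c.events p.dst
  delivered_lt : ∀ k ∈ c.delivered, k < c.net.length
  tossed : ∀ i k r, LocalEvent.tossed k (some r) ∈ c.events i → c.coins k = some r
  coins_lt : CoinsLt c

lemma inv_init (input : Party t → V) : Inv (Config.init input) := by
  constructor <;> simp [Config.init, WF, Sent, CoinsLt]

lemma Inv.sound_of_know (hc : Inv c) (h : Know (c.events i) m) : Sound c m := by
  refine sound_of_derivable (by simp) ?_ h
  rintro m ⟨k, hk⟩
  obtain ⟨p, hp, rfl⟩ := hc.received _ _ _ hk
  exact hc.sound p hp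

lemma Inv.sound_of_traffic (hc : Inv c)
    (h : Derivable (c.corrupted : Set (Party t)) c.traffic m) : Sound c m := by
  refine sound_of_derivable (fun i hi => hi) ?_ h
  rintro m ⟨p, hp, rfl⟩
  exact hc.sound p hp

lemma mem_record_events {e e' : LocalEvent t V} (h : e' ∈ (c.record i e).events p) :
    (p = i ∧ e' = e) ∨ e' ∈ c.events p := by
  rcases eq_or_ne p i with rfl | hp
  · rw [record_events_self] at h
    exact (List.mem_cons.1 h).imp_left fun h => ⟨rfl, h⟩
  · rw [record_events_of_ne _ _ hp] at h
    exact .inr h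

lemma sent_cons {e : LocalEvent t V} {ev : Log t V} :
    Sent (e :: ev) d m ↔ (∃ l, e = .sent l ∧ (d, m) ∈ l) ∨ Sent ev d m := by
  simp only [Sent, List.mem_cons]
  constructor
  · rintro ⟨l, h | h, hd⟩
    · exact .inl ⟨l, h.symm, hd⟩
    · exact .inr ⟨l, h, hd⟩
  · rintro (⟨l, h, hd⟩ | ⟨l, h, hd⟩)
    · exact ⟨l, .inl h.symm, hd⟩
    · exact ⟨l, .inr h, hd⟩

lemma sent_record {e : LocalEvent t V} (h : Sent ((c.record i e).events p) d m) :
    (p = i ∧ ∃ l, e = .sent l ∧ (d, m) ∈ l) ∨ Sent (c.events p) d m := by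
  rcases eq_or_ne p i with rfl | hp
  · rw [record_events_self, sent_cons] at h
    exact h.imp_left fun h => ⟨rfl, h⟩
  · rw [record_events_of_ne _ _ hp] at h
    exact .inr h

lemma issued_record_sent {l : List (Party t × Msg t V)} (h : (d, .sig i m) ∈ l) :
    Issued ((c.record i (.sent l)).events i) i m := by
  rw [record_events_self]
  exact ⟨d, l, List.mem_cons_self, h⟩

lemma wf_record {e : LocalEvent t V} (h : ∀ i, WF i (c.input i) (c.events i))
    (he : WF i (c.input i) (e :: c.events i)) (p : Party t) :
    WF p ((c.record i e).input p) ((c.record i e).events p) := by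
  rcases eq_or_ne p i with rfl | hp
  · rw [record_events_self]
    exact he
  · rw [record_events_of_ne _ _ hp]
    exact h p

lemma getElem?_append_of {l l' : List (Packet t V)} {k : ℕ} {q : Packet t V}
    (h : (l ++ l')[k]? = some q) (hk : k < l.length) : l[k]? = some q := by
  rwa [List.getElem?_append_left hk] at h

/-- The clause with content is soundness: a local step sends its own signatures, which are now
logged, or material derived from sound messages; an injected message is derived from sound traffic
with corrupted keys. The logs of corrupted parties stay well formed because these parties take no
more local steps. -/
lemma Inv.trans (hc : Inv c) (h : Trans c c') : Inv c' := by
  have hext := h.ext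
  cases h with
  | stay => exact hc
  | send i l hi ha =>
    refine ⟨wf_record hc.wf ⟨ha, hc.wf i⟩, hc.card, ?_, ?_, ?_, ?_, ?_, ?_, ?_, hc.coins_lt⟩
    · intro p hp
      rcases List.mem_append.1 hp with hp | hp
      · exact (hc.sound p hp).mono hext
      obtain ⟨y, hy, rfl⟩ := List.mem_map.1 hp
      rcases act_eq_send ha with rfl | ⟨-, rfl⟩
      · simp at hy
      obtain ⟨s, -, hs⟩ := List.mem_flatMap.1 hy
      obtain ⟨o, es, he, -, hm | hm⟩ := mem_output hs
      · simp only [hm]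
        exact ⟨.inr (issued_record_sent (d := y.1) (by rwa [← hm])), sound_stmt _ _ _⟩
      · rcases he.2.2.extra hm with ⟨hk, -⟩ | ⟨j, -, h'⟩
        · exact (hc.sound_of_know hk).mono hext
        · simp only [h']
          exact ⟨.inr (issued_record_sent (d := y.1) (by rwa [← h'])), trivial⟩
    · intro p hp hh
      rcases List.mem_append.1 hp with hp | hp
      · exact (hc.sent p hp hh).mono (hext.events _)
      obtain ⟨y, hy, rfl⟩ := List.mem_map.1 hp
      exact ⟨l, by rw [record_events_self]; exact List.mem_cons_self, hy⟩
    · intro p k m hm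
      rcases mem_record_events hm with ⟨-, hm⟩ | hm
      · cases hm
      · obtain ⟨p, hp, h⟩ := hc.received _ _ _ hm
        exact ⟨p, List.mem_append_left _ hp, h⟩
    · intro p d m hm
      rcases sent_record hm with ⟨rfl, l', hl, hd⟩ | hm
      · cases hl
        exact List.mem_append_right _ (List.mem_map.2 ⟨_, hd, rfl⟩)
      · exact List.mem_append_left _ (hc.net _ _ _ hm)
    · intro k p hp hk
      exact (hext.events _).subset
        (hc.delivered k p (getElem?_append_of hp (hc.delivered_lt k hk)) hk)
    · intro k hk
      have := hc.delivered_lt k hk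
      simp only [Config.record, List.length_append]
      omega
    · intro p k r hr
      rcases mem_record_events hr with ⟨-, hm⟩ | hm
      · cases hm
      · exact hc.tossed _ _ _ hm
  | decide i v hi ha =>
    refine ⟨wf_record hc.wf ⟨ha, hc.wf i⟩, hc.card, fun p hp => (hc.sound p hp).mono hext,
      fun p hp hh => (hc.sent p hp hh).mono (hext.events _), ?_, ?_,
      fun k p hp hk => (hext.events _).subset (hc.delivered k p hp hk), hc.delivered_lt, ?_,
      hc.coins_lt⟩
    · intro p k m hm
      rcases mem_record_events hm with ⟨-, hm⟩ | hm
      · cases hm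
      · exact hc.received _ _ _ hm
    · intro p d m hm
      rcases sent_record hm with ⟨rfl, l', hl, hd⟩ | hm
      · cases hl
      · exact hc.net _ _ _ hm
    · intro p k r hr
      rcases mem_record_events hr with ⟨-, hm⟩ | hm
      · cases hm
      · exact hc.tossed _ _ _ hm
  | toss i k r hi ha hk hr =>
    refine ⟨wf_record (c := { c with coins := Function.update c.coins k (some r) }) hc.wf
      ⟨ha, hc.wf i⟩, hc.card, fun p hp => (hc.sound p hp).mono hext,
      fun p hp hh => (hc.sent p hp hh).mono (hext.events _), ?_, ?_,
      fun k p hp hk => (hext.events _).subset (hc.delivered k p hp hk), hc.delivered_lt, ?_, ?_⟩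
    · intro p k m hm
      rcases mem_record_events hm with ⟨-, hm⟩ | hm
      · cases hm
      · exact hc.received _ _ _ hm
    · intro p d m hm
      rcases sent_record hm with ⟨rfl, l', hl, hd⟩ | hm
      · cases hl
      · exact hc.net _ _ _ hm
    · intro p k' r' hr
      rcases mem_record_events hr with ⟨-, hm⟩ | hm
      · cases hm
        simp [Config.record]
      · exact hext.coins _ _ (hc.tossed _ _ _ hm)
    · intro k' r' h
      simp only [Config.record, Function.update_apply] at h
      split_ifs at h with hkk
      · cases h; exact hr
      · exact hc.coins_lt _ _ h
  | deliver k p hp hk =>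
    refine ⟨wf_record (c := { c with delivered := insert k c.delivered }) hc.wf (hc.wf p.dst),
      hc.card, fun p hp => (hc.sound p hp).mono hext,
      fun p hp hh => (hc.sent p hp hh).mono (hext.events _), ?_, ?_, ?_, ?_, ?_, hc.coins_lt⟩
    · intro p k m hm
      rcases mem_record_events hm with ⟨-, hm⟩ | hm
      · cases hm
        exact ⟨_, List.mem_of_getElem? hp, rfl⟩
      · exact hc.received _ _ _ hm
    · intro p d m hm
      rcases sent_record hm with ⟨rfl, l', hl, hd⟩ | hm
      · cases hl
      · exact hc.net _ _ _ hm
    · intro k' p' hp' hk'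
      rcases Finset.mem_insert.1 hk' with rfl | hk'
      · have : p = p' := Option.some.inj (hp.symm.trans hp')
        subst this
        rw [record_events_self]
        exact List.mem_cons_self
      · exact (hext.events _).subset (hc.delivered k' p' hp' hk')
    · intro k' hk'
      rcases Finset.mem_insert.1 hk' with rfl | hk'
      · exact (List.getElem?_eq_some_iff.1 hp).1
      · exact hc.delivered_lt k' hk'
    · intro p k r hr
      rcases mem_record_events hr with ⟨-, hm⟩ | hm
      · cases hm
      · exact hc.tossed _ _ _ hm
  | corrupt i hi =>
    exact ⟨hc.wf, (Finset.card_insert_le _ _).trans hi, fun p hp => (hc.sound p hp).mono hext,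
      hc.sent, hc.received, hc.net, hc.delivered, hc.delivered_lt, hc.tossed, hc.coins_lt⟩
  | inject i d m hi hd =>
    refine ⟨hc.wf, hc.card, ?_, ?_, ?_, ?_, ?_, ?_, hc.tossed, hc.coins_lt⟩
    · intro p hp
      rcases List.mem_append.1 hp with hp | hp
      · exact (hc.sound p hp).mono hext
      · rw [List.mem_singleton] at hp
        subst hp
        exact (hc.sound_of_traffic hd).mono hext
    · intro p hp hh
      rcases List.mem_append.1 hp with hp | hp
      · exact hc.sent p hp hh
      · rw [List.mem_singleton] at hp
        subst hp
        simp at hh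
    · intro p k m hm
      obtain ⟨p, hp, h⟩ := hc.received _ _ _ hm
      exact ⟨p, List.mem_append_left _ hp, h⟩
    · exact fun p d m hm => List.mem_append_left _ (hc.net _ _ _ hm)
    · exact fun k p hp hk => hc.delivered k p (getElem?_append_of hp (hc.delivered_lt k hk)) hk
    · intro k hk
      have := hc.delivered_lt k hk
      simp only [List.length_append]
      omega
  | peek k r hk hk' hr =>
    refine ⟨hc.wf, hc.card, fun p hp => (hc.sound p hp).mono hext, hc.sent, hc.received, hc.net,
      hc.delivered, hc.delivered_lt, fun p k r h => hext.coins _ _ (hc.tossed p k r h), ?_⟩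
    intro k' r' h
    simp only [Function.update_apply] at h
    split_ifs at h with hkk
    · cases h; exact hr
    · exact hc.coins_lt _ _ h

/-! ### Quorums -/

lemma Inv.exists_issued (hc : Inv c) {Q : Finset (Party t)} (hQ : t + 1 ≤ Q.card)
    (h : ∀ i ∈ Q, Auth c i m) : ∃ i ∈ Q, i ∉ c.corrupted ∧ Issued (c.events i) i m := by
  obtain ⟨i, hi, hi'⟩ := Finset.exists_mem_notMem_of_card_lt_card
    (lt_of_le_of_lt hc.card (Nat.lt_of_succ_le hQ))
  exact ⟨i, hi, hi', (h i hi).resolve_left hi'⟩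

lemma card_inter_of_quorums {Q Q' : Finset (Party t)} (hQ : 2 * t + 1 ≤ Q.card)
    (hQ' : 2 * t + 1 ≤ Q'.card) : t + 1 ≤ (Q ∩ Q').card := by
  have h1 := Finset.card_union_add_card_inter Q Q'
  have h2 := Finset.card_le_univ (Q ∪ Q')
  rw [Fintype.card_fin] at h2
  omega

lemma Inv.issued_of_wcert (hc : Inv c) (h : Sound c (.tsig (t + 1) m)) :
    ∃ i, i ∉ c.corrupted ∧ Issued (c.events i) i m := by
  obtain ⟨⟨Q, hQ, hm⟩, -⟩ := h
  obtain ⟨i, -, hi⟩ := hc.exists_issued hQ hm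
  exact ⟨i, hi⟩

lemma Inv.issued_of_qcert (hc : Inv c) (h : Sound c (.tsig (2 * t + 1) m)) :
    ∃ i, i ∉ c.corrupted ∧ Issued (c.events i) i m := by
  obtain ⟨⟨Q, hQ, hm⟩, -⟩ := h
  obtain ⟨i, -, hi⟩ := hc.exists_issued (by omega) hm
  exact ⟨i, hi⟩

/-- Two quorums among `3t + 1` parties share `t + 1` of them, at least one of which is uncorrupted
and so followed the protocol when signing both messages. -/
lemma Inv.issued_both (hc : Inv c) {m' : Msg t V} (h : Sound c (.tsig (2 * t + 1) m))
    (h' : Sound c (.tsig (2 * t + 1) m')) :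
    ∃ i, i ∉ c.corrupted ∧ Issued (c.events i) i m ∧ Issued (c.events i) i m' := by
  obtain ⟨⟨Q, hQ, hm⟩, -⟩ := h
  obtain ⟨⟨Q', hQ', hm'⟩, -⟩ := h'
  obtain ⟨i, hi, hi', h1⟩ := hc.exists_issued (card_inter_of_quorums hQ hQ')
    fun i hi => hm i (Finset.mem_inter.1 hi).1
  exact ⟨i, hi', h1, (hm' i (Finset.mem_inter.1 hi).2).resolve_left hi'⟩

end AsyncBA

end

/-! ### Safety: agreement, failed leaders, clean proposals, frequent inputs. -/

noncomputable section

namespace AsyncBA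

variable {t : ℕ} {V : Type u}

/-! ### Safety -/

variable {c c' : Config t V} {i p p' h : Party t} {m : Msg t V} {j k : ℕ} {v w : V} {o : Option V}

/-- The value `v` is the input of some party. -/
def Config.IsInput (c : Config t V) (v : V) : Prop := ∃ i, c.input i = v

lemma Inv.coins_of_lead (hc : Inv c) (hl : Lead (c.events i) j p) : c.coins j = some p.val :=
  hc.tossed _ _ _ hl

lemma eq_of_coins (h1 : c.coins j = some p.val) (h2 : c.coins j = some p'.val) : p = p' :=
  Fin.ext (Option.some.inj (h1.symm.trans h2))

lemma Inv.unique (hc : Inv c) {s : Slot t} {o' : Option V}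
    (h1 : Issued (c.events i) i (stmt s o)) (h2 : Issued (c.events i) i (stmt s o')) : o = o' :=
  (hc.wf i).issued_unique h1 h2

/-- A quorum has confirmed to hold the certificate of `p` in view `j`. -/
def Held (c : Config t V) (j : ℕ) (p : Party t) : Prop := Sound c (qcert (.hold j p) none)

lemma Inv.input_of_issued (hc : Inv c) (hi : Issued (c.events i) i (stmt .inp (some v))) :
    c.input i = v := by
  obtain ⟨pre, es, hs, he, -⟩ := (hc.wf i).issued hi
  exact (Option.some.inj he.2.2.1).symm

lemma Inv.isInput_of_wcert (hc : Inv c) (hw : Sound c (wcert .inp (some v))) : c.IsInput v := by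
  obtain ⟨i, -, hi⟩ := hc.issued_of_wcert hw
  exact ⟨i, hc.input_of_issued hi⟩

lemma Inv.of_ack (hc : Inv c) (hi : Issued (c.events i) i (stmt (.ack j p) (some v))) :
    Entered (c.events i) j ∧ Know (c.events i) (.sig p (stmt (.prop j) (some v))) ∧
      Valid (c.events i) j v := by
  obtain ⟨pre, es, hs, he, -⟩ := (hc.wf i).issued hi
  have hs := (List.suffix_cons _ _).trans hs
  obtain ⟨w, hw, -, -, hk, hv⟩ := he.2.2
  cases hw
  exact ⟨Entered.mono hs he.2.1, hk.mono hs, hv.mono hs⟩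

lemma Inv.of_vote (hc : Inv c) (hi : Issued (c.events i) i (stmt (.vote j) o)) :
    Entered (c.events i) j ∧ ∃ p, Lead (c.events i) j p ∧
      ((∃ v, o = some v ∧ Know (c.events i) (qcert (.ack j p) (some v))) ∨
        (o = none ∧ Know (c.events i) (qcert (.absent j) none))) := by
  obtain ⟨pre, es, hs, he, -⟩ := (hc.wf i).issued hi
  have hs := (List.suffix_cons _ _).trans hs
  obtain ⟨p, hp, hv⟩ := he.2.2
  exact ⟨Entered.mono hs he.2.1, p, hp.mono hs, hv.imp
    (fun ⟨v, ho, _, hk⟩ => ⟨v, ho, hk.mono hs⟩) fun ⟨ho, _, hk⟩ => ⟨ho, hk.mono hs⟩⟩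

lemma Inv.valid_of_qcert (hc : Inv c) (hq : Sound c (qcert (.ack j p) (some v))) :
    ∃ h, h ∉ c.corrupted ∧ Entered (c.events h) j ∧
      Know (c.events h) (.sig p (stmt (.prop j) (some v))) ∧ Valid (c.events h) j v := by
  obtain ⟨h, hh, hi⟩ := hc.issued_of_qcert hq
  exact ⟨h, hh, hc.of_ack hi⟩

/-- An uncorrupted party in both quorums would have signed two values in one slot. -/
lemma Inv.qcert_unique (hc : Inv c) {s : Slot t} {o' : Option V} (h1 : Sound c (qcert s o))
    (h2 : Sound c (qcert s o')) : o = o' := by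
  obtain ⟨h, -, ha, hb⟩ := hc.issued_both h1 h2
  exact hc.unique ha hb

lemma Inv.cert_of_vote (hc : Inv c) (hq : Sound c (qcert (.vote j) (some v))) :
    ∃ i p, Entered (c.events i) j ∧ Lead (c.events i) j p ∧
      Sound c (qcert (.ack j p) (some v)) := by
  obtain ⟨h, -, hi⟩ := hc.issued_of_qcert hq
  obtain ⟨he, p, hp, ⟨w, hw, hk⟩ | ⟨hw, -⟩⟩ := hc.of_vote hi
  · cases hw
    exact ⟨h, p, he, hp, hc.sound_of_know hk⟩
  · cases hw

/-- After a decision, no other value is legitimate in later views. -/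
lemma Inv.valid_after_vote (hc : Inv c) (hq : Sound c (qcert (.vote j) (some v))) :
    ∀ m h w, Valid (c.events h) (j + 1 + m) w → w = v := by
  intro m
  induction m with
  | zero =>
    -- In the next view a value comes either from the leader's certificate, which is unique and
    -- backs the vote for `v`, or from a quorum of empty votes, which the quorum for `v` excludes.
    rintro h w (⟨p, hp, hk⟩ | ⟨hk, -⟩)
    · obtain ⟨i, p', -, hp', hs⟩ := hc.cert_of_vote hq
      obtain rfl := eq_of_coins (hc.coins_of_lead hp) (hc.coins_of_lead hp')
      exact Option.some.inj (hc.qcert_unique (hc.sound_of_know hk) hs)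
    · exact absurd (hc.qcert_unique (hc.sound_of_know hk) hq) (by simp)
  | succ m ih =>
    rintro h w (⟨p, hp, hk⟩ | ⟨hk, hv⟩)
    · obtain ⟨h', -, -, -, hv⟩ := hc.valid_of_qcert (hc.sound_of_know hk)
      exact ih _ _ hv
    · exact ih _ _ hv

/-- In the later of two different views, the decided value was certified for the leader, hence
acknowledged as legitimate, hence equal to the value decided earlier. -/
lemma Inv.vote_unique (hc : Inv c) (h1 : Sound c (qcert (.vote j) (some v)))
    (h2 : Sound c (qcert (.vote k) (some w))) : v = w := by
  wlog hjk : j ≤ k generalizing j k v w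
  · exact (this h2 h1 (by omega)).symm
  rcases hjk.eq_or_lt with rfl | hjk
  · exact Option.some.inj (hc.qcert_unique h1 h2)
  · obtain ⟨m, rfl⟩ := Nat.exists_eq_add_of_le (Nat.succ_le_of_lt hjk)
    obtain ⟨i, p, -, -, hs⟩ := hc.cert_of_vote h2
    obtain ⟨h, -, -, -, hv⟩ := hc.valid_of_qcert hs
    exact (hc.valid_after_vote h1 m _ _ hv).symm

lemma Inv.vote_of_decided (hc : Inv c) (hd : LocalEvent.decided v ∈ c.events i) :
    ∃ j, Sound c (qcert (.vote j) (some v)) := by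
  obtain ⟨pre, hs⟩ := exists_suffix_of_mem hd
  obtain ⟨j, hj⟩ := act_eq_decide ((hc.wf i).of_suffix hs).1
  exact ⟨j, hc.sound_of_know (hj.mono ((List.suffix_cons _ _).trans hs))⟩

lemma Inv.decided_unique (hc : Inv c) (hd : LocalEvent.decided v ∈ c.events i)
    (hd' : LocalEvent.decided w ∈ c.events p) : v = w := by
  obtain ⟨j, hj⟩ := hc.vote_of_decided hd
  obtain ⟨k, hk⟩ := hc.vote_of_decided hd'
  exact hc.vote_unique hj hk

/-! ### Leaders whose certificate is held by a quorum -/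

/-- The leader of view `j` is elected, but its certificate is not held by a quorum. -/
def Failed (c : Config t V) (j : ℕ) : Prop :=
  ∃ p : Party t, c.coins j = some p.val ∧ ¬ Held c j p

/-- Some uncorrupted party both confirmed the leader's certificate and declared it absent; the rules
forbid this in either order. -/
lemma Inv.not_held (hc : Inv c) (hq : Sound c (qcert (.absent j) none))
    (hp : c.coins j = some p.val) : ¬ Held c j p := by
  intro hh
  obtain ⟨h, -, h1, h2⟩ := hc.issued_both hh hq
  obtain ⟨a, es, ha, he, -, hf⟩ := (hc.wf h).issued h1
  obtain ⟨b, es', hb, he', -, hf'⟩ := (hc.wf h).issued h2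
  obtain ⟨-, -, hab, v, hv⟩ := he.2.2
  obtain ⟨-, -, hab', p', hp', hn⟩ := he'.2.2
  obtain rfl := eq_of_coins hp
    (hc.coins_of_lead (hp'.mono ((List.suffix_cons _ _).trans hb)))
  -- If it confirmed earlier or in the same batch, it knew the certificate when declaring it absent;
  -- if it confirmed later, it had already abandoned the proposals.
  rcases suffix_cons_total ha hb with heq | hs | hs
  · obtain rfl := (List.cons.inj heq).2
    exact hn v hv
  · exact hn v (hv.mono ((List.suffix_cons _ _).trans hs))
  · exact hab (hab'.mono ((List.suffix_cons _ _).trans hs))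

/-- Entering a view requires an absence proof for every earlier one. Such a proof persists, so views
that have been passed stay failed, whereas `Failed` alone can be revoked by later confirmations. -/
lemma Inv.failed_of_entered (hc : Inv c) (he : Entered (c.events i) k) (hj : j < k) :
    Failed c j := by
  obtain ⟨-, hx, p, hp, -⟩ := he.of_le (Nat.succ_le_of_lt hj)
  exact ⟨p, hc.coins_of_lead hp, hc.not_held (hc.sound_of_know hx) (hc.coins_of_lead hp)⟩

/-- What must have happened when a coin becomes accessible. -/
lemma Inv.of_coin (hc : Inv c) (hk : Sound c (.tsig (t + 1) (.coin j))) :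
    (∃ i, Entered (c.events i) j) ∧ Sound c (qcert (.aband j) none) ∧
      2 * t + 1 ≤ {p | Held c j p}.ncard := by
  obtain ⟨i, -, hi⟩ := hc.issued_of_wcert hk
  obtain ⟨he, hab⟩ := (hc.wf i).issued_coin hi
  refine ⟨⟨i, he⟩, hc.sound_of_know hab, ?_⟩
  obtain ⟨a, -, ha⟩ := hc.issued_of_qcert (hc.sound_of_know hab)
  obtain ⟨pre, es, hs, hen, -⟩ := (hc.wf a).issued ha
  obtain ⟨-, -, hsk⟩ := hen.2.2
  -- Among the `t + 1` requests to end the proposals there is one by an uncorrupted party, which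
  -- itself saw `2t + 1` confirmed proposers.
  obtain ⟨b, -, hb⟩ := hc.issued_of_wcert
    (hc.sound_of_know (hsk.mono ((List.suffix_cons _ _).trans hs)))
  obtain ⟨pre', es', hs', hen', -⟩ := (hc.wf b).issued hb
  obtain ⟨-, -, hcard⟩ := hen'.2.2
  refine hcard.trans (Set.ncard_le_ncard ?_ (Set.toFinite _))
  exact fun p hp => hc.sound_of_know (Know.mono hp ((List.suffix_cons _ _).trans hs'))

lemma Inv.coins_before (hc : Inv c) (hk : Sound c (.tsig (t + 1) (.coin j))) (hkj : k < j) :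
    ∃ p : Party t, c.coins k = some p.val := by
  obtain ⟨⟨i, hi⟩, -⟩ := hc.of_coin hk
  obtain ⟨p, hp, -⟩ := hc.failed_of_entered hi hkj
  exact ⟨p, hp⟩

/-- The coins are accessed in the order of the views. -/
def Ordered (c : Config t V) : Prop := ∀ k j, k < j → c.coins j ≠ none → c.coins k ≠ none

lemma ordered_update (hc : Ordered c) {r : ℕ} (hb : ∀ k < j, ∃ p : Party t, c.coins k = some p.val)
    {a b : ℕ} (hab : a < b) (h : Function.update c.coins j (some r) b ≠ none) :
    Function.update c.coins j (some r) a ≠ none := by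
  simp only [Function.update_apply, ne_eq] at h ⊢
  split_ifs with ha
  · simp
  · split_ifs at h with hb'
    · subst hb'
      obtain ⟨p, hp⟩ := hb a hab
      simp [hp]
    · exact hc a b hab h

/-- A share of a coin is released only by a party in its view, and entering that view requires all
earlier leaders to be known. -/
lemma Ordered.trans (ho : Ordered c) (hc : Inv c) (h : Trans c c') : Ordered c' := by
  cases h with
  | toss i k r hi ha hk hr =>
    exact fun a b hab hb => ordered_update ho
      (fun k' hk' => hc.coins_before (hc.sound_of_know (act_eq_toss ha).2.1) hk') hab hb
  | peek k r hk hk' hr =>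
    exact fun a b hab hb => ordered_update ho
      (fun k' hk' => hc.coins_before (hc.sound_of_traffic hk) hk') hab hb
  | _ => exact ho

/-! ### Clean proposals -/

/-- Only input values can be certified for `p` in view `j`: a quorum has abandoned the proposals
of the view and acknowledged no other value of `p`. -/
def Clean (c : Config t V) (j : ℕ) (p : Party t) : Prop :=
  ∃ A : Finset (Party t), 2 * t + 1 ≤ A.card ∧ ∀ h ∈ A, h ∈ c.corrupted ∨
    (Issued (c.events h) h (stmt (.aband j) none) ∧
      ∀ v, Issued (c.events h) h (stmt (.ack j p) (some v)) → c.IsInput v)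

lemma Clean.mono (hc : Clean c j p) (h : Ext c c') (hc' : Inv c') : Clean c' j p := by
  obtain ⟨A, hA, hcl⟩ := hc
  refine ⟨A, hA, fun a ha => (hcl a ha).imp (fun hi => h.corrupted hi) fun ⟨hab, hack⟩ =>
    ⟨hab.mono (h.events a), fun v hv => ?_⟩⟩
  have hev := h.events a
  suffices hv' : Issued (c.events a) a (stmt (.ack j p) (some v)) by
    obtain ⟨i, hi⟩ := hack v hv'
    exact ⟨i, by rw [h.input]; exact hi⟩
  obtain ⟨pre, es, hs, he, -, hf⟩ := (hc'.wf a).issued hv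
  -- An acknowledgement newer than `c` would follow the party's abandonment, which its rule forbids;
  -- so the set of acknowledged values is frozen.
  rcases List.suffix_or_suffix_of_suffix hs hev with hsub | hsub
  · exact hf.mono hsub
  · rcases List.suffix_cons_iff.1 hsub with heq | hsub
    · rw [heq]
      exact hf
    · obtain ⟨w, -, -, hn, -⟩ := he.2.2
      exact absurd ⟨none, hab.mono hsub⟩ hn

/-- The quorum behind the certificate meets the quorum that makes `p` clean in an uncorrupted party,
which acknowledged only input values of `p`. -/
lemma Inv.isInput_of_clean (hc : Inv c) (hcl : Clean c j p)
    (hq : Sound c (qcert (.ack j p) (some v))) : c.IsInput v := by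
  obtain ⟨A, hA, hcl⟩ := hcl
  obtain ⟨⟨Q, hQ, hq⟩, -⟩ := hq
  obtain ⟨i, hi, hi'⟩ := Finset.exists_mem_notMem_of_card_lt_card
    (lt_of_le_of_lt hc.card (Nat.lt_of_succ_le (card_inter_of_quorums hA hQ)))
  rw [Finset.mem_inter] at hi
  exact ((hcl i hi.1).resolve_left hi').2 v ((hq i hi.2).resolve_left hi')

/-- If the earlier leaders are clean then parties propose input values. -/
lemma Inv.isInput_of_prop (hc : Inv c) :
    ∀ {j v}, (∀ k < j, ∀ p : Party t, c.coins k = some p.val → Clean c k p) →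
      Issued (c.events i) i (stmt (.prop j) (some v)) → c.IsInput v := by
  intro j
  induction j with
  | zero =>
    intro v hcl hi
    obtain ⟨pre, es, hs, he, -⟩ := (hc.wf i).issued hi
    obtain ⟨w, m, hw, -, hk, rfl | ⟨rfl, -⟩⟩ := he.2.2
    · cases hw
      exact hc.isInput_of_wcert (hc.sound_of_know (hk.mono ((List.suffix_cons _ _).trans hs)))
    · cases hw
      exact ⟨i, rfl⟩
  | succ j ih =>
    intro v hcl hi
    obtain ⟨pre, es, hs, he, -⟩ := (hc.wf i).issued hi
    have hs := (List.suffix_cons _ _).trans hs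
    obtain ⟨w, m, hw, -, hk, ⟨p, hp, rfl⟩ | ⟨-, hp⟩⟩ := he.2.2
    · cases hw
      exact hc.isInput_of_clean (hcl j (by omega) p (hc.coins_of_lead (hp.mono hs)))
        (hc.sound_of_know (hk.mono hs))
    · cases hw
      exact ih (fun k hk => hcl k (by omega)) (hp.mono hs)

/-- A party that is uncorrupted when the coin becomes accessible is clean. -/
lemma Inv.clean_of_coin (hc : Inv c) (hk : Sound c (.tsig (t + 1) (.coin j)))
    (hp : p ∉ c.corrupted)
    (hcl : ∀ k < j, ∀ p : Party t, c.coins k = some p.val → Clean c k p) : Clean c j p := by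
  obtain ⟨⟨A, hA, hq⟩, -⟩ := (hc.of_coin hk).2.1
  refine ⟨A, hA, fun a ha => (hq a ha).imp_right fun hi => ⟨hi, fun v hv => ?_⟩⟩
  -- Whatever was acknowledged carries the signature of `p`, who is still uncorrupted and hence
  -- proposed by the rules.
  exact hc.isInput_of_prop hcl ((hc.sound_of_know (hc.of_ack hv).2.1).1.resolve_left hp)

/-- A leader that is not clean was elected before any leader whose certificate was held. -/
def Lost (c : Config t V) : Prop :=
  ∃ j, ∃ p : Party t, c.coins j = some p.val ∧ ¬ Clean c j p ∧ ∀ k < j, Failed c k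

/-- The deciding view has a leader certified for a value that is no input, hence unclean; reaching
that view means that all earlier views failed. -/
lemma Inv.lost_of_decided (hc : Inv c) (hd : LocalEvent.decided v ∈ c.events i)
    (hv : ¬ c.IsInput v) : Lost c := by
  obtain ⟨j, hj⟩ := hc.vote_of_decided hd
  obtain ⟨h, p, he, hp, hs⟩ := hc.cert_of_vote hj
  exact ⟨j, p, hc.coins_of_lead hp, fun hcl => hv (hc.isInput_of_clean hcl hs),
    fun k hk => hc.failed_of_entered he hk⟩

/-! ### Inputs with a frequent value -/

/-- Without a certificate of mixed inputs, legitimacy starts from certified inputs, and later views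
only hand on legitimate values. -/
lemma Inv.isInput_of_valid (hc : Inv c) (hb : ¬ Sound c (wcert .echo none)) :
    ∀ {j h v}, Valid (c.events h) j v → c.IsInput v := by
  intro j
  induction j with
  | zero =>
    rintro h v (hk | hk)
    · exact hc.isInput_of_wcert (hc.sound_of_know hk)
    · exact absurd (hc.sound_of_know hk) hb
  | succ j ih =>
    rintro h v (⟨p, -, hk⟩ | ⟨-, hv⟩)
    · obtain ⟨h', -, -, -, hv⟩ := hc.valid_of_qcert (hc.sound_of_know hk)
      exact ih hv
    · exact ih hv

lemma Inv.isInput_of_decided (hc : Inv c) (hb : ¬ Sound c (wcert .echo none))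
    (hd : LocalEvent.decided v ∈ c.events i) : c.IsInput v := by
  obtain ⟨j, hj⟩ := hc.vote_of_decided hd
  obtain ⟨h, p, he, hp, hs⟩ := hc.cert_of_vote hj
  obtain ⟨h', -, -, -, hv⟩ := hc.valid_of_qcert hs
  exact hc.isInput_of_valid hb hv

/-- If a value is sufficiently frequent then nobody reports that the inputs are mixed. -/
lemma Inv.not_sound_echo (hc : Inv c)
    (hv : 2 * t + 1 + c.corrupted.card ≤ {i | c.input i = v}.ncard) :
    ¬ Sound c (wcert .echo none) := by
  intro hs
  obtain ⟨a, -, ha⟩ := hc.issued_of_wcert hs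
  obtain ⟨pre, es, hs, he, -⟩ := (hc.wf a).issued ha
  have hs := (List.suffix_cons _ _).trans hs
  obtain ⟨hcard, ⟨w, hw, -⟩ | ⟨-, -, hno⟩⟩ := he.2.2
  · cases hw
  classical
  set P : Finset (Party t) := Set.toFinset {p | ∃ w, Know pre (.sig p (stmt .inp (some w)))}
    with hP
  rw [Set.ncard_eq_toFinset_card'] at hcard hv
  set I : Finset (Party t) := Set.toFinset {i | c.input i = v} with hI
  -- The uncorrupted parties with input `v` form a quorum; they meet the `2t + 1` known signers in
  -- `t + 1` parties, whose signatures yield the certificate that the reporting party claimed not to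
  -- know.
  have hGc : 2 * t + 1 ≤ (I \ c.corrupted).card := by
    have := Finset.le_card_sdiff c.corrupted I
    omega
  have hint := card_inter_of_quorums hGc hcard
  refine hno v (.combine ((I \ c.corrupted) ∩ P) hint (derivable_stmt _ _ _ _) fun p hp => ?_)
  rw [Finset.mem_inter, Finset.mem_sdiff, hI, hP, Set.mem_toFinset, Set.mem_toFinset] at hp
  obtain ⟨⟨hpv, hpc⟩, w, hw⟩ := hp
  change c.input p = v at hpv
  have := hc.input_of_issued ((hc.sound_of_know (hw.mono hs)).1.resolve_left hpc)
  rw [← hpv, this]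
  exact hw

end AsyncBA

end

/-! ### Expectations over paths, via the Markov property. -/

noncomputable section

namespace AsyncBA

variable {t : ℕ} {V : Type u}

/-! ### The measure on paths -/

namespace Ensemble

variable {A : Algorithm t V} (E : Ensemble A)

/-- The root of the tree. -/
def root : Node t V := ⟨Config.init E.input, []⟩

instance : IsProbabilityMeasure E.law :=
  inferInstanceAs (IsProbabilityMeasure (Kernel.traj (X := fun _ => Node t V) E.transition 0 _))

/-- The law of the paths, given the first nodes. -/
lemma lintegral_law_eq (s : ℕ) {f : (ℕ → Node t V) → ℝ≥0∞} (hf : Measurable f) :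
    ∫⁻ ω, f ω ∂E.law = ∫⁻ h, ∫⁻ ω, f ω ∂(Kernel.traj (X := fun _ => Node t V) E.transition s h)
      ∂(Kernel.partialTraj (X := fun _ => Node t V) E.transition 0 s fun _ => E.root) := by
  rw [← Kernel.lintegral_comp _ _ _ hf, Kernel.traj_comp_partialTraj (Nat.zero_le s)]
  rfl

lemma lintegral_next (s : ℕ) (h : Finset.Iic s → Node t V) (g : Node t V → ℝ≥0∞) :
    ∫⁻ ω, g (ω (s + 1)) ∂(Kernel.traj (X := fun _ => Node t V) E.transition s h) =
      ∫⁻ y, g y ∂(children A E.strategy (h ⟨s, Finset.mem_Iic.2 le_rfl⟩)).toMeasure := by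
  rw [← lintegral_map (f := g) measurable_from_top (measurable_pi_apply (s + 1)),
    ← Kernel.map_apply _ (measurable_pi_apply (s + 1)), Kernel.map_traj_succ_self]
  rfl

lemma measurable_eval {β : Type*} [MeasurableSpace β] (g : Node t V → β) (s : ℕ) :
    Measurable fun ω : ℕ → Node t V => g (ω s) :=
  measurable_from_top.comp (measurable_pi_apply s)

/-- One-step Markov property: conditioning on the first nodes leaves an average over the children of
the last one. -/
lemma lintegral_succ (s : ℕ) (g : Node t V → ℝ≥0∞) :
    ∫⁻ ω, g (ω (s + 1)) ∂E.law =
      ∫⁻ ω, ∫⁻ y, g y ∂(children A E.strategy (ω s)).toMeasure ∂E.law := by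
  rw [E.lintegral_law_eq s (measurable_eval g (s + 1)), E.lintegral_law_eq s
    (measurable_eval (fun x => ∫⁻ y, g y ∂(children A E.strategy x).toMeasure) s)]
  refine lintegral_congr fun h => ?_
  rw [E.lintegral_next, Kernel.lintegral_traj (κ := E.transition) _
    (measurable_eval (fun x => ∫⁻ y, g y ∂(children A E.strategy x).toMeasure) s)]
  simp [Function.updateFinset]

lemma lintegral_zero (g : Node t V → ℝ≥0∞) : ∫⁻ ω, g (ω 0) ∂E.law = g E.root := by
  unfold law
  rw [Kernel.lintegral_traj (κ := E.transition) _ (measurable_eval g 0)]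
  simp [Function.updateFinset, root]

lemma ae_zero : ∀ᵐ ω ∂E.law, ω 0 = E.root := by
  have h := E.lintegral_zero (({E.root}ᶜ : Set (Node t V)).indicator 1)
  rw [Set.indicator_of_notMem (by simp), lintegral_eq_zero_iff (measurable_eval _ 0)] at h
  filter_upwards [h] with ω hω
  by_contra hne
  simp [hne] at hω

/-- The nodes at depth `s`. -/
def level : ℕ → Set (Node t V)
  | 0 => {E.root}
  | s + 1 => ⋃ x ∈ level s, (children A E.strategy x).support

/-- The type of nodes may be uncountable. Countable levels allow the null sets for the individual
nodes to be united in `ae_isPath`. -/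
lemma countable_level (s : ℕ) : (E.level s).Countable := by
  induction s with
  | zero => exact Set.countable_singleton _
  | succ s ih => exact ih.biUnion fun x _ => PMF.support_countable _

lemma ae_level (s : ℕ) : ∀ᵐ ω ∂E.law, ω s ∈ E.level s := by
  induction s with
  | zero => exact E.ae_zero
  | succ s ih =>
    have h := E.lintegral_succ s ((E.level (s + 1))ᶜ.indicator 1)
    have h0 : ∫⁻ ω, ∫⁻ y, ((E.level (s + 1))ᶜ.indicator 1 y : ℝ≥0∞)
        ∂(children A E.strategy (ω s)).toMeasure ∂E.law = ∫⁻ _, 0 ∂E.law := by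
      refine lintegral_congr_ae ?_
      filter_upwards [ih] with ω hω
      rw [lintegral_indicator_one MeasurableSpace.measurableSet_top,
        PMF.toMeasure_apply_eq_zero_iff _ MeasurableSpace.measurableSet_top]
      refine Set.disjoint_left.2 fun y hy hy' => hy' ?_
      exact Set.mem_biUnion hω hy
    rw [h0, MeasureTheory.lintegral_zero, lintegral_eq_zero_iff (measurable_eval _ (s + 1))] at h
    filter_upwards [h] with ω hω
    by_contra hne
    simp [hne] at hω

lemma ae_child (s : ℕ) (x : Node t V) :
    ∀ᵐ ω ∂E.law, ω s = x → ω (s + 1) ∈ (children A E.strategy x).support := by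
  set B : Set (Node t V) := (children A E.strategy x).supportᶜ with hB
  have hm : Measurable fun ω : ℕ → Node t V =>
      (({x} : Set (Node t V)).indicator 1 (ω s) * B.indicator 1 (ω (s + 1)) : ℝ≥0∞) :=
    (measurable_eval _ s).mul (measurable_eval _ (s + 1))
  have h := E.lintegral_law_eq s hm
  -- Given the history, the first factor is constant and the second integrates to the probability of
  -- leaving the support of the children.
  have h0 : ∀ h : Finset.Iic s → Node t V,
      ∫⁻ ω, (({x} : Set (Node t V)).indicator 1 (ω s) * B.indicator 1 (ω (s + 1)) : ℝ≥0∞)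
        ∂(Kernel.traj (X := fun _ => Node t V) E.transition s h) = 0 := by
    intro h
    rw [Kernel.lintegral_traj (κ := E.transition) _ hm]
    simp only [Function.updateFinset, Finset.mem_Iic, le_refl, dite_true,
      add_le_iff_nonpos_right, nonpos_iff_eq_zero, one_ne_zero, dite_false]
    rw [lintegral_const_mul _ (measurable_eval _ (s + 1)), E.lintegral_next s h]
    by_cases hx : h ⟨s, Finset.mem_Iic.2 le_rfl⟩ = x
    · rw [hx, lintegral_indicator_one MeasurableSpace.measurableSet_top,
        (PMF.toMeasure_apply_eq_zero_iff _ MeasurableSpace.measurableSet_top).2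
          disjoint_compl_right, mul_zero]
    · rw [Set.indicator_of_notMem (by simpa using hx), zero_mul]
  simp only [h0, MeasureTheory.lintegral_zero] at h
  rw [lintegral_eq_zero_iff hm] at h
  filter_upwards [h] with ω hω hx
  by_contra hne
  have : ω (s + 1) ∈ B := hne
  simp [hx, this] at hω

lemma ae_isPath : ∀ᵐ ω ∂E.law, E.IsPath ω := by
  have h : ∀ᵐ ω ∂E.law, ∀ s, ∀ x ∈ E.level s, ω s = x →
      ω (s + 1) ∈ (children A E.strategy x).support :=
    ae_all_iff.2 fun s => (ae_ball_iff (E.countable_level s)).2 fun x _ => E.ae_child s x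
  filter_upwards [E.ae_zero, h, ae_all_iff.2 E.ae_level] with ω h0 h1 h2
  exact ⟨h0, fun s => h1 s _ (h2 s) rfl⟩

/-- The expectation of a function that does not increase on average from parent to child. -/
lemma lintegral_le_of_supermartingale {g : Node t V → ℝ≥0∞}
    (hg : ∀ ω, E.IsPath ω → ∀ s,
      ∫⁻ y, g y ∂(children A E.strategy (ω s)).toMeasure ≤ g (ω s)) (s : ℕ) :
    ∫⁻ ω, g (ω s) ∂E.law ≤ g E.root := by
  induction s with
  | zero => exact (E.lintegral_zero g).le
  | succ s ih =>
    rw [E.lintegral_succ]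
    refine (lintegral_mono_ae ?_).trans ih
    filter_upwards [E.ae_isPath] with ω hω using hg ω hω s

end Ensemble
end AsyncBA
end

/-! ### Supermartingale bounds for failed views and unclean leaders. -/

noncomputable section

namespace AsyncBA

variable {t : ℕ} {V : Type u}

/-! ### The effect of a move on the distribution of the configurations -/

variable {c c' : Config t V} {i p : Party t} {m : Msg t V} {j k : ℕ} {v : V}

/-- The configurations differ at most in coins and accesses to coins. -/
structure SameSent (c c' : Config t V) : Prop where
  input : c'.input = c.input
  corrupted : c'.corrupted = c.corrupted
  issued : ∀ i m, Issued (c'.events i) i m ↔ Issued (c.events i) i m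

lemma SameSent.auth (h : SameSent c c') : Auth c' i m ↔ Auth c i m := by
  rw [Auth, Auth, h.corrupted, h.issued]

lemma SameSent.sound (h : SameSent c c') : ∀ {m : Msg t V}, Sound c' m ↔ Sound c m
  | .nat _ | .val _ | .coin _ => Iff.rfl
  | .pair _ _ => and_congr h.sound h.sound
  | .sig _ _ => and_congr h.auth h.sound
  | .tsig _ _ => and_congr (exists_congr fun _ => and_congr_right fun _ =>
      forall₂_congr fun _ _ => h.auth) h.sound

lemma SameSent.clean (h : SameSent c c') : Clean c' j p ↔ Clean c j p := by
  simp only [Clean, h.corrupted, h.issued, Config.IsInput, h.input]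

lemma issued_tossed {r : Option ℕ} {c : Config t V} {q : Party t} :
    Issued ((c.record i (.tossed k r)).events q) q m ↔ Issued (c.events q) q m := by
  rcases eq_or_ne q i with rfl | h
  · rw [record_events_self]
    simp only [Issued, sent_cons]
    simp
  · rw [record_events_of_ne _ _ h]

lemma flip_fresh (hj : c.coins j = none) : c.flip (protocol t V) j =
    (PMF.uniformOfFintype (Party t)).map fun p =>
      (p.val, { c with coins := Function.update c.coins j (some p.val) }) := by
  unfold Config.flip
  rw [hj]
  simp only [protocol, PMF.map_comp]
  rfl

/-- The coin of view `j` becomes accessible and elects `p`, which leads to the configuration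
`D p`. -/
structure Toss (c : Config t V) (j : ℕ) (D : Party t → Config t V) : Prop where
  fresh : c.coins j = none
  sound : Sound c (.tsig (t + 1) (.coin j))
  coins : ∀ p, (D p).coins = Function.update c.coins j (some p.val)
  same : ∀ p, SameSent c (D p)

/-- A move either has a definite effect and accesses no new coin, or elects a leader uniformly at
random. -/
lemma Inv.next_cases (hc : Inv c) (mv : Move t V) :
    (∃ c', c.next (protocol t V) mv = PMF.pure c' ∧ c'.coins = c.coins) ∨
    ∃ j D, Toss c j D ∧
      c.next (protocol t V) mv = (PMF.uniformOfFintype (Party t)).map D := by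
  cases mv with
  | step i =>
    simp only [Config.next]
    split_ifs with hi
    · exact .inl ⟨c, rfl, rfl⟩
    cases ha : act i (c.input i) (c.events i) with
    | send l => exact .inl ⟨_, localStep_send ha, rfl⟩
    | decide v => exact .inl ⟨_, localStep_decide ha, rfl⟩
    | toss j =>
      rw [localStep_toss ha]
      cases hj : c.coins j with
      | some r =>
        refine .inl ⟨c.record i (.tossed j (some r)), ?_, rfl⟩
        simp only [Config.flip, hj, PMF.pure_map]
      | none =>
        refine .inr ⟨j, fun p => Config.record
          { c with coins := Function.update c.coins j (some p.val) } i (.tossed j (some p.val)),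
          ⟨hj, hc.sound_of_know (act_eq_toss ha).2.1, fun _ => rfl,
            fun p => ⟨rfl, rfl, fun q m => issued_tossed⟩⟩, ?_⟩
        rw [flip_fresh hj, PMF.map_comp]
        rfl
  | deliver k =>
    simp only [Config.next]
    split
    · split_ifs
      · exact .inl ⟨c, rfl, rfl⟩
      · exact .inl ⟨_, rfl, rfl⟩
    · exact .inl ⟨c, rfl, rfl⟩
  | corrupt i =>
    simp only [Config.next]
    split_ifs
    · exact .inl ⟨_, rfl, rfl⟩
    · exact .inl ⟨c, rfl, rfl⟩
  | inject i d m =>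
    simp only [Config.next]
    split_ifs
    · exact .inl ⟨_, rfl, rfl⟩
    · exact .inl ⟨c, rfl, rfl⟩
  | peek j =>
    simp only [Config.next]
    split_ifs with hk
    · cases hj : c.coins j with
      | some r =>
        refine .inl ⟨c, ?_, rfl⟩
        simp only [Config.flip, hj, PMF.pure_map]
      | none =>
        refine .inr ⟨j, fun p => { c with coins := Function.update c.coins j (some p.val) },
          ⟨hj, hc.sound_of_traffic hk, fun _ => rfl, fun p => ⟨rfl, rfl, fun q m => Iff.rfl⟩⟩, ?_⟩
        rw [flip_fresh hj, PMF.map_comp]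
        rfl
    · exact .inl ⟨c, rfl, rfl⟩

lemma lintegral_children {A : Algorithm t V} {σ : Strategy t V} {x : Node t V}
    (g : Config t V → ℝ≥0∞) {α : Type*} [Fintype α] [MeasurableSpace α]
    [MeasurableSingletonClass α] {q : PMF α} {D : α → Config t V}
    (h : x.cur.next A (σ x) = q.map D) :
    ∫⁻ y, g y.cur ∂(children A σ x).toMeasure = ∑ a, g (D a) * q a := by
  have hm : Measurable fun a => (⟨D a, x.cur :: x.past⟩ : Node t V) := measurable_of_finite _
  have : children A σ x = q.map fun a => ⟨D a, x.cur :: x.past⟩ := by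
    rw [children, h, PMF.map_comp]
    rfl
  rw [this, ← PMF.toMeasure_map (hf := hm), lintegral_map measurable_from_top hm, lintegral_fintype]
  simp only [PMF.toMeasure_apply_singleton _ _ (MeasurableSet.singleton _)]

/-! ### Paths of the protocol -/

section Path

variable {E : Ensemble (protocol t V)} {ω : ℕ → Node t V}

lemma mem_support_next (hω : E.IsPath ω) (s : ℕ) :
    (ω (s + 1)).cur ∈ ((ω s).cur.next (protocol t V) (E.strategy (ω s))).support := by
  have h := hω.2 s
  rw [children, PMF.mem_support_map_iff] at h
  obtain ⟨c', hc', h⟩ := h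
  rwa [← h]

lemma inv_path (hω : E.IsPath ω) (s : ℕ) : Inv (ω s).cur := by
  induction s with
  | zero =>
    rw [hω.1]
    exact inv_init _
  | succ s ih => exact ih.trans (trans_of_mem_support ih.coins_lt (mem_support_next hω s))

lemma trans_path (hω : E.IsPath ω) (s : ℕ) : Trans (ω s).cur (ω (s + 1)).cur :=
  trans_of_mem_support (inv_path hω s).coins_lt (mem_support_next hω s)

lemma ordered_path (hω : E.IsPath ω) (s : ℕ) : Ordered (ω s).cur := by
  induction s with
  | zero =>
    rw [hω.1]
    intro a b _ h
    exact absurd rfl h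
  | succ s ih => exact ih.trans (inv_path hω s) (trans_path hω s)

lemma ext_path (hω : E.IsPath ω) {s s' : ℕ} (h : s ≤ s') : Ext (ω s).cur (ω s').cur := by
  induction h with
  | refl => exact .refl _
  | step _ ih => exact ih.trans (trans_path hω _).ext

lemma input_path (hω : E.IsPath ω) (s : ℕ) : (ω s).cur.input = E.input := by
  rw [(ext_path hω (Nat.zero_le s)).input, hω.1]
  rfl

lemma card_le_faults (hω : E.IsPath ω) (s : ℕ) : (ω s).cur.corrupted.card ≤ E.faults := by
  refine le_csSup ⟨t, ?_⟩ ⟨ω, hω, s, rfl⟩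
  rintro k ⟨ω', hω', s', rfl⟩
  exact (inv_path hω' s').card

lemma faults_le (E : Ensemble (protocol t V)) : E.faults ≤ t := by
  refine csSup_le' ?_
  rintro k ⟨ω', hω', s', rfl⟩
  exact (inv_path hω' s').card

end Path

/-! ### Expectations -/

/-- A leader is elected whose certificate is held by a quorum. -/
def Won (c : Config t V) : Prop := ∃ j, ∃ p : Party t, c.coins j = some p.val ∧ Held c j p

lemma Failed.of_ext (h : Ext c c') (hco : c'.coins = c.coins) (hf : Failed c' j) : Failed c j := by
  obtain ⟨p, hp, hn⟩ := hf
  exact ⟨p, hco ▸ hp, fun hh => hn (hh.mono h)⟩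

lemma Won.mono (h : Ext c c') (hw : Won c) : Won c' := by
  obtain ⟨j, p, hp, hh⟩ := hw
  exact ⟨j, p, h.coins _ _ hp, hh.mono h⟩

lemma not_won_of_failed (h : Failed c j) {p : Party t} (hp : c.coins j = some p.val)
    (hh : Held c j p) : False := by
  obtain ⟨p', hp', hn⟩ := h
  exact hn (eq_of_coins hp hp' ▸ hh)

/-- Between elections a loss can only be undone: clean parties stay clean, and confirmations only
accumulate, so no view becomes failed. -/
lemma Lost.of_ext (h : Ext c c') (hc' : Inv c') (hco : c'.coins = c.coins) (hl : Lost c') :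
    Lost c := by
  obtain ⟨j, p, hp, hn, hf⟩ := hl
  exact ⟨j, p, hco ▸ hp, fun hcl => hn (hcl.mono h hc'), fun k hk => (hf k hk).of_ext h hco⟩

open Classical in
/-- The number of views that failed before the first one that did not. -/
def failures (c : Config t V) : ℝ≥0∞ := ∑' k, if ∀ j ≤ k, Failed c j then 1 else 0

open Classical in
/-- The number of failed views, and a bound on the expected number of further ones. -/
def failureBound (c : Config t V) : ℝ≥0∞ := failures c + if Won c then 0 else 2⁻¹

open Classical in
/-- A bound on the probability that a value is decided that is not an input, if at most `f`
parties are corrupted. -/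
def lossBound (f : ℕ) (c : Config t V) : ℝ≥0∞ :=
  if Lost c then 1 else if Won c then 0 else (f : ℝ≥0∞) / ((2 * t + 1 : ℕ) : ℝ≥0∞)

lemma failureBound_anti (h : Ext c c') (hco : c'.coins = c.coins) :
    failureBound c' ≤ failureBound c := by
  refine add_le_add (ENNReal.tsum_le_tsum fun k => ?_) ?_
  · split_ifs with h1 h2 h2
    · exact le_rfl
    · exact absurd (fun j hj => (h1 j hj).of_ext h hco) h2
    · exact zero_le_one
    · exact le_rfl
  · split_ifs with h1 h2 h2
    · exact le_rfl
    · exact zero_le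
    · exact absurd (h2.mono h) h1
    · exact le_rfl

lemma ennreal_div_le_one {f : ℕ} (hf : f ≤ t) :
    (f : ℝ≥0∞) / ((2 * t + 1 : ℕ) : ℝ≥0∞) ≤ 1 := by
  refine ENNReal.div_le_of_le_mul ?_
  rw [one_mul]
  exact_mod_cast (by omega : f ≤ 2 * t + 1)

lemma lossBound_anti {f : ℕ} (hf : f ≤ t) (h : Ext c c') (hc' : Inv c')
    (hco : c'.coins = c.coins) : lossBound f c' ≤ lossBound f c := by
  unfold lossBound
  by_cases hl : Lost c
  · rw [if_pos hl]
    split_ifs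
    · exact le_rfl
    · exact zero_le
    · exact ennreal_div_le_one hf
  · rw [if_neg hl, if_neg fun h1 => hl (h1.of_ext h hc' hco)]
    split_ifs with h1 h2 h2
    · exact le_rfl
    · exact zero_le
    · exact absurd (h2.mono h) h1
    · exact le_rfl

namespace Toss

variable {D : Party t → Config t V} {q : Party t}

lemma held (h : Toss c j D) : Held (D p) k q ↔ Held c k q := (h.same p).sound

lemma failed_of_ne (h : Toss c j D) (hk : k ≠ j) : Failed (D p) k ↔ Failed c k := by
  simp only [Failed, h.held, h.coins, Function.update_of_ne hk]

lemma failed (h : Toss c j D) : Failed (D p) j ↔ ¬ Held c j p := by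
  simp only [Failed, h.held, h.coins, Function.update_self]
  refine ⟨fun ⟨q, hq, hn⟩ => ?_, fun h => ⟨p, rfl, h⟩⟩
  rwa [Fin.ext (Option.some.inj hq)]

lemma not_failed (h : Toss c j D) (ho : Ordered c) (hk : j < k) : ¬ Failed (D p) k := by
  rw [h.failed_of_ne hk.ne']
  rintro ⟨q, hq, -⟩
  exact ho j k hk (by simp [hq]) h.fresh

lemma lt_of_coins (h : Toss c j D) (ho : Ordered c) (hk : c.coins k = some q.val) : k < j := by
  by_contra hlt
  rcases (not_lt.1 hlt).eq_or_lt with rfl | h'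
  · simp [h.fresh] at hk
  · exact ho j k h' (by simp [hk]) h.fresh

lemma won (h : Toss c j D) (ho : Ordered c) (hw : Won c) : Won (D p) := by
  obtain ⟨k, q, hk, hh⟩ := hw
  refine ⟨k, q, ?_, h.held.2 hh⟩
  rw [h.coins, Function.update_of_ne (h.lt_of_coins ho hk).ne]
  exact hk

-- Coins are sampled in order, so only the term of view `j` is new; it counts only if the leader is
-- unconfirmed and all earlier views failed, which excludes an earlier win.
open Classical in
lemma failures_le (h : Toss c j D) (ho : Ordered c) :
    failures (D p) ≤ failures c + if ¬ Won c ∧ ¬ Held c j p then 1 else 0 := by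
  have : (if ¬ Won c ∧ ¬ Held c j p then 1 else 0 : ℝ≥0∞) =
      ∑' k, if k = j then (if ¬ Won c ∧ ¬ Held c j p then 1 else 0) else 0 := by
    rw [tsum_ite_eq]
  rw [this, failures, failures, ← ENNReal.tsum_add]
  refine ENNReal.tsum_le_tsum fun k => ?_
  by_cases hk : ∀ i ≤ k, Failed (D p) i
  · rw [if_pos hk]
    rcases lt_trichotomy k j with hkj | rfl | hkj
    · rw [if_pos fun i hi => (h.failed_of_ne (by omega)).1 (hk i hi)]
      exact le_self_add
    · rw [if_pos rfl, if_pos (c := ¬ Won c ∧ ¬ Held c k p)]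
      · exact le_add_self
      · refine ⟨?_, h.failed.1 (hk k le_rfl)⟩
        rintro ⟨i, q, hi, hh⟩
        have hlt := h.lt_of_coins ho hi
        exact not_won_of_failed ((h.failed_of_ne hlt.ne).1 (hk i hlt.le)) hi hh
    · exact absurd (hk k le_rfl) (h.not_failed ho hkj)
  · rw [if_neg hk]
    exact zero_le

/-- A new loss is due to the new leader. The earlier leaders were all clean, since an unclean one
would have been a loss already, so an uncorrupted leader would be clean by `Inv.clean_of_coin`. -/
lemma lost (h : Toss c j D) (hc : Inv c) (ho : Ordered c) (hl : Lost (D p)) :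
    Lost c ∨ (p ∈ c.corrupted ∧ ¬ Won c) := by
  by_contra! hcon
  obtain ⟨hl', hcon⟩ := hcon
  obtain ⟨k, q, hk, hn, hf⟩ := hl
  rw [(h.same p).clean] at hn
  rw [h.coins] at hk
  rcases eq_or_ne k j with rfl | hkj
  · rw [Function.update_self] at hk
    obtain rfl : p = q := Fin.ext (Option.some.inj hk)
    have hf' : ∀ i < k, Failed c i := fun i hi => (h.failed_of_ne hi.ne).1 (hf i hi)
    have hp : p ∈ c.corrupted := by
      by_contra hp
      refine hn (hc.clean_of_coin h.sound hp fun i hi q hq => ?_)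
      by_contra hncl
      exact hl' ⟨i, q, hq, hncl, fun i' hi' => hf' i' (hi'.trans hi)⟩
    obtain ⟨i, q, hi, hh⟩ := hcon hp
    exact not_won_of_failed (hf' i (h.lt_of_coins ho hi)) hi hh
  · rw [Function.update_of_ne hkj] at hk
    have := h.lt_of_coins ho hk
    exact hl' ⟨k, q, hk, hn, fun i hi => (h.failed_of_ne (by omega)).1 (hf i hi)⟩

open Classical in
lemma card_not_held (h : Toss c j D) (hc : Inv c) :
    (Finset.univ.filter fun p => ¬ Held c j p).card ≤ t := by
  have h1 := (hc.of_coin h.sound).2.2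
  rw [Set.ncard_eq_toFinset_card'] at h1
  have h2 : (Finset.univ.filter fun p => ¬ Held c j p) = (Set.toFinset {p | Held c j p})ᶜ := by
    ext p
    simp
  rw [h2, Finset.card_compl, Fintype.card_fin]
  omega

end Toss

/-- Here `a` is the cost common to all leaders, `b p` the extra cost of electing `p`, and `B` a
bound for the mean extra cost. -/
lemma average_le {g b : Party t → ℝ≥0∞} {a B : ℝ≥0∞} (h1 : ∀ p, g p ≤ a + b p)
    (h2 : ∑ p, b p ≤ ((3 * t + 1 : ℕ) : ℝ≥0∞) * B) :
    ∑ p, g p * PMF.uniformOfFintype (Party t) p ≤ a + B := by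
  simp only [PMF.uniformOfFintype_apply, Fintype.card_fin]
  rw [← Finset.sum_mul, ← div_eq_mul_inv]
  refine ENNReal.div_le_of_le_mul ?_
  calc ∑ p, g p ≤ ∑ p, (a + b p) := Finset.sum_le_sum fun p _ => h1 p
    _ = ((3 * t + 1 : ℕ) : ℝ≥0∞) * a + ∑ p, b p := by
      rw [Finset.sum_add_distrib, Finset.sum_const, Finset.card_univ, Fintype.card_fin,
        nsmul_eq_mul]
    _ ≤ ((3 * t + 1 : ℕ) : ℝ≥0∞) * a + ((3 * t + 1 : ℕ) : ℝ≥0∞) * B := by gcongr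
    _ = (a + B) * ((3 * t + 1 : ℕ) : ℝ≥0∞) := by ring

-- Before a win, an unconfirmed leader costs one failure plus at most the remaining 1/2, and a
-- confirmed one costs nothing. The mean extra cost is at most `(t / n) * (3 / 2) ≤ 1 / 2`, the
-- share already reserved.
open Classical in
lemma Toss.average_failureBound {D : Party t → Config t V} (h : Toss c j D) (hc : Inv c)
    (ho : Ordered c) :
    ∑ p, failureBound (D p) * PMF.uniformOfFintype (Party t) p ≤ failureBound c := by
  by_cases hw : Won c
  · have := average_le (g := fun p => failureBound (D p)) (b := 0) (a := failures c) (B := 0)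
      (fun p => ?_) (by simp)
    · refine this.trans ?_
      rw [failureBound, if_pos hw]
    · rw [failureBound, if_pos (h.won ho hw)]
      have := h.failures_le ho (p := p)
      rw [if_neg (by simp [hw]), add_zero] at this
      simpa using this
  · rw [failureBound, if_neg hw]
    refine average_le (b := fun p => if ¬ Held c j p then 1 + 2⁻¹ else 0) (fun p => ?_) ?_
    · have := h.failures_le ho (p := p)
      rw [failureBound]
      refine (add_le_add_left this _).trans ?_
      rw [add_assoc]
      gcongr
      by_cases hh : Held c j p
      · rw [if_neg (by simp [hh]),
          if_pos ⟨j, p, by rw [h.coins, Function.update_self], h.held.2 hh⟩]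
        simp
      · rw [if_pos ⟨hw, hh⟩, if_pos hh]
        gcongr
        split_ifs
        · exact zero_le
        · exact le_rfl
    · rw [← Finset.sum_filter, Finset.sum_const, nsmul_eq_mul]
      have h1 : ((Finset.univ.filter fun p => ¬ Held c j p).card : ℝ≥0∞) ≤ (t : ℝ≥0∞) := by
        exact_mod_cast h.card_not_held hc
      have h2 : (1 + 2⁻¹ : ℝ≥0∞) = 3 * 2⁻¹ := by
        rw [show (3 : ℝ≥0∞) = 2 + 1 by norm_num, add_mul, one_mul,
          ENNReal.mul_inv_cancel (by norm_num) (by norm_num)]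
      calc _ ≤ (t : ℝ≥0∞) * (1 + 2⁻¹) := by gcongr
        _ = ((3 * t : ℕ) : ℝ≥0∞) * 2⁻¹ := by rw [h2]; push_cast; ring
        _ ≤ _ := by gcongr; omega

-- With `r = f / (2t + 1)`, a corrupted leader costs at most 1 and an unconfirmed one at most `r`.
-- The total `f + t * r` equals `(3t + 1) * r`, so `r` is the fixed point of the recursion.
open Classical in
lemma Toss.average_lossBound {f : ℕ} {D : Party t → Config t V} (h : Toss c j D) (hc : Inv c)
    (ho : Ordered c) (hf : f ≤ t) (hcf : c.corrupted.card ≤ f) :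
    ∑ p, lossBound f (D p) * PMF.uniformOfFintype (Party t) p ≤ lossBound f c := by
  set r : ℝ≥0∞ := (f : ℝ≥0∞) / ((2 * t + 1 : ℕ) : ℝ≥0∞) with hr
  have hr1 : r ≤ 1 := ennreal_div_le_one hf
  by_cases hl : Lost c
  · rw [lossBound, if_pos hl]
    refine (average_le (b := 0) (a := 1) (B := 0) (fun p => ?_) (by simp)).trans (by simp)
    rw [lossBound]
    split_ifs
    · exact le_self_add
    · exact zero_le
    · exact hr1.trans le_self_add
  rw [lossBound, if_neg hl]
  by_cases hw : Won c
  · rw [if_pos hw]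
    refine (average_le (b := 0) (a := 0) (B := 0) (fun p => ?_) (by simp)).trans (by simp)
    rw [lossBound, if_neg, if_pos (h.won ho hw)]
    · exact zero_le
    · intro hl'
      exact (h.lost hc ho hl').elim hl fun h' => h'.2 hw
  · rw [if_neg hw, ← hr, ← zero_add r]
    refine average_le
      (b := fun p => (if p ∈ c.corrupted then 1 else 0) + if ¬ Held c j p then r else 0)
      (fun p => ?_) ?_
    · rw [lossBound, zero_add]
      by_cases hl' : Lost (D p)
      · rw [if_pos hl', if_pos ((h.lost hc ho hl').resolve_left hl).1]
        exact le_self_add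
      · rw [if_neg hl']
        by_cases hh : Held c j p
        · rw [
          if_pos ⟨j, p, by rw [h.coins, Function.update_self], h.held.2 hh⟩]
          exact zero_le
        · refine le_trans ?_ le_add_self
          rw [if_pos hh]
          split_ifs
          · exact zero_le
          · exact le_rfl
    · rw [Finset.sum_add_distrib, ← Finset.sum_filter, ← Finset.sum_filter, Finset.sum_const,
        Finset.sum_const, nsmul_eq_mul, nsmul_eq_mul, mul_one]
      have h1 : ((Finset.univ.filter fun p => ¬ Held c j p).card : ℝ≥0∞) ≤ (t : ℝ≥0∞) := by
        exact_mod_cast h.card_not_held hc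
      have h2 : ((Finset.univ.filter fun p => p ∈ c.corrupted).card : ℝ≥0∞) ≤ (f : ℝ≥0∞) := by
        rw [Finset.filter_mem_eq_inter, Finset.univ_inter]
        exact_mod_cast hcf
      have h3 : (f : ℝ≥0∞) = ((2 * t + 1 : ℕ) : ℝ≥0∞) * r := by
        rw [hr, ENNReal.mul_div_cancel]
        · exact_mod_cast (by omega : 2 * t + 1 ≠ 0)
        · exact ENNReal.natCast_ne_top _
      calc _ ≤ (f : ℝ≥0∞) + t * r := by gcongr
        _ = ((3 * t + 1 : ℕ) : ℝ≥0∞) * r := by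
          rw [h3]
          push_cast
          ring

section Expectation

variable (E : Ensemble (protocol t V))

/-- By `Inv.next_cases` a move is either deterministic without touching the coins or a uniform
election, so the two hypotheses cover all moves of the adversary. -/
lemma supermartingale {g : Config t V → ℝ≥0∞}
    (h1 : ∀ c c', Inv c' → Ext c c' → c'.coins = c.coins → g c' ≤ g c)
    (h2 : ∀ c j D, Inv c → Ordered c → c.corrupted.card ≤ E.faults → Toss c j D →
      ∑ p, g (D p) * PMF.uniformOfFintype (Party t) p ≤ g c) (s : ℕ) :
    ∫⁻ ω, g (ω s).cur ∂E.law ≤ g (Config.init E.input) := by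
  refine E.lintegral_le_of_supermartingale (g := fun x => g x.cur) (fun ω hω s => ?_) s
  have hc := inv_path hω s
  rcases hc.next_cases (E.strategy (ω s)) with ⟨c', hc', hco⟩ | ⟨j, D, hT, hnext⟩
  · have htr : Trans (ω s).cur c' :=
      trans_of_mem_support (mv := E.strategy (ω s)) hc.coins_lt (by rw [hc']; simp)
    have h : (ω s).cur.next (protocol t V) (E.strategy (ω s)) =
        (PMF.pure ()).map fun _ => c' := by
      rw [hc', PMF.pure_map]
    rw [lintegral_children _ h]
    simpa using h1 _ _ (hc.trans htr) htr.ext hco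
  · rw [lintegral_children _ hnext]
    exact h2 _ _ _ hc (ordered_path hω s) (card_le_faults hω s) hT

lemma lintegral_failures_le (s : ℕ) : ∫⁻ ω, failures (ω s).cur ∂E.law ≤ 2⁻¹ := by
  refine (lintegral_mono fun ω => ?_).trans ((supermartingale E (g := failureBound)
    (fun c c' _ h hco => failureBound_anti h hco)
    (fun c j D hc ho _ hT => hT.average_failureBound hc ho) s).trans ?_)
  · exact le_self_add
  · have h0 : failures (Config.init E.input) = 0 := by
      refine ENNReal.tsum_eq_zero.2 fun k => if_neg fun h => ?_
      obtain ⟨p, hp, -⟩ := h 0 (Nat.zero_le k)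
      cases hp
    rw [failureBound, h0, zero_add]
    split_ifs
    · exact zero_le
    · exact le_rfl

lemma law_lost_le (s : ℕ) :
    E.law {ω | Lost (ω s).cur} ≤ (E.faults : ℝ≥0∞) / ((2 * t + 1 : ℕ) : ℝ≥0∞) := by
  have hm : MeasurableSet {ω : ℕ → Node t V | Lost (ω s).cur} :=
    (measurable_pi_apply (X := fun _ => Node t V) s)
      (MeasurableSpace.measurableSet_top (s := {x : Node t V | Lost x.cur}))
  rw [← lintegral_indicator_one hm]
  refine (lintegral_mono (g := fun ω => lossBound E.faults (ω s).cur) fun ω => ?_).trans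
    ((supermartingale E (g := lossBound E.faults)
    (fun c c' hc' h hco => lossBound_anti (faults_le E) h hc' hco)
    (fun c j D hc ho hcf hT => hT.average_lossBound hc ho (faults_le E) hcf) s).trans ?_)
  · by_cases hl : Lost (ω s).cur
    · change _ ≤ lossBound E.faults (ω s).cur
      rw [lossBound, if_pos hl]
      exact Set.indicator_le_self' (fun _ _ => zero_le) ω
    · rw [Set.indicator_of_notMem (by exact hl)]
      exact zero_le
  · have h0 : ¬ Lost (Config.init E.input) := by
      rintro ⟨j, p, hp, -⟩
      cases hp
    unfold lossBound
    rw [if_neg h0]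
    split_ifs
    · exact zero_le
    · exact le_rfl

end Expectation

end AsyncBA
end

/-! ### Message and word complexity. -/

noncomputable section

namespace AsyncBA

variable {t : ℕ} {V : Type u}

/-! ### Counting messages -/

variable {c c' : Config t V} {i p : Party t} {x : V} {ev : Log t V} {s : Slot t} {j m : ℕ}

lemma Entered.lead (h : Entered ev j) {k : ℕ} (hk : k < j) : ∃ p, Lead ev k p := by
  obtain ⟨-, -, p, hp, -⟩ := h.of_le (Nat.succ_le_of_lt hk)
  exact ⟨p, hp⟩

/-- Each earlier view left its own coin event in the log. Hence the finite range of slots searched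
by `batch` contains all views entered. -/
lemma Entered.le_length (h : Entered ev j) : j ≤ ev.length := by
  classical
  choose! p hp using fun k (hk : k < j) => h.lead hk
  have := Finset.card_le_card_of_injOn (s := Finset.range j) (t := ev.toFinset)
    (fun k => LocalEvent.tossed k (some (p k).val))
    (fun k hk => by
      have := hp k (by simpa using hk)
      simpa [Lead] using this)
    (fun a _ b _ hab => (LocalEvent.tossed.inj hab).1)
  rw [Finset.card_range] at this
  exact this.trans (List.toFinset_card_le _)

/-- The slots that can be used belong to views that have been entered. -/
lemma Ready.mem_slots (h : Ready ev s) (hm : ∀ j, Entered ev j → j < m) : s ∈ slots t m := by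
  cases s
  case inp | echo => simp [slots]
  all_goals
    have := hm _ h
    simp [slots, viewSlots, this]

/-- A bound on the number of messages sent for a slot. -/
def Slot.size (s : Slot t) : ℕ := s.dests.length * 2

lemma length_output_le : (output i x ev s).length ≤ s.size := by
  unfold output
  split_ifs with h
  · rw [List.length_flatMap, Slot.size]
    refine (List.sum_le_card_nsmul _ 2 fun k hk => ?_).trans (by simp)
    obtain ⟨d, -, rfl⟩ := List.mem_map.1 hk
    have := h.choose_spec.2.2.length_le
    simpa using this
  · exact Nat.zero_le _

/-- The number of messages sent according to a log. -/
def sentCount : Log t V → ℕ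
  | [] => 0
  | .sent l :: ev => l.length + sentCount ev
  | _ :: ev => sentCount ev

lemma fired_of_mem_output {y : Party t × Msg t V} (hs : s ∈ slots t (ev.length + 1))
    (hy : y ∈ output i x ev s) : Fired (.sent (batch i x ev) :: ev) i s := by
  have hr : ∃ r : Option V × List (Msg t V), Enabled i x ev s r.1 r.2 := by
    by_contra hr
    rw [output, dif_neg hr] at hy
    simp at hy
  have hd : s.dests ≠ [] := by
    intro hd
    rw [output, dif_pos hr, hd] at hy
    simp at hy
  obtain ⟨d, hd⟩ := List.exists_mem_of_ne_nil _ hd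
  refine ⟨hr.choose.1, d, _, List.mem_cons_self,
    List.mem_flatMap.2 ⟨s, Finset.mem_toList.2 hs, ?_⟩⟩
  rw [output, dif_pos hr]
  exact List.mem_flatMap.2 ⟨d, hd, by simp⟩

open Classical in
lemma WF.sentCount_le (h : WF i x ev) (hm : ∀ j, Entered ev j → j < m) :
    sentCount ev ≤ ∑ s ∈ slots t m, if Fired ev i s then s.size else 0 := by
  induction ev with
  | nil => exact Nat.zero_le _
  | cons e ev ih =>
    have hsuf : ev <:+ e :: ev := List.suffix_cons _ _
    have ih := ih (h.of_suffix hsuf) fun j hj => hm j (hj.mono hsuf)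
    have hmono : (∑ s ∈ slots t m, if Fired ev i s then s.size else 0) ≤
        ∑ s ∈ slots t m, if Fired (e :: ev) i s then s.size else 0 := by
      refine Finset.sum_le_sum fun s _ => ?_
      split_ifs with h1 h2
      · exact le_rfl
      · exact absurd (h1.mono hsuf) h2
      · exact Nat.zero_le _
      · exact le_rfl
    cases e with
    | received | decided | tossed => exact ih.trans hmono
    | sent l =>
      rcases act_eq_send h.1 with rfl | ⟨-, rfl⟩
      · simpa [sentCount] using ih.trans hmono
      -- The batch is charged to the slots used for the first time in it, so no slot is charged
      -- twice.
      have hb : (batch i x ev).length ≤ ∑ s ∈ slots t m,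
          if ¬ Fired ev i s ∧ Fired (.sent (batch i x ev) :: ev) i s then s.size else 0 := by
        have h1 : (batch i x ev).length =
            ∑ s ∈ slots t (ev.length + 1), (output i x ev s).length := by
          rw [batch, List.length_flatMap, Finset.sum_map_toList]
        have h2 : ∀ s ∈ slots t (ev.length + 1), (output i x ev s).length ≤
            if s ∈ slots t m then
              if ¬ Fired ev i s ∧ Fired (.sent (batch i x ev) :: ev) i s then s.size else 0
            else 0 := by
          intro s hs
          rcases hout : output i x ev s with _ | ⟨y, l⟩
          · exact Nat.zero_le _
          have hy : y ∈ output i x ev s := by rw [hout]; exact List.mem_cons_self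
          obtain ⟨o, es, he, -⟩ := mem_output hy
          rw [← hout, if_pos (he.2.1.mem_slots fun j hj => hm j (hj.mono hsuf)),
            if_pos ⟨he.1, fired_of_mem_output hs hy⟩]
          exact length_output_le
        rw [h1]
        refine (Finset.sum_le_sum h2).trans ?_
        rw [Finset.sum_ite_mem]
        exact Finset.sum_le_sum_of_subset Finset.inter_subset_right
      calc _ = (batch i x ev).length + sentCount ev := rfl
        _ ≤ _ := add_le_add hb ih
        _ ≤ _ := by
          rw [← Finset.sum_add_distrib]
          refine Finset.sum_le_sum fun s _ => ?_
          by_cases h1 : Fired ev i s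
          · simp [h1, h1.mono hsuf]
          · simp [h1]

lemma sum_union_le {α : Type*} [DecidableEq α] (f : α → ℕ) (a b : Finset α) :
    ∑ y ∈ a ∪ b, f y ≤ ∑ y ∈ a, f y + ∑ y ∈ b, f y := by
  rw [← Finset.sum_union_inter]
  exact Nat.le_add_right _ _

lemma sum_biUnion_le {α β : Type*} [DecidableEq α] [DecidableEq β] (f : α → ℕ) (a : Finset β)
    (g : β → Finset α) {K : ℕ} (h : ∀ b ∈ a, ∑ y ∈ g b, f y ≤ K) :
    ∑ y ∈ a.biUnion g, f y ≤ a.card * K := by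
  induction a using Finset.induction_on with
  | empty => simp
  | insert b a hb ih =>
    rw [Finset.biUnion_insert, Finset.card_insert_of_notMem hb, add_mul, one_mul, add_comm]
    exact (sum_union_le _ _ _).trans (add_le_add (h _ (Finset.mem_insert_self _ _))
      (ih fun b' hb' => h b' (Finset.mem_insert_of_mem hb')))

/-- Eight slots addressed to everybody and `2n` slots with one addressee, each with at most two
messages per addressee: `16n + 4n`. -/
lemma sum_size_viewSlots (j : ℕ) : ∑ s ∈ viewSlots t j, s.size ≤ 20 * (3 * t + 1) := by
  have h1 : ∑ s ∈ ({.prop j, .cert j, .done j, .skip j, .aband j, .share j, .absent j, .vote j} :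
      Finset (Slot t)), s.size ≤ 16 * (3 * t + 1) := by
    simp [Slot.size, Slot.dests]
    omega
  have h2 : ∑ s ∈ Finset.univ.biUnion fun p : Party t => ({.ack j p, .hold j p} : Finset (Slot t)),
      s.size ≤ (3 * t + 1) * 4 := by
    refine (sum_biUnion_le (K := 4) _ _ _ fun p _ => ?_).trans (by simp)
    simp [Slot.size, Slot.dests]
  refine (sum_union_le _ _ _).trans ((add_le_add h1 h2).trans (by omega))

lemma sum_size_slots (m : ℕ) : ∑ s ∈ slots t m, s.size ≤ (4 + 20 * m) * (3 * t + 1) := by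
  have h1 : ∑ s ∈ ({.inp, .echo} : Finset (Slot t)), s.size ≤ 4 * (3 * t + 1) := by
    simp [Slot.size, Slot.dests]
    omega
  have h2 := sum_biUnion_le (fun s : Slot t => s.size) (Finset.range m) (viewSlots t)
    fun j _ => sum_size_viewSlots j
  rw [Finset.card_range] at h2
  refine (sum_union_le _ _ _).trans ((add_le_add h1 h2).trans (le_of_eq (by ring)))

lemma WF.sentCount_le' (h : WF i x ev) (hm : ∀ j, Entered ev j → j < m) :
    sentCount ev ≤ (4 + 20 * m) * (3 * t + 1) := by
  classical
  refine (h.sentCount_le hm).trans (le_trans (Finset.sum_le_sum fun s _ => ?_) (sum_size_slots m))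
  split_ifs
  · exact le_rfl
  · exact Nat.zero_le _

lemma sentCount_record_of_not_sent {e : LocalEvent t V} (he : ∀ l, e ≠ .sent l) (p : Party t) :
    sentCount ((c.record i e).events p) = sentCount (c.events p) := by
  rcases eq_or_ne p i with rfl | h
  · rw [record_events_self]
    cases e <;> first | rfl | exact absurd rfl (he _)
  · rw [record_events_of_ne _ _ h]

lemma Trans.honestMessages_le (h : Trans c c')
    (hc : (honestMessages c).length ≤ ∑ i, sentCount (c.events i)) :
    (honestMessages c').length ≤ ∑ i, sentCount (c'.events i) := by
  cases h with
  | send i l hi ha =>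
    have h1 : ∀ p, sentCount ((c.record i (.sent l)).events p) =
        sentCount (c.events p) + if p = i then l.length else 0 := by
      intro p
      rcases eq_or_ne p i with rfl | h
      · rw [record_events_self, if_pos rfl, add_comm]
        rfl
      · rw [record_events_of_ne _ _ h, if_neg h, add_zero]
    have h2 : (honestMessages ({ c with net := c.net ++ packets i l }.record i (.sent l))).length =
        (honestMessages c).length + l.length := by
      simp [honestMessages, packets, Config.record, List.filter_map, Function.comp_def]
    rw [h2]
    refine (add_le_add_left hc _).trans (le_of_eq ?_)
    refine Eq.trans ?_ (Finset.sum_congr rfl fun p _ => (h1 p).symm)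
    rw [Finset.sum_add_distrib]
    simp
  | inject i d m hi hd => simpa [honestMessages] using hc
  | stay | corrupt | peek => exact hc
  | decide | toss | deliver =>
    refine le_trans hc (le_of_eq (Finset.sum_congr rfl fun p _ => ?_))
    exact (sentCount_record_of_not_sent (by simp) p).symm

open Classical in
/-- The number of views that some party has entered. -/
def viewCount (c : Config t V) : ℕ := sInf {m | ∀ i j, Entered (c.events i) j → j < m}

lemma lt_viewCount (h : Entered (c.events i) j) : j < viewCount c := by
  have hne : {m | ∀ i j, Entered (c.events i) j → j < m}.Nonempty := by
    refine ⟨∑ i, (c.events i).length + 1, fun i j hj => ?_⟩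
    have := Finset.single_le_sum (f := fun i => (c.events i).length) (fun _ _ => Nat.zero_le _)
      (Finset.mem_univ i)
    have := hj.le_length
    omega
  exact Nat.sInf_mem hne i j h

lemma exists_entered (h : j + 1 ≤ viewCount c) : ∃ i, Entered (c.events i) j := by
  by_contra! hn
  have : viewCount c ≤ j := Nat.sInf_le fun i k hk => by
    by_contra hlt
    exact hn i (hk.of_le (not_lt.1 hlt))
  omega

lemma viewCount_mono (h : Ext c c') : viewCount c ≤ viewCount c' :=
  Nat.sInf_le fun _ _ hj => lt_viewCount (hj.mono (h.events _))

/-- All views before the latest one entered have failed; the extra 1 is that view itself. -/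
lemma Inv.viewCount_le (hc : Inv c) : (viewCount c : ℝ≥0∞) ≤ failures c + 1 := by
  rcases hv : viewCount c with _ | k
  · simp
  obtain ⟨i, hi⟩ := exists_entered hv.ge
  push_cast
  gcongr
  calc (k : ℝ≥0∞) = ∑ _a ∈ Finset.range k, 1 := by simp
    _ ≤ ∑ a ∈ Finset.range k, _ := Finset.sum_le_sum fun a ha => by
      rw [if_pos]
      intro b hb
      exact hc.failed_of_entered hi (by rw [Finset.mem_range] at ha; omega)
    _ ≤ failures c := ENNReal.sum_le_tsum _

section Path

variable {E : Ensemble (protocol t V)} {ω : ℕ → Node t V}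

lemma length_honestMessages_le (hω : E.IsPath ω) (s : ℕ) :
    (honestMessages (ω s).cur).length ≤ (3 * t + 1) ^ 2 * (4 + 20 * viewCount (ω s).cur) := by
  have h : (honestMessages (ω s).cur).length ≤ ∑ i, sentCount ((ω s).cur.events i) := by
    induction s with
    | zero =>
      rw [hω.1]
      exact Nat.zero_le _
    | succ s ih => exact (trans_path hω s).honestMessages_le ih
  refine h.trans ((Finset.sum_le_card_nsmul _ _ _ fun i _ =>
    ((inv_path hω s).wf i).sentCount_le' fun j hj => lt_viewCount hj).trans (le_of_eq ?_))
  rw [Finset.card_univ, Fintype.card_fin, smul_eq_mul]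
  ring

lemma Inv.words_le (hc : Inv c) {m : Msg t V} (hm : m ∈ honestMessages c) : m.words ≤ 5 := by
  obtain ⟨p, hp, rfl⟩ := List.mem_map.1 hm
  rw [List.mem_filter] at hp
  obtain ⟨pre, s, o, es, -, -, he, hm, -⟩ := (hc.wf p.src).sent (hc.sent p hp.1 hp.2)
  rcases hm with hm | hm
  · rw [hm, Msg.words, words_stmt]
  · rcases he.2.2.extra hm with ⟨-, h, -⟩ | ⟨j, -, h⟩
    · exact h
    · simp [h, Msg.words]

end Path

section Expectation

variable (E : Ensemble (protocol t V))

/-- Monotone convergence: the view count grows along a path and its mean is at most `1 + 1/2` at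
each time, rounded up to 2. -/
lemma lintegral_viewCount_le :
    ∫⁻ ω, ⨆ s, (viewCount (ω s).cur : ℝ≥0∞) ∂E.law ≤ 2 := by
  rw [lintegral_iSup_ae (fun s => Ensemble.measurable_eval (fun x => (viewCount x.cur : ℝ≥0∞)) s)]
  · refine iSup_le fun s => ?_
    calc _ ≤ ∫⁻ ω, (failures (ω s).cur + 1) ∂E.law := by
          refine lintegral_mono_ae ?_
          filter_upwards [E.ae_isPath] with ω hω using (inv_path hω s).viewCount_le
      _ = ∫⁻ ω, failures (ω s).cur ∂E.law + 1 := by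
          rw [lintegral_add_left (Ensemble.measurable_eval (fun x => failures x.cur) s)]
          simp
      _ ≤ 1 + 1 := by
          gcongr
          refine (lintegral_failures_le E s).trans ?_
          rw [ENNReal.inv_le_one]
          exact one_le_two
      _ = 2 := one_add_one_eq_two
  · intro s
    filter_upwards [E.ae_isPath] with ω hω
    exact_mod_cast viewCount_mono (ext_path hω (Nat.le_succ s))

lemma lintegral_add_mul_viewCount_le (a b : ℝ≥0∞) :
    ∫⁻ ω, (a + b * ⨆ s, (viewCount (ω s).cur : ℝ≥0∞)) ∂E.law ≤ a + b * 2 := by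
  have hm : Measurable fun ω : ℕ → Node t V => ⨆ s, (viewCount (ω s).cur : ℝ≥0∞) :=
    .iSup fun s => Ensemble.measurable_eval (fun x => (viewCount x.cur : ℝ≥0∞)) s
  rw [lintegral_add_left measurable_const, lintegral_const_mul _ hm]
  gcongr
  · simp
  · exact lintegral_viewCount_le E

lemma lintegral_messagesSent_le :
    ∫⁻ ω, messagesSent ω ∂E.law ≤ 44 * ((3 * t + 1 : ℕ) : ℝ≥0∞) ^ 2 := by
  set N : ℝ≥0∞ := ((3 * t + 1 : ℕ) : ℝ≥0∞) ^ 2 with hN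
  have h : ∫⁻ ω, (4 * N + 20 * N * ⨆ s, (viewCount (ω s).cur : ℝ≥0∞)) ∂E.law ≤ 44 * N :=
    (lintegral_add_mul_viewCount_le E _ _).trans (le_of_eq (by ring))
  refine (lintegral_mono_ae ?_).trans h
  filter_upwards [E.ae_isPath] with ω hω
  refine iSup_le fun s => ?_
  calc ((honestMessages (ω s).cur).length : ℝ≥0∞)
      ≤ (((3 * t + 1) ^ 2 * (4 + 20 * viewCount (ω s).cur) : ℕ) : ℝ≥0∞) := by
        exact_mod_cast length_honestMessages_le hω s
    _ = 4 * N + 20 * N * (viewCount (ω s).cur : ℝ≥0∞) := by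
        rw [hN]
        push_cast
        ring
    _ ≤ _ := by
        gcongr
        exact le_iSup (fun s => (viewCount (ω s).cur : ℝ≥0∞)) s

lemma lintegral_wordsSent_le :
    ∫⁻ ω, wordsSent ω ∂E.law ≤ 220 * ((3 * t + 1 : ℕ) : ℝ≥0∞) ^ 2 := by
  calc ∫⁻ ω, wordsSent ω ∂E.law ≤ ∫⁻ ω, 5 * messagesSent ω ∂E.law := by
        refine lintegral_mono_ae ?_
        filter_upwards [E.ae_isPath] with ω hω
        refine iSup_le fun s => ?_
        refine le_trans ?_ (mul_le_mul_right (le_iSup (fun s =>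
          ((honestMessages (ω s).cur).length : ℝ≥0∞)) s) 5)
        have := List.sum_le_card_nsmul ((honestMessages (ω s).cur).map Msg.words) 5 (by
          intro k hk
          obtain ⟨m, hm, rfl⟩ := List.mem_map.1 hk
          exact (inv_path hω s).words_le hm)
        rw [List.length_map, smul_eq_mul, mul_comm] at this
        exact_mod_cast this
    _ = 5 * ∫⁻ ω, messagesSent ω ∂E.law := lintegral_const_mul _ (.iSup fun s =>
        Ensemble.measurable_eval (fun x => ((honestMessages x.cur).length : ℝ≥0∞)) s)
    _ ≤ 5 * (44 * ((3 * t + 1 : ℕ) : ℝ≥0∞) ^ 2) := by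
        gcongr
        exact lintegral_messagesSent_le E
    _ = _ := by ring

end Expectation

end AsyncBA
end

/-! ### Rounds, and the timing of honest local steps and deliveries. -/

noncomputable section

namespace AsyncBA

variable {t : ℕ} {V : Type u}

/-! ### Rounds -/

section Rounds

variable {σ : Strategy t V} {ω : ℕ → Node t V}

/-- The number of rounds completed after `s` events. -/
def rounds (σ : Strategy t V) (ω : ℕ → Node t V) (s : ℕ) : ℕ := (roundState σ ω s).2

lemma roundState_succ (s : ℕ) :
    (RoundOver σ ω (roundState σ ω s).1 (s + 1) ∧
      roundState σ ω (s + 1) = (s + 1, rounds σ ω s + 1)) ∨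
    (¬ RoundOver σ ω (roundState σ ω s).1 (s + 1) ∧
      roundState σ ω (s + 1) = roundState σ ω s) := by
  by_cases h : RoundOver σ ω (roundState σ ω s).1 (s + 1)
  · exact .inl ⟨h, by rw [roundState, if_pos h]; rfl⟩
  · exact .inr ⟨h, by rw [roundState, if_neg h]⟩

lemma roundState_fst (s : ℕ) :
    (roundState σ ω s).1 ≤ s ∧ roundState σ ω (roundState σ ω s).1 = roundState σ ω s := by
  induction s with
  | zero => exact ⟨le_rfl, rfl⟩
  | succ s ih =>
    rcases roundState_succ (σ := σ) (ω := ω) s with ⟨-, h⟩ | ⟨-, h⟩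
    · rw [h]
      exact ⟨le_rfl, h⟩
    · rw [h]
      exact ⟨ih.1.trans (Nat.le_succ s), ih.2⟩

lemma rounds_mono : Monotone (rounds σ ω) := by
  refine monotone_nat_of_le_succ fun s => ?_
  rcases roundState_succ (σ := σ) (ω := ω) s with ⟨-, h⟩ | ⟨-, h⟩
  · simp only [rounds, h]
    omega
  · simp only [rounds, h]
    exact le_rfl

/-- A completed round. -/
lemma exists_roundOver {r s : ℕ} (h : r + 1 ≤ rounds σ ω s) :
    ∃ a b, a < b ∧ b ≤ s ∧ r ≤ rounds σ ω a ∧ RoundOver σ ω a b := by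
  induction s with
  | zero => simp [rounds, roundState] at h
  | succ s ih =>
    by_cases hs : r + 1 ≤ rounds σ ω s
    · obtain ⟨a, b, h1, h2, h3⟩ := ih hs
      exact ⟨a, b, h1, h2.trans (Nat.le_succ s), h3⟩
    · rcases roundState_succ (σ := σ) (ω := ω) s with ⟨hR, h'⟩ | ⟨-, h'⟩
      · have hfst := roundState_fst (σ := σ) (ω := ω) s
        refine ⟨(roundState σ ω s).1, s + 1, by omega, le_rfl, ?_, hR⟩
        have h2 : rounds σ ω (roundState σ ω s).1 = rounds σ ω s := by
          simp only [rounds, hfst.2]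
        rw [h2]
        have h3 : rounds σ ω (s + 1) = rounds σ ω s + 1 := by
          simp only [rounds, h']
        omega
      · exact absurd (by simpa only [rounds, h'] using h) hs

lemma exists_step_of_rounds {r s : ℕ} {i : Party t} (hi : HonestIn ω i)
    (h : r + 1 ≤ rounds σ ω s) : ∃ s' < s, r ≤ rounds σ ω s' ∧ σ (ω s') = .step i := by
  obtain ⟨a, b, h1, h2, h3, h4⟩ := exists_roundOver h
  obtain ⟨s', h5, h6, h7⟩ := h4.1 i (hi b)
  exact ⟨s', by omega, h3.trans (rounds_mono h5), h7⟩

end Rounds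

section Path

variable {E : Ensemble (protocol t V)} {ω : ℕ → Node t V} {i d : Party t} {r s : ℕ}

/-- The log of party `i` after `s` events. -/
abbrev logAt (ω : ℕ → Node t V) (s : ℕ) (i : Party t) : Log t V := (ω s).cur.events i

lemma logAt_mono (hω : E.IsPath ω) {s s' : ℕ} (h : s ≤ s') (i : Party t) :
    logAt ω s i <:+ logAt ω s' i := (ext_path hω h).events i

/-- The number of rounds is unbounded. -/
lemma exists_le_rounds (hω : E.IsPath ω) (r : ℕ) : ∃ s, r ≤ rounds E.strategy ω s := by
  obtain ⟨hstep, hdel⟩ := E.fair ω hω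
  induction r with
  | zero => exact ⟨0, Nat.zero_le _⟩
  | succ r ih =>
    obtain ⟨s0, hs0⟩ := ih
    by_contra! hno
    -- If the count never grows again, the round current at `s0` never ends. By fairness each of its
    -- finitely many demands is eventually met or made void by a corruption, hence all are at some
    -- common time.
    have hconst : ∀ k, roundState E.strategy ω (s0 + k) = roundState E.strategy ω s0 ∧
        ¬ RoundOver E.strategy ω (roundState E.strategy ω s0).1 (s0 + k + 1) := by
      intro k
      have hnot : ∀ k, roundState E.strategy ω (s0 + k) = roundState E.strategy ω s0 →
          ¬ RoundOver E.strategy ω (roundState E.strategy ω s0).1 (s0 + k + 1) := by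
        intro k hk hR
        rcases roundState_succ (σ := E.strategy) (ω := ω) (s0 + k) with ⟨-, h⟩ | ⟨hn, -⟩
        · have := hno (s0 + k + 1)
          simp only [rounds, h, hk] at this hs0
          omega
        · rw [hk] at hn
          exact hn hR
      induction k with
      | zero => exact ⟨rfl, hnot 0 rfl⟩
      | succ k ihk =>
        have h : roundState E.strategy ω (s0 + (k + 1)) = roundState E.strategy ω s0 := by
          rcases roundState_succ (σ := E.strategy) (ω := ω) (s0 + k) with ⟨hR, -⟩ | ⟨-, h⟩
          · rw [ihk.1] at hR
            exact absurd hR ihk.2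
          · rw [← add_assoc, h, ihk.1]
        exact ⟨h, hnot _ h⟩
    set a := (roundState E.strategy ω s0).1 with ha
    -- times by which a party has been corrupted or has taken a step
    have h1 : ∀ i, ∃ b, ∀ b' ≥ b, i ∉ (ω b').cur.corrupted →
        ∃ s, a ≤ s ∧ s < b' ∧ E.strategy (ω s) = .step i := by
      intro i
      by_cases hi : HonestIn ω i
      · obtain ⟨s', h, h'⟩ := hstep i hi a
        exact ⟨s' + 1, fun b' hb' _ => ⟨s', h, by omega, h'⟩⟩
      · simp only [HonestIn, not_forall, not_not] at hi
        obtain ⟨b, hb⟩ := hi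
        exact ⟨b, fun b' hb' hn => absurd ((ext_path hω hb').corrupted hb) hn⟩
    have h2 : ∀ k : Fin (ω a).cur.net.length, ∃ b, ∀ b' ≥ b, ∀ p,
        (ω a).cur.net[(k : ℕ)]? = some p →
        p.dst ∉ (ω b').cur.corrupted → (k : ℕ) ∈ (ω b').cur.delivered := by
      intro k
      have hk : (ω a).cur.net[(k : ℕ)]? = some (ω a).cur.net[k] := by simp
      by_cases hi : HonestIn ω ((ω a).cur.net[k]).dst
      · obtain ⟨b, hb⟩ := hdel a k _ hk hi
        exact ⟨b, fun b' hb' _ _ _ => (ext_path hω hb').delivered hb⟩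
      · simp only [HonestIn, not_forall, not_not] at hi
        obtain ⟨b, hb⟩ := hi
        refine ⟨b, fun b' hb' p hp hn => ?_⟩
        rw [hk] at hp
        cases hp
        exact absurd ((ext_path hω hb').corrupted hb) hn
    choose f hf using h1
    choose g hg using h2
    refine (hconst (Finset.univ.sup f + Finset.univ.sup g)).2 ⟨fun i hi => ?_, ?_⟩
    · refine hf i _ ?_ hi
      have := Finset.le_sup (f := f) (Finset.mem_univ i)
      omega
    · intro k p hp _ hdst
      have hk := (List.getElem?_eq_some_iff.1 hp).1
      refine hg ⟨k, hk⟩ _ ?_ p hp hdst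
      have := Finset.le_sup (f := g) (Finset.mem_univ ⟨k, hk⟩)
      omega

open Classical in
/-- The parties that are never corrupted. -/
def honestSet (ω : ℕ → Node t V) : Finset (Party t) := Finset.univ.filter (HonestIn ω)

lemma mem_honestSet : i ∈ honestSet ω ↔ HonestIn ω i := by
  simp [honestSet]

/-- At one sufficiently late time all parties ever corrupted are corrupted at once, so there are at
most `t` of them. -/
lemma card_honestSet (hω : E.IsPath ω) : 2 * t + 1 ≤ (honestSet ω).card := by
  classical
  have h : ∀ i, ∃ b, ¬ HonestIn ω i → i ∈ (ω b).cur.corrupted := by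
    intro i
    by_cases hi : HonestIn ω i
    · exact ⟨0, fun h => absurd hi h⟩
    · simp only [HonestIn, not_forall, not_not] at hi
      obtain ⟨b, hb⟩ := hi
      exact ⟨b, fun _ => hb⟩
  choose f hf using h
  have hsub : (honestSet ω)ᶜ ⊆ (ω (Finset.univ.sup f)).cur.corrupted := by
    intro i hi
    rw [Finset.mem_compl, mem_honestSet] at hi
    exact (ext_path hω (Finset.le_sup (Finset.mem_univ i))).corrupted (hf i hi)
  have h1 := (Finset.card_le_card hsub).trans (inv_path hω _).card
  rw [Finset.card_compl, Fintype.card_fin] at h1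
  omega

/-! ### Local steps of honest parties -/

lemma steps_cons_received (k : Party t) (m : Msg t V) (ev : Log t V) :
    Log.steps (.received k m :: ev) = ev.steps := by
  simp [Log.steps]

/-- The local step of an honest party. -/
lemma logAt_step (hω : E.IsPath ω) (hi : HonestIn ω i) (hs : E.strategy (ω s) = .step i) :
    (∃ l, act i (E.input i) (logAt ω s i) = .send l ∧
      logAt ω (s + 1) i = .sent l :: logAt ω s i) ∨
    (∃ v, act i (E.input i) (logAt ω s i) = .decide v ∧
      logAt ω (s + 1) i = .decided v :: logAt ω s i) ∨
    (∃ k r, act i (E.input i) (logAt ω s i) = .toss k ∧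
      logAt ω (s + 1) i = .tossed k (some r) :: logAt ω s i) := by
  have h := mem_support_next hω s
  rw [hs] at h
  simp only [Config.next, if_neg (hi s)] at h
  rw [← input_path hω s]
  cases ha : act i ((ω s).cur.input i) ((ω s).cur.events i) with
  | send l =>
    rw [localStep_send ha, PMF.support_pure, Set.mem_singleton_iff] at h
    exact .inl ⟨l, rfl, by rw [logAt, h, record_events_self]⟩
  | decide v =>
    rw [localStep_decide ha, PMF.support_pure, Set.mem_singleton_iff] at h
    exact .inr (.inl ⟨v, rfl, by rw [logAt, h, record_events_self]⟩)
  | toss k =>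
    rw [localStep_toss ha, PMF.mem_support_map_iff] at h
    obtain ⟨⟨r, c1⟩, h1, h2⟩ := h
    refine .inr (.inr ⟨k, r, rfl, ?_⟩)
    rw [logAt, ← h2, record_events_self]
    unfold Config.flip at h1
    split at h1
    · rw [PMF.support_pure, Set.mem_singleton_iff] at h1
      cases h1
      rfl
    · obtain ⟨r', -, h1⟩ := (PMF.mem_support_map_iff _ _ _).1 h1
      cases h1
      rfl

lemma steps_logAt_step (hω : E.IsPath ω) (hi : HonestIn ω i)
    (hs : E.strategy (ω s) = .step i) :
    (logAt ω (s + 1) i).steps = (logAt ω s i).steps + 1 := by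
  rcases logAt_step hω hi hs with ⟨l, -, h⟩ | ⟨v, -, h⟩ | ⟨k, r, -, h⟩ <;>
    simp [h, Log.steps]

lemma steps_logAt_of_ne (hω : E.IsPath ω) (hs : E.strategy (ω s) ≠ .step i) :
    (logAt ω (s + 1) i).steps = (logAt ω s i).steps := by
  have h := mem_support_next hω s
  have hc := (inv_path hω s).coins_lt
  generalize E.strategy (ω s) = mv at h hs
  have hrec : ∀ (c : Config t V) (q : Party t) (e : LocalEvent t V), q ≠ i →
      (c.record q e).events i = c.events i := fun c q e hq => record_events_of_ne _ _ hq.symm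
  cases mv with
  | step q =>
    have hq : q ≠ i := fun h => hs (h ▸ rfl)
    simp only [Config.next] at h
    split_ifs at h with hcor
    · rw [PMF.support_pure, Set.mem_singleton_iff] at h
      rw [logAt, h]
    cases ha : act q ((ω s).cur.input q) ((ω s).cur.events q) with
    | send l =>
      rw [localStep_send ha, PMF.support_pure, Set.mem_singleton_iff] at h
      rw [logAt, h, hrec _ _ _ hq]
    | decide v =>
      rw [localStep_decide ha, PMF.support_pure, Set.mem_singleton_iff] at h
      rw [logAt, h, hrec _ _ _ hq]
    | toss k =>
      rw [localStep_toss ha, PMF.mem_support_map_iff] at h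
      obtain ⟨⟨r, c1⟩, h1, h2⟩ := h
      rw [logAt, ← h2, hrec _ _ _ hq]
      unfold Config.flip at h1
      split at h1
      · rw [PMF.support_pure, Set.mem_singleton_iff] at h1
        cases h1
        rfl
      · obtain ⟨r', -, h1⟩ := (PMF.mem_support_map_iff _ _ _).1 h1
        cases h1
        rfl
  | deliver k =>
    simp only [Config.next] at h
    split at h
    · rename_i p hp
      split_ifs at h
      · rw [PMF.support_pure, Set.mem_singleton_iff] at h
        rw [logAt, h]
      · rw [PMF.support_pure, Set.mem_singleton_iff] at h
        rw [logAt, h]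
        rcases eq_or_ne p.dst i with hd | hd
        · rw [hd, record_events_self, steps_cons_received]
        · rw [hrec _ _ _ hd]
    · rw [PMF.support_pure, Set.mem_singleton_iff] at h
      rw [logAt, h]
  | corrupt q =>
    simp only [Config.next] at h
    split_ifs at h <;> rw [PMF.support_pure, Set.mem_singleton_iff] at h <;> rw [logAt, h]
  | inject q d m =>
    simp only [Config.next] at h
    split_ifs at h <;> rw [PMF.support_pure, Set.mem_singleton_iff] at h <;> rw [logAt, h]
  | peek k =>
    simp only [Config.next] at h
    split_ifs at h
    · rw [PMF.mem_support_map_iff] at h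
      obtain ⟨⟨r, c1⟩, h1, h2⟩ := h
      rw [logAt, ← h2]
      unfold Config.flip at h1
      split at h1
      · rw [PMF.support_pure, Set.mem_singleton_iff] at h1
        cases h1
        rfl
      · obtain ⟨r', -, h1⟩ := (PMF.mem_support_map_iff _ _ _).1 h1
        cases h1
        rfl
    · rw [PMF.support_pure, Set.mem_singleton_iff] at h
      rw [logAt, h]

/-- Discrete intermediate values, applied to the number of local steps of a party. -/
lemma exists_crossing {f : ℕ → ℕ} (hf : ∀ s, f (s + 1) ≤ f s + 1) {a v : ℕ} (ha : f a ≤ v) :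
    ∀ k, v < f (a + k) → ∃ s, a ≤ s ∧ s < a + k ∧ f s = v ∧ f (s + 1) = v + 1 := by
  intro k
  induction k with
  | zero => intro h; rw [add_zero] at h; omega
  | succ k ih =>
    intro h
    by_cases hk : v < f (a + k)
    · obtain ⟨s, h1, h2, h3⟩ := ih hk
      exact ⟨s, h1, by omega, h3⟩
    · have := hf (a + k)
      rw [← add_assoc] at h
      exact ⟨a + k, by omega, by omega, by omega, by omega⟩

/-- Within three rounds an honest party takes a step of each kind. -/
lemma exists_phase (hω : E.IsPath ω) (hi : HonestIn ω i) {φ : ℕ} (hφ : φ < 3)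
    (h : r + 3 ≤ rounds E.strategy ω s) : ∃ s' < s, r ≤ rounds E.strategy ω s' ∧
      E.strategy (ω s') = .step i ∧ (logAt ω s' i).steps % 3 = φ := by
  obtain ⟨s3, h31, h32, h33⟩ := exists_step_of_rounds hi (r := r + 2) h
  obtain ⟨s2, h21, h22, h23⟩ := exists_step_of_rounds hi (r := r + 1) h32
  obtain ⟨s1, h11, h12, h13⟩ := exists_step_of_rounds hi (r := r) h22
  set f : ℕ → ℕ := fun s => (logAt ω s i).steps with hf
  have hone : ∀ s, f (s + 1) ≤ f s + 1 := by
    intro s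
    by_cases hs : E.strategy (ω s) = .step i
    · exact (steps_logAt_step hω hi hs).le
    · exact (steps_logAt_of_ne hω hs).le.trans (Nat.le_succ _)
  have hmono : Monotone f := monotone_nat_of_le_succ fun s => by
    by_cases hs : E.strategy (ω s) = .step i
    · exact (Nat.le_succ _).trans (steps_logAt_step hω hi hs).ge
    · exact (steps_logAt_of_ne hω hs).ge
  have e1 : f (s1 + 1) = f s1 + 1 := steps_logAt_step hω hi h13
  have e2 : f (s2 + 1) = f s2 + 1 := steps_logAt_step hω hi h23
  have e3 : f (s3 + 1) = f s3 + 1 := steps_logAt_step hω hi h33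
  have m1 : f (s1 + 1) ≤ f s2 := hmono h11
  have m2 : f (s2 + 1) ≤ f s3 := hmono h21
  -- The least step number from `f s1` on with residue `φ`; three rounds give three steps, enough to
  -- pass it.
  obtain ⟨v, hv1, hv2, hv3⟩ : ∃ v, f s1 ≤ v ∧ v < f s1 + 3 ∧ v % 3 = φ :=
    ⟨f s1 + (φ + 3 - f s1 % 3) % 3, by omega, by omega, by omega⟩
  obtain ⟨s', h1, h2, h3, h4⟩ := exists_crossing hone hv1 (s3 + 1 - s1)
    (by rw [show s1 + (s3 + 1 - s1) = s3 + 1 by omega]; omega)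
  refine ⟨s', by omega, h12.trans (rounds_mono h1), ?_, by rw [← hv3, ← h3]⟩
  by_contra hs
  have : f (s' + 1) = f s' := steps_logAt_of_ne hω hs
  omega

lemma Slot.exists_dest (i : Party t) (sl : Slot t) : ∃ d, d ∈ sl.dests := by
  cases sl
  case ack j p | hold j p => exact ⟨p, by simp [Slot.dests]⟩
  all_goals exact ⟨i, by simp [Slot.dests]⟩

/-- Within three rounds an honest party speaks in the slots that it can use. -/
lemma exists_fired (hω : E.IsPath ω) (hi : HonestIn ω i) (h : r + 3 ≤ rounds E.strategy ω s) :
    ∃ s' < s, r ≤ rounds E.strategy ω s' ∧ ∀ sl, Ready (logAt ω s' i) sl →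
      (∃ o es, Rule i (E.input i) (logAt ω s' i) sl o es) → Fired (logAt ω s i) i sl := by
  obtain ⟨s', h1, h2, h3, h4⟩ := exists_phase hω hi (φ := 0) (by norm_num) h
  refine ⟨s', h1, h2, fun sl hr ⟨o, es, hrule⟩ => ?_⟩
  by_cases hf : Fired (logAt ω s' i) i sl
  · exact hf.mono (logAt_mono hω h1.le i)
  have hact : act i (E.input i) (logAt ω s' i) = .send (batch i (E.input i) (logAt ω s' i)) := by
    rw [act, if_pos h4]
  have hlog : logAt ω (s' + 1) i =
      .sent (batch i (E.input i) (logAt ω s' i)) :: logAt ω s' i := by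
    rcases logAt_step hω hi h3 with ⟨l, h, h'⟩ | ⟨v, h, h'⟩ | ⟨k, r, h, h'⟩
    · rw [hact] at h
      cases h
      exact h'
    · rw [hact] at h
      cases h
    · rw [hact] at h
      cases h
  have hslot : sl ∈ slots t ((logAt ω s' i).length + 1) :=
    hr.mem_slots fun j hj => Nat.lt_succ_of_le hj.le_length
  obtain ⟨o', es', -, hout⟩ := output_spec ⟨hf, hr, hrule⟩
  obtain ⟨d, hd⟩ := sl.exists_dest i
  have := fired_of_mem_output hslot (hout d hd _ List.mem_cons_self)
  rw [← hlog] at this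
  exact this.mono (logAt_mono hω h1 i)

/-- Within three rounds an honest party accesses the coin of a view. -/
lemma lead_of_tossable (hω : E.IsPath ω) (hi : HonestIn ω i) {j : ℕ}
    (hj : ∀ s, r ≤ rounds E.strategy ω s →
      Entered (logAt ω s i) j ∧ Know (logAt ω s i) (.tsig (t + 1) (.coin j)))
    (h : r + 3 ≤ rounds E.strategy ω s) : ∃ p, Lead (logAt ω s i) j p := by
  obtain ⟨s', h1, h2, h3, h4⟩ := exists_phase hω hi (φ := 1) (by norm_num) h
  by_cases hl : ∃ p, Lead (logAt ω s' i) j p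
  · exact hl.imp fun p hp => hp.mono (logAt_mono hω h1.le i)
  obtain ⟨he, hk⟩ := hj s' h2
  have htoss : Tossable (logAt ω s' i) j := ⟨he, hk, fun p hp => hl ⟨p, hp⟩⟩
  -- The action picks an arbitrary accessible coin, so it must be the only one: coins of earlier
  -- views have been accessed, and a later view would require the coin of `j`.
  have huniq : ∀ k, Tossable (logAt ω s' i) k → k = j := by
    intro k hk
    rcases lt_trichotomy k j with h | h | h
    · obtain ⟨p, hp⟩ := he.lead h
      exact absurd hp (hk.2.2 p)
    · exact h
    · exact absurd (hk.1.lead h) hl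
  have hex : ∃ k, Tossable (logAt ω s' i) k := ⟨j, htoss⟩
  have hact : act i (E.input i) (logAt ω s' i) = .toss hex.choose := by
    rw [act, if_neg (by omega), if_pos h4, dif_pos hex]
  rw [huniq _ hex.choose_spec] at hact
  rcases logAt_step hω hi h3 with ⟨l, h, h'⟩ | ⟨v, h, h'⟩ | ⟨k, r, h, h'⟩
  · rw [hact] at h
    cases h
  · rw [hact] at h
    cases h
  · rw [hact] at h
    cases h
    have hmem : LocalEvent.tossed j (some r) ∈ logAt ω (s' + 1) i := by
      rw [h']
      exact List.mem_cons_self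
    have hr := (inv_path hω (s' + 1)).coins_lt _ _ ((inv_path hω (s' + 1)).tossed _ _ _ hmem)
    exact ⟨⟨r, hr⟩, Lead.mono (p := ⟨r, hr⟩) hmem (logAt_mono hω h1 i)⟩

/-- Within three rounds an honest party decides. -/
lemma decided_of_decisive (hω : E.IsPath ω) (hi : HonestIn ω i)
    (hj : ∀ s, r ≤ rounds E.strategy ω s → ∃ v, Decisive (logAt ω s i) v)
    (h : r + 3 ≤ rounds E.strategy ω s) : ∃ v, DecidedBy ω i v s := by
  obtain ⟨s', h1, h2, h3, h4⟩ := exists_phase hω hi (φ := 2) (by norm_num) h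
  have hex := hj s' h2
  have hact : act i (E.input i) (logAt ω s' i) = .decide hex.choose := by
    rw [act, if_neg (by omega), if_neg (by omega), dif_pos hex]
  rcases logAt_step hω hi h3 with ⟨l, h, h'⟩ | ⟨v, h, h'⟩ | ⟨k, r, h, h'⟩
  · rw [hact] at h
    cases h
  · refine ⟨v, (logAt_mono hω h1 i).subset ?_⟩
    rw [h']
    exact List.mem_cons_self
  · rw [hact] at h
    cases h

/-- Within one round the messages between honest parties are delivered. -/
lemma exists_delivered (hω : E.IsPath ω) (h : r + 1 ≤ rounds E.strategy ω s) :
    ∃ a < s, r ≤ rounds E.strategy ω a ∧ ∀ i d m, HonestIn ω i → HonestIn ω d →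
      Sent (logAt ω a i) d m → Know (logAt ω s d) m := by
  obtain ⟨a, b, h1, h2, h3, h4⟩ := exists_roundOver h
  refine ⟨a, by omega, h3, fun i d m hi hd hm => ?_⟩
  obtain ⟨k, hk⟩ := List.getElem?_of_mem ((inv_path hω a).net i d m hm)
  have hdel := h4.2 k _ hk (hi b) (hd b)
  have hkb : (ω b).cur.net[k]? = some ⟨i, d, m, true⟩ := by
    obtain ⟨l, hl⟩ := (ext_path hω h1.le).net
    have hlen := (List.getElem?_eq_some_iff.1 hk).1
    rw [← hl, List.getElem?_append_left hlen]
    exact hk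
  have := (inv_path hω b).delivered k _ hkb hdel
  exact .known ⟨i, (logAt_mono hω h2 d).subset this⟩

/-- What an honest party has said in a slot is known to all honest addressees. -/
structure Heard (E : Ensemble (protocol t V)) (ω : ℕ → Node t V) (s : ℕ) (i : Party t)
    (sl : Slot t) (o : Option V) (es : List (Msg t V)) : Prop where
  issued : Issued (logAt ω s i) i (stmt sl o)
  rule : ∃ pre, pre <:+ logAt ω s i ∧ Rule i (E.input i) pre sl o es
  know : ∀ d ∈ sl.dests, HonestIn ω d → Know (logAt ω s d) (.sig i (stmt sl o))
  extra : ∀ d ∈ sl.dests, HonestIn ω d → ∀ m ∈ es, Know (logAt ω s d) m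

lemma WF.fired {x : V} {ev : Log t V} {sl : Slot t} (h : WF i x ev) (hf : Fired ev i sl) :
    ∃ o es pre, pre <:+ ev ∧ Rule i x pre sl o es ∧
      ∀ d ∈ sl.dests, ∀ m ∈ Msg.sig i (stmt sl o) :: es, Sent ev d m := by
  obtain ⟨o, ho⟩ := hf
  obtain ⟨pre, es, hs, he, -⟩ := h.issued ho
  obtain ⟨o', es', he', hout⟩ := output_spec he
  refine ⟨o', es', pre, (List.suffix_cons _ _).trans hs, he'.2.2, fun d hd m hm =>
    ⟨_, hs.subset List.mem_cons_self, List.mem_flatMap.2 ⟨sl, Finset.mem_toList.2 ?_,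
      hout d hd m hm⟩⟩⟩
  exact he.2.1.mem_slots fun j hj => Nat.lt_succ_of_le hj.le_length

/-- The time `a` is common to all parties and slots; this allows case distinctions on what has been
said by time `a`. -/
lemma exists_heard (hω : E.IsPath ω) (h : r + 1 ≤ rounds E.strategy ω s) :
    ∃ a < s, r ≤ rounds E.strategy ω a ∧ ∀ i sl, HonestIn ω i → Fired (logAt ω a i) i sl →
      ∃ o es, Heard E ω s i sl o es := by
  obtain ⟨a, h1, h2, h3⟩ := exists_delivered hω h
  refine ⟨a, h1, h2, fun i sl hi hf => ?_⟩
  have hwf := (inv_path hω a).wf i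
  rw [input_path hω a] at hwf
  obtain ⟨o, es, pre, hp, hr, hs⟩ := hwf.fired hf
  obtain ⟨d, hd⟩ := sl.exists_dest i
  exact ⟨o, es, Issued.mono ⟨d, hs d hd _ List.mem_cons_self⟩ (logAt_mono hω h1.le i),
    ⟨pre, hp.trans (logAt_mono hω h1.le i), hr⟩,
    fun d hd hh => h3 i d _ hi hh (hs d hd _ List.mem_cons_self),
    fun d hd hh m hm => h3 i d _ hi hh (hs d hd _ (List.mem_cons_of_mem _ hm))⟩

/-- Within four rounds what an honest party can say is heard by all honest addressees. -/
lemma heard_of_rule (hω : E.IsPath ω) (hi : HonestIn ω i) {sl : Slot t} {G : ℕ → Prop}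
    (hG : Monotone G)
    (hr : ∀ s, r ≤ rounds E.strategy ω s →
      (Ready (logAt ω s i) sl ∧ ∃ o es, Rule i (E.input i) (logAt ω s i) sl o es) ∨ G s)
    (h : r + 4 ≤ rounds E.strategy ω s) : (∃ o es, Heard E ω s i sl o es) ∨ G s := by
  obtain ⟨a, h1, h2, h3⟩ := exists_heard hω (r := r + 3) h
  obtain ⟨s', h4, h5, h6⟩ := exists_fired hω hi h2
  rcases hr s' h5 with ⟨hready, hrule⟩ | hg
  · exact .inl (h3 i sl hi (h6 sl hready hrule))
  · exact .inr (hG (h4.le.trans h1.le) hg)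

lemma heard_of_rule' (hω : E.IsPath ω) (hi : HonestIn ω i) {sl : Slot t}
    (hr : ∀ s, r ≤ rounds E.strategy ω s →
      Ready (logAt ω s i) sl ∧ ∃ o es, Rule i (E.input i) (logAt ω s i) sl o es)
    (h : r + 4 ≤ rounds E.strategy ω s) : ∃ o es, Heard E ω s i sl o es :=
  (heard_of_rule hω hi (G := fun _ => False) (fun _ _ _ h => h)
    (fun s hs => .inl (hr s hs)) h).resolve_right id

end Path

end AsyncBA
end

/-! ### Liveness: progress within a view and from view to view. -/

noncomputable section

namespace AsyncBA

variable {t : ℕ} {V : Type u}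

/-! ### The progress of the views -/

section Progress

variable {E : Ensemble (protocol t V)} {ω : ℕ → Node t V} {i p d : Party t} {r s j : ℕ} {v : V}
  {sl : Slot t} {o : Option V} {es : List (Msg t V)}

lemma know_tsig (hω : E.IsPath ω) {m : Msg t V} {k : ℕ} (hk : k ≤ 2 * t + 1)
    (hm : Derivable ∅ (logAt ω s d).received m)
    (h : ∀ i, HonestIn ω i → Know (logAt ω s d) (.sig i m)) :
    Know (logAt ω s d) (.tsig k m) :=
  .combine (honestSet ω) (hk.trans (card_honestSet hω)) hm fun i hi => h i (mem_honestSet.1 hi)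

lemma know_qcert (hω : E.IsPath ω)
    (h : ∀ i, HonestIn ω i → Know (logAt ω s d) (.sig i (stmt sl o))) :
    Know (logAt ω s d) (qcert sl o) :=
  know_tsig hω le_rfl (derivable_stmt _ _ _ _) h

lemma know_wcert (hω : E.IsPath ω)
    (h : ∀ i, HonestIn ω i → Know (logAt ω s d) (.sig i (stmt sl o))) :
    Know (logAt ω s d) (wcert sl o) :=
  know_tsig hω (by omega) (derivable_stmt _ _ _ _) h

lemma honest_le_ncard (hω : E.IsPath ω) {P : Party t → Prop} (h : ∀ i, HonestIn ω i → P i) :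
    2 * t + 1 ≤ {i | P i}.ncard := by
  refine (card_honestSet hω).trans ?_
  rw [← Set.ncard_coe_finset]
  exact Set.ncard_le_ncard (fun i hi => h i (mem_honestSet.1 hi)) (Set.toFinite _)

lemma issued_of_know (hω : E.IsPath ω) (hp : HonestIn ω p) {m : Msg t V}
    (h : Know (logAt ω s d) (.sig p m)) : Issued (logAt ω s p) p m :=
  ((inv_path hω s).sound_of_know h).1.resolve_left (hp s)

lemma lead_unique (hω : E.IsPath ω) {p' : Party t} (h : Lead (logAt ω s i) j p)
    (h' : Lead (logAt ω s d) j p') : p = p' :=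
  eq_of_coins ((inv_path hω s).coins_of_lead h) ((inv_path hω s).coins_of_lead h')

/-- The value of a slot is the same whenever it is heard. -/
lemma Heard.unique (hω : E.IsPath ω) {s' : ℕ} {o' : Option V} {es' : List (Msg t V)}
    (h : Heard E ω s i sl o es) (h' : Heard E ω s' i sl o' es') : o = o' :=
  (inv_path hω (max s s')).unique (h.issued.mono (logAt_mono hω (le_max_left s s') i))
    (h'.issued.mono (logAt_mono hω (le_max_right s s') i))

/-- Every honest party enters the first view. -/
lemma entered_zero (hω : E.IsPath ω) (h : 8 ≤ rounds E.strategy ω s) (hd : HonestIn ω d) :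
    Entered (logAt ω s d) 0 := by
  have hinp : ∀ s, 4 ≤ rounds E.strategy ω s → ∀ i d, HonestIn ω i → HonestIn ω d →
      Know (logAt ω s d) (.sig i (stmt .inp (some (E.input i)))) := by
    intro s hs i d hi hd
    obtain ⟨o, es, hh⟩ := heard_of_rule' hω hi (sl := .inp) (r := 0)
      (fun s _ => ⟨trivial, _, _, rfl, rfl⟩) hs
    obtain ⟨pre, -, rfl, -⟩ := hh.rule
    exact hh.know d (by simp [Slot.dests]) hd
  have hecho : ∀ i, HonestIn ω i → ∃ o es, Heard E ω s i .echo o es := by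
    intro i hi
    refine heard_of_rule' hω hi (r := 4) (fun s hs => ⟨trivial, ?_⟩) h
    have hn := honest_le_ncard hω
      (P := fun p => ∃ w, Know (logAt ω s i) (.sig p (stmt .inp (some w))))
      fun p hp => ⟨_, hinp s hs p i hp hi⟩
    by_cases hv : ∃ v, Know (logAt ω s i) (wcert .inp (some v))
    · obtain ⟨v, hv⟩ := hv
      exact ⟨_, _, hn, .inl ⟨v, rfl, hv, rfl⟩⟩
    · exact ⟨_, _, hn, .inr ⟨rfl, rfl, not_exists.1 hv⟩⟩
  -- One report carrying an input certificate hands it to everybody; otherwise all honest reports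
  -- are empty and together form the other entry certificate.
  by_cases hv : ∃ i v es, HonestIn ω i ∧ Heard E ω s i .echo (some v) es
  · obtain ⟨i, v, es, hi, hh⟩ := hv
    obtain ⟨pre, -, -, ⟨w, -, -, rfl⟩ | ⟨h, -⟩⟩ := hh.rule
    · exact .inl ⟨w, hh.extra d (by simp [Slot.dests]) hd _ List.mem_cons_self⟩
    · cases h
  · refine .inr (know_wcert hω fun i hi => ?_)
    obtain ⟨o, es, hh⟩ := hecho i hi
    cases o with
    | none => exact hh.know d (by simp [Slot.dests]) hd
    | some v => exact absurd ⟨i, v, es, hi, hh⟩ hv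

/-- The proposals of the honest parties in the views before `j` have been heard. -/
def Proposed (E : Ensemble (protocol t V)) (ω : ℕ → Node t V) (s j : ℕ) : Prop :=
  ∀ k < j, ∀ i, HonestIn ω i → ∃ o es, Heard E ω s i (.prop k) o es

/-- The proposals of the honest parties are valid. -/
lemma valid_of_heard (hω : E.IsPath ω) (hd : HonestIn ω d) :
    ∀ {j i v es}, HonestIn ω i → Heard E ω s i (.prop j) (some v) es → Entered (logAt ω s d) j →
      Proposed E ω s j → Valid (logAt ω s d) j v := by
  intro j
  induction j with
  | zero =>
    intro i v es hi hh _ _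
    obtain ⟨pre, hpre, w, m, hw, rfl, -, hm⟩ := hh.rule
    cases hw
    have hk := hh.extra d (by simp [Slot.dests]) hd m List.mem_cons_self
    rcases hm with rfl | ⟨-, rfl⟩
    · exact .inl hk
    · exact .inr hk
  | succ j ih =>
    intro i v es hi hh he hprop
    obtain ⟨pre, hpre, w, m, hw, rfl, -, hm⟩ := hh.rule
    cases hw
    have hk := hh.extra d (by simp [Slot.dests]) hd m List.mem_cons_self
    rcases hm with ⟨p, hp, rfl⟩ | ⟨rfl, hiss⟩
    · obtain ⟨-, -, p', hp', -⟩ := he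
      obtain rfl := lead_unique hω hp' (hp.mono hpre)
      exact .inl ⟨p', hp', hk⟩
    -- A repeated proposal is legitimate because the preceding one was; this is why earlier
    -- proposals must have been heard.
    · obtain ⟨o, es, hh'⟩ := hprop j (Nat.lt_succ_self j) i hi
      obtain rfl := (inv_path hω s).unique hh'.issued (hiss.mono hpre)
      exact .inr ⟨hk, ih hi hh' he.1 fun k hk => hprop k (Nat.lt_succ_of_lt hk)⟩

/-- From round `r` on, all honest parties are in view `j`, and the honest proposals of the
preceding views have been heard. -/
def InView (E : Ensemble (protocol t V)) (ω : ℕ → Node t V) (r j : ℕ) : Prop :=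
  ∀ s, r ≤ rounds E.strategy ω s →
    (∀ i, HonestIn ω i → Entered (logAt ω s i) j) ∧ Proposed E ω s j

lemma heard_prop (hω : E.IsPath ω) (hv : InView E ω r j) (hi : HonestIn ω i)
    (h : r + 4 ≤ rounds E.strategy ω s) : ∃ v es, Heard E ω s i (.prop j) (some v) es := by
  suffices ∃ o es, Heard E ω s i (.prop j) o es by
    obtain ⟨o, es, hh⟩ := this
    obtain ⟨pre, hpre, hr⟩ := hh.rule
    cases j <;> obtain ⟨v, m, rfl, -⟩ := hr <;> exact ⟨v, es, hh⟩
  refine heard_of_rule' hω hi (fun s hs => ⟨(hv s hs).1 i hi, ?_⟩) h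
  obtain ⟨he, hprop⟩ := hv s hs
  have he := he i hi
  cases j with
  | zero =>
    rcases he with ⟨v, hk⟩ | hk
    · exact ⟨_, _, v, _, rfl, rfl, hk, .inl rfl⟩
    · exact ⟨_, _, E.input i, _, rfl, rfl, hk, .inr ⟨rfl, rfl⟩⟩
  | succ j =>
    obtain ⟨-, -, p, hp, hk | ⟨v, hk⟩⟩ := he
    · obtain ⟨o, es, hh⟩ := hprop j (Nat.lt_succ_self j) i hi
      have : ∃ v, o = some v := by
        obtain ⟨pre, hpre, hr⟩ := hh.rule
        cases j <;> obtain ⟨v, m, rfl, -⟩ := hr <;> exact ⟨v, rfl⟩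
      obtain ⟨v, rfl⟩ := this
      exact ⟨_, _, v, _, rfl, rfl, hk, .inr ⟨rfl, hh.issued⟩⟩
    · exact ⟨_, _, v, _, rfl, rfl, hk, .inl ⟨p, hp, rfl⟩⟩

/-- Some honest party has abandoned the proposals of view `j`. -/
def Abandoned (ω : ℕ → Node t V) (j s : ℕ) : Prop :=
  ∃ i, HonestIn ω i ∧ Fired (logAt ω s i) i (.aband j)

lemma Abandoned.monotone (hω : E.IsPath ω) : Monotone (Abandoned ω j) :=
  fun _ _ h ⟨i, hi, hf⟩ => ⟨i, hi, hf.mono (logAt_mono hω h i)⟩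

/-- Each stage takes four rounds: three until a sending step and one for delivery. An early
abandonment may block a stage, but then `know_skip` takes a shortcut. -/
lemma heard_ack (hω : E.IsPath ω) (hv : InView E ω r j) (hi : HonestIn ω i) (hp : HonestIn ω p)
    (h : r + 8 ≤ rounds E.strategy ω s) :
    (∃ o es, Heard E ω s i (.ack j p) o es) ∨ Abandoned ω j s := by
  refine heard_of_rule hω hi (r := r + 4) (Abandoned.monotone hω) (fun s hs => ?_) h
  by_cases hab : Fired (logAt ω s i) i (.aband j)
  · exact .inr ⟨i, hi, hab⟩
  · obtain ⟨he, hprop⟩ := hv s (by omega)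
    obtain ⟨v, es, hh⟩ := heard_prop hω hv hp hs
    exact .inl ⟨he i hi, _, _, v, rfl, rfl, hab, hh.know i (by simp [Slot.dests]) hi,
      valid_of_heard hω hi hp hh (he i hi) hprop⟩

lemma heard_cert (hω : E.IsPath ω) (hv : InView E ω r j) (hp : HonestIn ω p)
    (h : r + 12 ≤ rounds E.strategy ω s) :
    (∃ o es, Heard E ω s p (.cert j) o es) ∨ Abandoned ω j s := by
  refine heard_of_rule hω hp (r := r + 8) (Abandoned.monotone hω) (fun s hs => ?_) h
  refine or_iff_not_imp_right.2 fun hab => ⟨(hv s (by omega)).1 p hp, ?_⟩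
  obtain ⟨v, es, hh⟩ := heard_prop hω hv hp (s := s) (by omega)
  refine ⟨_, _, v, rfl, rfl, know_qcert hω fun i hi => ?_⟩
  obtain ⟨o, es', hack⟩ := (heard_ack hω hv hi hp hs).resolve_right hab
  obtain ⟨pre, hpre, w, rfl, -, -, hk, -⟩ := hack.rule
  -- All honest parties acknowledge the same value, since the honest `p` signed only one proposal.
  have := (inv_path hω s).unique hh.issued (issued_of_know hω hp (hk.mono hpre))
  rw [this]
  exact hack.know p (by simp [Slot.dests]) hp

lemma heard_hold (hω : E.IsPath ω) (hv : InView E ω r j) (hi : HonestIn ω i) (hp : HonestIn ω p)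
    (h : r + 16 ≤ rounds E.strategy ω s) :
    (∃ o es, Heard E ω s i (.hold j p) o es) ∨ Abandoned ω j s := by
  refine heard_of_rule hω hi (r := r + 12) (Abandoned.monotone hω) (fun s hs => ?_) h
  refine or_iff_not_imp_right.2 fun hab => ⟨(hv s (by omega)).1 i hi, ?_⟩
  obtain ⟨o, es, hh⟩ := (heard_cert hω hv hp hs).resolve_right hab
  obtain ⟨pre, -, v, rfl, rfl, -⟩ := hh.rule
  exact ⟨_, _, rfl, rfl, fun hf => hab ⟨i, hi, hf⟩, v,
    hh.extra i (by simp [Slot.dests]) hi _ List.mem_cons_self⟩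

lemma heard_done (hω : E.IsPath ω) (hv : InView E ω r j) (hp : HonestIn ω p)
    (h : r + 20 ≤ rounds E.strategy ω s) :
    (∃ o es, Heard E ω s p (.done j) o es) ∨ Abandoned ω j s := by
  refine heard_of_rule hω hp (r := r + 16) (Abandoned.monotone hω) (fun s hs => ?_) h
  refine or_iff_not_imp_right.2 fun hab => ⟨(hv s (by omega)).1 p hp, ?_⟩
  refine ⟨_, _, rfl, rfl, know_qcert hω fun i hi => ?_⟩
  obtain ⟨o, es, hh⟩ := (heard_hold hω hv hi hp hs).resolve_right hab
  obtain ⟨pre, -, rfl, -⟩ := hh.rule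
  exact hh.know p (by simp [Slot.dests]) hp

lemma heard_skip (hω : E.IsPath ω) (hv : InView E ω r j) (hi : HonestIn ω i)
    (h : r + 24 ≤ rounds E.strategy ω s) :
    (∃ o es, Heard E ω s i (.skip j) o es) ∨ Abandoned ω j s := by
  refine heard_of_rule hω hi (r := r + 20) (Abandoned.monotone hω) (fun s hs => ?_) h
  refine or_iff_not_imp_right.2 fun hab => ⟨(hv s (by omega)).1 i hi, ?_⟩
  refine ⟨_, _, rfl, rfl, honest_le_ncard hω fun p hp => ?_⟩
  obtain ⟨o, es, hh⟩ := (heard_done hω hv hp hs).resolve_right hab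
  obtain ⟨pre, -, -, rfl, -⟩ := hh.rule
  exact hh.extra i (by simp [Slot.dests]) hi _ List.mem_cons_self

lemma know_skip (hω : E.IsPath ω) (hv : InView E ω r j) (hd : HonestIn ω d)
    (h : r + 25 ≤ rounds E.strategy ω s) : Know (logAt ω s d) (wcert (.skip j) none) := by
  obtain ⟨a, ha, hr, hheard⟩ := exists_heard hω (r := r + 24) h
  -- A party that abandons forwards the certificate that made it do so; if none has, all honest
  -- requests to end the proposals have arrived.
  by_cases hab : Abandoned ω j a
  · obtain ⟨i, hi, hf⟩ := hab
    obtain ⟨o, es, hh⟩ := hheard i _ hi hf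
    obtain ⟨pre, -, -, rfl, -⟩ := hh.rule
    exact hh.extra d (by simp [Slot.dests]) hd _ List.mem_cons_self
  · refine (know_wcert hω fun i hi => ?_).mono (logAt_mono hω ha.le d)
    obtain ⟨o, es, hh⟩ := (heard_skip hω hv hi hr).resolve_right hab
    obtain ⟨pre, -, rfl, -⟩ := hh.rule
    exact hh.know d (by simp [Slot.dests]) hd

lemma heard_aband (hω : E.IsPath ω) (hv : InView E ω r j) (hi : HonestIn ω i)
    (h : r + 29 ≤ rounds E.strategy ω s) : ∃ es, Heard E ω s i (.aband j) none es := by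
  obtain ⟨o, es, hh⟩ := heard_of_rule' hω hi (r := r + 25) (sl := .aband j) (fun s hs =>
    ⟨(hv s (by omega)).1 i hi, _, _, rfl, rfl, know_skip hω hv hi hs⟩) h
  obtain ⟨pre, -, rfl, -⟩ := hh.rule
  exact ⟨es, hh⟩

lemma know_coin (hω : E.IsPath ω) (hv : InView E ω r j) (hd : HonestIn ω d)
    (h : r + 33 ≤ rounds E.strategy ω s) :
    Know (logAt ω s d) (.tsig (t + 1) (.coin j)) := by
  refine know_tsig hω (by omega) (.coin j) fun i hi => ?_
  obtain ⟨o, es, hh⟩ := heard_of_rule' hω hi (r := r + 29) (sl := .share j) (fun s hs =>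
    ⟨(hv s (by omega)).1 i hi, _, _, rfl, rfl, know_qcert hω fun p hp => by
      obtain ⟨es, hh⟩ := heard_aband hω hv hp hs
      exact hh.know i (by simp [Slot.dests]) hi⟩) h
  obtain ⟨pre, -, -, rfl, -⟩ := hh.rule
  exact hh.extra d (by simp [Slot.dests]) hd _ List.mem_cons_self

lemma exists_lead (hω : E.IsPath ω) (hv : InView E ω r j) (hi : HonestIn ω i)
    (h : r + 36 ≤ rounds E.strategy ω s) : ∃ p, Lead (logAt ω s i) j p :=
  lead_of_tossable hω hi (r := r + 33)
    (fun s hs => ⟨(hv s (by omega)).1 i hi, know_coin hω hv hi hs⟩) h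

lemma fired_absent_or_vote (hω : E.IsPath ω) (hv : InView E ω r j) (hi : HonestIn ω i)
    (h : r + 39 ≤ rounds E.strategy ω s) :
    Fired (logAt ω s i) i (.absent j) ∨ Fired (logAt ω s i) i (.vote j) := by
  obtain ⟨s', -, hr, hf⟩ := exists_fired hω hi (r := r + 36) h
  have he := (hv s' (by omega)).1 i hi
  obtain ⟨p, hp⟩ := exists_lead hω hv hi hr
  by_cases hk : ∃ v, Know (logAt ω s' i) (qcert (.ack j p) (some v))
  · obtain ⟨v, hk⟩ := hk
    exact .inr (hf _ he ⟨_, _, p, hp, .inl ⟨v, rfl, rfl, hk⟩⟩)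
  · obtain ⟨es, hab⟩ := heard_aband hω hv hi (s := s') (by omega)
    exact .inl (hf _ he ⟨_, _, rfl, rfl, ⟨_, hab.issued⟩, p, hp, not_exists.1 hk⟩)

lemma heard_vote (hω : E.IsPath ω) (hv : InView E ω r j) (hi : HonestIn ω i)
    (h : r + 44 ≤ rounds E.strategy ω s) : ∃ o es, Heard E ω s i (.vote j) o es := by
  refine heard_of_rule' hω hi (r := r + 40) (fun s hs => ⟨(hv s (by omega)).1 i hi, ?_⟩) h
  obtain ⟨p, hp⟩ := exists_lead hω hv hi (s := s) (by omega)
  obtain ⟨a, ha, hr, hheard⟩ := exists_heard hω (r := r + 39) hs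
  -- A vote carries its justification, which enables everybody else to vote. If nobody has voted,
  -- all honest parties have declared the certificate absent, which yields the absence proof.
  by_cases hvote : ∃ k, HonestIn ω k ∧ Fired (logAt ω a k) k (.vote j)
  · obtain ⟨k, hk, hf⟩ := hvote
    obtain ⟨o, es, hh⟩ := hheard k _ hk hf
    obtain ⟨pre, hpre, p', hp', ⟨v, rfl, rfl, -⟩ | ⟨rfl, rfl, -⟩⟩ := hh.rule
    · obtain rfl := lead_unique hω hp (hp'.mono hpre)
      exact ⟨_, _, p, hp, .inl ⟨v, rfl, rfl,
        hh.extra i (by simp [Slot.dests]) hi _ List.mem_cons_self⟩⟩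
    · exact ⟨_, _, p, hp, .inr ⟨rfl, rfl,
        hh.extra i (by simp [Slot.dests]) hi _ List.mem_cons_self⟩⟩
  · refine ⟨_, _, p, hp, .inr ⟨rfl, rfl, know_qcert hω fun k hk => ?_⟩⟩
    obtain ⟨o, es, hh⟩ := hheard k _ hk ((fired_absent_or_vote hω hv hk hr).resolve_right
      fun hf => hvote ⟨k, hk, hf⟩)
    obtain ⟨pre, -, rfl, -⟩ := hh.rule
    exact hh.know i (by simp [Slot.dests]) hi

/-- A view either leads to a decision or is followed by the next view. -/
lemma decided_or_inView (hω : E.IsPath ω) (hv : InView E ω r j) :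
    (∀ s, r + 47 ≤ rounds E.strategy ω s → ∀ i, HonestIn ω i → ∃ v, DecidedBy ω i v s) ∨
      InView E ω (r + 44) (j + 1) := by
  -- The existence of an honest empty vote is asked over all times; `Heard.unique` transfers it to
  -- every `s`, so one alternative holds uniformly.
  by_cases hnone : ∃ s i es, HonestIn ω i ∧ Heard E ω s i (.vote j) none es
  · obtain ⟨s₀, i, es₀, hi, hh₀⟩ := hnone
    refine .inr fun s hs => ⟨fun d hd => ?_, fun k hk p hp => ?_⟩
    · obtain ⟨p, hp⟩ := exists_lead hω hv hd (s := s) (by omega)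
      refine ⟨(hv s (by omega)).1 d hd, ?_, p, hp, ?_⟩
      · obtain ⟨o, es, hh⟩ := heard_vote hω hv hi hs
        obtain rfl := hh.unique hω hh₀
        obtain ⟨pre, -, p', -, ⟨v, h, -⟩ | ⟨-, rfl, -⟩⟩ := hh.rule
        · cases h
        · exact hh.extra d (by simp [Slot.dests]) hd _ List.mem_cons_self
      -- A nonempty vote supplies the leader's certificate; otherwise the honest votes form a quorum
      -- of empty ones. Either suffices for entry.
      · by_cases hsome : ∃ k v es, HonestIn ω k ∧ Heard E ω s k (.vote j) (some v) es
        · obtain ⟨k, v, es, hk, hh⟩ := hsome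
          obtain ⟨pre, hpre, p', hp', ⟨w, -, rfl, -⟩ | ⟨h, -⟩⟩ := hh.rule
          · obtain rfl := lead_unique hω hp (hp'.mono hpre)
            exact .inr ⟨w, hh.extra d (by simp [Slot.dests]) hd _ List.mem_cons_self⟩
          · cases h
        · refine .inl (know_qcert hω fun k hk => ?_)
          obtain ⟨o, es, hh⟩ := heard_vote hω hv hk hs
          cases o with
          | none => exact hh.know d (by simp [Slot.dests]) hd
          | some v => exact absurd ⟨k, v, es, hk, hh⟩ hsome
    · rcases (Nat.lt_succ_iff_lt_or_eq.1 hk) with hk | rfl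
      · exact (hv s (by omega)).2 k hk p hp
      · obtain ⟨v, es, hh⟩ := heard_prop hω hv hp (s := s) (by omega)
        exact ⟨_, es, hh⟩
  · refine .inl fun s hs d hd => decided_of_decisive hω hd (r := r + 44) (fun s hs => ?_) hs
    have hsome : ∀ k, HonestIn ω k → ∃ v es, Heard E ω s k (.vote j) (some v) es := by
      intro k hk
      obtain ⟨o, es, hh⟩ := heard_vote hω hv hk hs
      cases o with
      | none => exact absurd ⟨s, k, es, hk, hh⟩ hnone
      | some v => exact ⟨v, es, hh⟩
    obtain ⟨v, es, hh⟩ := hsome d hd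
    refine ⟨v, j, know_qcert hω fun k hk => ?_⟩
    obtain ⟨w, es', hh'⟩ := hsome k hk
    have hcert : ∀ {k w es}, Heard E ω s k (.vote j) (some w) es → ∃ p,
        Lead (logAt ω s k) j p ∧ Sound (ω s).cur (qcert (.ack j p) (some w)) := by
      intro k w es hh
      obtain ⟨pre, hpre, p, hp, ⟨w', h, -, hk⟩ | ⟨h, -⟩⟩ := hh.rule
      · cases h
        exact ⟨p, hp.mono hpre, (inv_path hω s).sound_of_know (hk.mono hpre)⟩
      · cases h
    obtain ⟨p, hp, hs1⟩ := hcert hh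
    obtain ⟨p', hp', hs2⟩ := hcert hh'
    obtain rfl := lead_unique hω hp hp'
    rw [(inv_path hω s).qcert_unique hs1 hs2]
    exact hh'.know d (by simp [Slot.dests]) hd

lemma decided_or_inView_of_path (hω : E.IsPath ω) (j : ℕ) :
    (∀ s, 11 + 44 * j ≤ rounds E.strategy ω s → ∀ i, HonestIn ω i → ∃ v, DecidedBy ω i v s) ∨
      InView E ω (8 + 44 * j) j := by
  induction j with
  | zero =>
    exact .inr fun s hs => ⟨fun i hi => entered_zero hω hs hi, fun k hk => absurd hk (by omega)⟩
  | succ j ih =>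
    rcases ih with h | h
    · exact .inl fun s hs => h s (by omega)
    · rcases decided_or_inView hω h with h | h
      · exact .inl fun s hs => h s (by omega)
      · exact .inr fun s hs => h s (by omega)

/-- As long as some honest party has not decided, the number of rounds is bounded by the number of
views. -/
lemma rounds_lt_of_undecided (hω : E.IsPath ω) (hi : HonestIn ω i)
    (h : ¬ ∃ v, DecidedBy ω i v s) :
    rounds E.strategy ω s < 11 + 44 * viewCount (ω s).cur := by
  by_contra hs
  rcases decided_or_inView_of_path hω (viewCount (ω s).cur) with hd | hv
  · exact h (hd s (by omega) i hi)
  -- The view whose number is the view count has, by definition, not been entered.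
  · exact (lt_viewCount ((hv s (by omega)).1 i hi)).ne rfl

lemma roundsToDecide_le (hω : E.IsPath ω) :
    roundsToDecide E.strategy ω ≤ 11 + 44 * ⨆ s, (viewCount (ω s).cur : ℝ≥0∞) := by
  refine iSup_le fun s => ?_
  split_ifs with h
  · obtain ⟨i, hi, hd⟩ := h
    have hlt : rounds E.strategy ω s + 1 ≤ 11 + 44 * viewCount (ω s).cur :=
      rounds_lt_of_undecided hω hi hd
    calc (((roundState E.strategy ω s).2 + 1 : ℕ) : ℝ≥0∞)
        ≤ ((11 + 44 * viewCount (ω s).cur : ℕ) : ℝ≥0∞) := by exact_mod_cast hlt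
      _ = 11 + 44 * (viewCount (ω s).cur : ℝ≥0∞) := by push_cast; rfl
      _ ≤ _ := by
        gcongr
        exact le_iSup (fun s => (viewCount (ω s).cur : ℝ≥0∞)) s
  · exact zero_le

lemma lintegral_roundsToDecide_le (E : Ensemble (protocol t V)) :
    ∫⁻ ω, roundsToDecide E.strategy ω ∂E.law ≤ 99 := by
  calc ∫⁻ ω, roundsToDecide E.strategy ω ∂E.law
      ≤ ∫⁻ ω, (11 + 44 * ⨆ s, (viewCount (ω s).cur : ℝ≥0∞)) ∂E.law :=
        lintegral_mono_ae (E.ae_isPath.mono fun ω hω => roundsToDecide_le hω)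
    _ ≤ 11 + 44 * 2 := lintegral_add_mul_viewCount_le E 11 44
    _ = 99 := by norm_num

end Progress

end AsyncBA
end

/-! ### The properties of Byzantine Agreement. -/

noncomputable section

namespace AsyncBA

variable {t : ℕ} {V : Type u}

/-! ### Byzantine Agreement -/

section Main

variable (E : Ensemble (protocol t V))

theorem agreement : Agreement E := by
  rintro ω hω i j v w - - ⟨s, hv⟩ ⟨s', hw⟩
  exact (inv_path hω (max s s')).decided_unique
    ((logAt_mono hω (le_max_left s s') i).subset hv)
    ((logAt_mono hω (le_max_right s s') j).subset hw)

/-- The total number of views has finite mean, so it is almost surely finite, while rounds continue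
forever; by `rounds_lt_of_undecided` nobody stays undecided. -/
theorem probabilisticTermination : ProbabilisticTermination E := by
  have hm : Measurable fun ω : ℕ → Node t V => ⨆ s, (viewCount (ω s).cur : ℝ≥0∞) :=
    .iSup fun s => Ensemble.measurable_eval (fun x => (viewCount x.cur : ℝ≥0∞)) s
  have hfin := ae_lt_top hm ((lintegral_viewCount_le (E := E)).trans_lt ENNReal.ofNat_lt_top).ne
  filter_upwards [hfin, E.ae_isPath] with ω hlt hω i hi
  obtain ⟨m, hm⟩ := ENNReal.exists_nat_gt hlt.ne
  obtain ⟨s, hs⟩ := exists_le_rounds hω (11 + 44 * m)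
  by_contra hd
  have h1 := rounds_lt_of_undecided hω hi (s := s) fun ⟨v, hv⟩ => hd ⟨v, s, hv⟩
  have h2 : viewCount (ω s).cur < m := by
    exact_mod_cast (le_iSup (fun s => (viewCount (ω s).cur : ℝ≥0∞)) s).trans_lt hm
  omega

variable {E}

lemma mem_inputs {ω : ℕ → Node t V} (hω : E.IsPath ω) {s : ℕ} {v : V} :
    v ∈ E.inputs ↔ (ω s).cur.IsInput v := by
  rw [Ensemble.inputs, Multiset.mem_map, Config.IsInput, input_path hω]
  exact exists_congr fun i => and_iff_right (Finset.mem_univ i)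

open Classical in
lemma count_inputs (v : V) : E.inputs.count v = {i | E.input i = v}.ncard := by
  rw [Ensemble.inputs, Multiset.count_map, ← Finset.filter_val, Finset.card_val,
    ← Set.ncard_coe_finset]
  simp [eq_comm]

variable (E)

/-- An honest party decides on a value that is no input with small probability only. -/
lemma law_exists_decides_le :
    E.law {ω | E.IsPath ω ∧ ∃ s i v, DecidedBy ω i v s ∧ v ∉ E.inputs} ≤
      (E.faults : ℝ≥0∞) / ((2 * t + 1 : ℕ) : ℝ≥0∞) := by
  set B : ℕ → Set (ℕ → Node t V) := fun s =>
    {ω | E.IsPath ω ∧ ∃ i v, DecidedBy ω i v s ∧ v ∉ E.inputs} with hB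
  -- `Lost` need not be monotone in time, but bad decisions are permanent; hence continuity of the
  -- measure is applied to the latter.
  have hmono : Monotone B := by
    rintro a b h ω ⟨hω, i, v, hd, hv⟩
    exact ⟨hω, i, v, (logAt_mono hω h i).subset hd, hv⟩
  have hunion : {ω | E.IsPath ω ∧ ∃ s i v, DecidedBy ω i v s ∧ v ∉ E.inputs} = ⋃ s, B s := by
    ext ω
    simp [hB]
  rw [hunion, hmono.measure_iUnion]
  refine iSup_le fun s => (measure_mono ?_).trans (law_lost_le (E := E) s)
  rintro ω ⟨hω, i, v, hd, hv⟩
  exact (inv_path hω s).lost_of_decided hd fun h => hv ((mem_inputs hω).2 h)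

theorem qualitativeValidity : QualitativeValidity E := by
  classical
  refine ⟨fun h ω hω i v _ ⟨s, hd⟩ => ?_, fun _ => ?_⟩
  · obtain ⟨w, -, hw⟩ := Finset.exists_mem_eq_sup E.inputs.toFinset
      ⟨E.input i, Multiset.mem_toFinset.2
        ((mem_inputs hω (s := s)).2 ⟨i, by rw [input_path hω]⟩)⟩ fun v => E.inputs.count v
    have hmax : maxMult E.inputs = {i | (ω s).cur.input i = w}.ncard := by
      rw [input_path hω, ← count_inputs, ← hw]
      unfold maxMult
      congr!
    have hcard := card_le_faults hω s
    exact (mem_inputs hω).2 ((inv_path hω s).isInput_of_decided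
      ((inv_path hω s).not_sound_echo (v := w) (by omega)) hd)
  · set S := {ω | ∀ i, HonestIn ω i → ∃ v ∈ E.inputs, Decides ω i v} with hS
    have hcompl : E.law Sᶜ ≤ (E.faults : ℝ≥0∞) / ((2 * t + 1 : ℕ) : ℝ≥0∞) := by
      refine (measure_mono_ae ?_).trans (law_exists_decides_le E)
      filter_upwards [probabilisticTermination E, E.ae_isPath] with ω hterm hω hn
      by_contra hbad
      refine hn fun i hi => ?_
      obtain ⟨v, s, hd⟩ := hterm i hi
      by_contra hv
      exact hbad ⟨hω, s, i, v, hd, fun hin => hv ⟨v, hin, s, hd⟩⟩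
    -- Subadditivity is enough here and avoids showing that `S` is measurable.
    have hle : 1 ≤ E.law.real S + E.law.real Sᶜ := by
      have := measureReal_union_le (μ := E.law) S Sᶜ
      rwa [Set.union_compl_self, probReal_univ] at this
    have hreal : E.law.real Sᶜ ≤ (E.faults : ℝ) / (2 * t + 1) := by
      have := ENNReal.toReal_mono (ENNReal.div_ne_top (by simp) (by simp)) hcompl
      rw [ENNReal.toReal_div, ENNReal.toReal_natCast, ENNReal.toReal_natCast] at this
      exact_mod_cast this
    have hden : (((3 * t + 1 : ℕ) : ℝ) - t) = 2 * t + 1 := by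
      push_cast
      ring
    rw [hden]
    linarith

end Main

end AsyncBA
end

theorem mainTheorem2 :
    ∃ C : ℝ≥0, ∀ (t : ℕ) (V : Type u), ∃ A : AsyncBA.Algorithm t V, ∀ E : AsyncBA.Ensemble A,
      AsyncBA.Agreement E ∧
      AsyncBA.ProbabilisticTermination E ∧
      AsyncBA.QualitativeValidity E ∧
      ∫⁻ ω, AsyncBA.roundsToDecide E.strategy ω ∂E.law ≤ (C : ℝ≥0∞) ∧
      ∫⁻ ω, AsyncBA.messagesSent ω ∂E.law ≤ (C : ℝ≥0∞) * ((3 * t + 1 : ℕ) : ℝ≥0∞) ^ 2 ∧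
      ∫⁻ ω, AsyncBA.wordsSent ω ∂E.law ≤ (C : ℝ≥0∞) * ((3 * t + 1 : ℕ) : ℝ≥0∞) ^ 2 := by
  -- `220 = 5 * 44`: five words for each of the at most `44 n ^ 2` expected messages; it also
  -- dominates the 99 rounds.
  refine ⟨220, fun t V => ⟨AsyncBA.protocol t V, fun E => ⟨AsyncBA.agreement E,
    AsyncBA.probabilisticTermination E, AsyncBA.qualitativeValidity E,
    (AsyncBA.lintegral_roundsToDecide_le E).trans ?_,
    (AsyncBA.lintegral_messagesSent_le (E := E)).trans ?_,
    (AsyncBA.lintegral_wordsSent_le (E := E)).trans ?_⟩⟩⟩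
  · norm_num
  · gcongr
    norm_num
  · rfl
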